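/- **Proposition 4.5.** Let $k$ be a commutative ring and $H$ a weak Hopf algebra over $k$ with bijective antipode $S$, finitely generated and projective as a $k$-module. *Conventions.* A weak bialgebra is an algebra and coalgebra $H$ with $\Delta(hl)=\Delta(h)\Delta(l)$, $$\Delta^2(1)=(\Delta(1)\otimes 1)(1\otimes\Delta(1))=(1\otimes\Delta(1))(\Delta(1)\otimes 1),$$ $$\varepsilon(hlm)=\varepsilon(hl_{(1)})\varepsilon(l_{(2)}m)=\varepsilon(hl_{(2)})\varepsilon(l_{(1)}m).$$ Put $\varepsilon_t(h)=\varepsilon(1_{(1)}h)1_{(2)}$, $\varepsilon_s(h)=1_{(1)}\varepsilon(h1_{(2)})$, $\overline\varepsilon_s(h)=\varepsilon(1_{(2)}h)1_{(1)}$ and $H_t=\varepsilon_t(H)$. It is a weak Hopf algebra if it has a linear map $S$ (the antipode) with $S*\mathrm{id}=\varepsilon_s$, $\mathrm{id}*S=\varepsilon_t$, $S*\mathrm{id}*S=S$ for the convolution product. For a weak bialgebra $A$, the category ${}_A\mathcal M$ of left $A$-modules is monoidal with product $M\otimes_tN=\Delta(1)(M\otimes N)\subset M\otimes N$ (with action $a(m\otimes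 n)=a_{(1)}m\otimes a_{(2)}n$), unit object $A_t$ (with action $a\rightharpoonup z=\varepsilon_t(az)$), associativity constraint induced by that of $\otimes$, and unit constraints $z\otimes m\mapsto zm$ and $m\otimes z\mapsto\overline\varepsilon_s(z)m$. We write ${}_A\overline{\mathcal M}$ for this category with the reversed tensor product. A left-right Yetter-Drinfeld module is a left $H$-module and right $H$-comodule $M$, with coaction $\rho(m)=m_{[0]}\otimes m_{[1]}$, such that $\rho(m)\in M\otimes_tH$ and $$h_{(1)}m_{[0]}\otimes h_{(2)}m_{[1]}=(h_{(2)}m)_{[0]}\otimes(h_{(2)}m)_{[1]}h_{(1)}\qquad(h\in H,\ m\in M).$$ With $H$-linear and $H$-colinear maps these form the category ${}_H\mathcal{YD}^H$. Its tensor product is $M\otimes_tN$ with coaction $\rho(1_{(1)}m\otimes1_{(2)}n)=m_{[0]}\otimes n_{[0]}\otimes n_{[1]}m_{[1]}$, its unit object is $H_t$ with coaction $\rho(z)=z_{(2)}\otimes S^{-1}(z_{(1)})$, and its constraints are those of ${}_H\mathcal M$. Let $H\bowtie H^*$ be the $k$-module $H\otimes H^*$ with multiplication $$(h\bowtie h^*)(l\bowtie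 l^*)=hl_{(2)}\bowtie\big(S^{-1}(l_{(1)})\rightharpoonup h^*\leftharpoonup l_{(3)}\big)*l^*,\qquad \langle a\rightharpoonup h^*\leftharpoonup c,x\rangle=\langle h^*,cxa\rangle ,$$ let $p(x)=(1\bowtie\varepsilon)x$, and let $D(H)=(H\bowtie H^*)/\mathrm{Ker}\,p$ be the Drinfeld double, with unit $[1\bowtie\varepsilon]$ and $$\Delta[h\bowtie h^*]=[h_{(2)}\bowtie h^*_{(1)}]\otimes[h_{(1)}\bowtie h^*_{(2)}],\qquad\varepsilon[h\bowtie h^*]=\langle h^*,1_{(2)}\rangle\,\varepsilon(h1_{(1)}),$$ where $\langle h^*_{(1)},x\rangle\langle h^*_{(2)},y\rangle=\langle h^*,xy\rangle$. *Claim.* All these structures are well defined: $H\bowtie H^*$ is associative; $e=1\bowtie\varepsilon$ satisfies $ex=xe=xe^2$ for all $x\in H\bowtie H^*$, so that $D(H)$ is an algebra with unit $[e]$; $D(H)$ is a weak bialgebra; ${}_H\mathcal{YD}^H$ is a monoidal category. For every Yetter-Drinfeld module $M$, $$[h\bowtie h^*]\,m=\langle h^*,m_{[1]}\rangle\,h\,m_{[0]}$$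 is a well-defined $D(H)$-module structure on $M$, and the functor $$F:{}_H\mathcal{YD}^H\to{}_{D(H)}\overline{\mathcal M},\qquad F(M)=M,\quad F(f)=f,$$ is an isomorphism of monoidal categories: it has a strict inverse functor, and it is a strong monoidal functor whose structure isomorphisms $F(N)\otimes_tF(M)\to F(M\otimes_tN)$ are given by the switch map $n\otimes m\mapsto m\otimes n$. -/

import Mathlib

open CategoryTheory TensorProduct

universe u v w

set_option linter.unusedSectionVars false

/-! ## Weak bialgebras -/

/-- A weak bialgebra over `k`. -/
class WeakBialgebra (k : Type u) (A : Type v) [CommRing k] [Ring A] [Algebra k A]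
    [Coalgebra k A] : Prop where
  comul_mul : ∀ a b : A,
    Coalgebra.comul (R := k) (a * b) = Coalgebra.comul a * Coalgebra.comul b
  comul_comul_one :
    (Coalgebra.comul (R := k) (A := A)).lTensor A (Coalgebra.comul 1) =
      TensorProduct.assoc k A A A (Coalgebra.comul 1 ⊗ₜ[k] 1) *
        ((1 : A) ⊗ₜ[k] Coalgebra.comul (R := k) (1 : A))
  comul_comul_one' :
    (Coalgebra.comul (R := k) (A := A)).lTensor A (Coalgebra.comul 1) =
      ((1 : A) ⊗ₜ[k] Coalgebra.comul (R := k) (1 : A)) *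
        TensorProduct.assoc k A A A (Coalgebra.comul 1 ⊗ₜ[k] 1)
  counit_mul_mul : ∀ a b c : A,
    Coalgebra.counit (R := k) (a * b * c) =
      LinearMap.mul' k k (TensorProduct.map
        (Coalgebra.counit (R := k) ∘ₗ LinearMap.mulLeft k a)
        (Coalgebra.counit (R := k) ∘ₗ LinearMap.mulRight k c) (Coalgebra.comul b))
  counit_mul_mul' : ∀ a b c : A,
    Coalgebra.counit (R := k) (a * b * c) =
      LinearMap.mul' k k (TensorProduct.map
        (Coalgebra.counit (R := k) ∘ₗ LinearMap.mulRight k c)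
        (Coalgebra.counit (R := k) ∘ₗ LinearMap.mulLeft k a) (Coalgebra.comul b))

namespace WeakBialgebra

section Maps

variable (k : Type u) (A : Type v) [CommRing k] [Ring A] [Algebra k A] [Coalgebra k A]

/-- `a ⊗ b ↦ (h ↦ ε(a h) b)`. -/
noncomputable def contractLeftMul : A ⊗[k] A →ₗ[k] A →ₗ[k] A :=
  TensorProduct.lift (LinearMap.mk₂ k
    (fun a b => (Coalgebra.counit (R := k) ∘ₗ LinearMap.mulLeft k a).smulRight b)
    (by intros; ext; simp [add_mul, add_smul]) (by intros; ext; simp [mul_smul])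
    (by intros; ext; simp) (by intro c a b; ext x; simp [smul_smul, mul_comm]))

/-- `a ⊗ b ↦ (h ↦ ε(h a) b)`. -/
noncomputable def contractRightMul : A ⊗[k] A →ₗ[k] A →ₗ[k] A :=
  TensorProduct.lift (LinearMap.mk₂ k
    (fun a b => (Coalgebra.counit (R := k) ∘ₗ LinearMap.mulRight k a).smulRight b)
    (by intros; ext; simp [mul_add, add_smul]) (by intros; ext; simp [mul_smul])
    (by intros; ext; simp) (by intro c a b; ext x; simp [smul_smul, mul_comm]))

/-- The target map `ε_t(h) = ε(1₍₁₎ h) 1₍₂₎`. -/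
noncomputable def epsT : A →ₗ[k] A := contractLeftMul k A (Coalgebra.comul 1)

/-- The source map `ε_s(h) = 1₍₁₎ ε(h 1₍₂₎)`. -/
noncomputable def epsS : A →ₗ[k] A :=
  contractRightMul k A (TensorProduct.comm k A A (Coalgebra.comul 1))

/-- The source map of the opposite algebra, `h ↦ ε(1₍₂₎ h) 1₍₁₎`. -/
noncomputable def epsSBar : A →ₗ[k] A :=
  contractLeftMul k A (TensorProduct.comm k A A (Coalgebra.comul 1))

/-- The target map of the opposite algebra, `h ↦ ε(h 1₍₁₎) 1₍₂₎`. -/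
noncomputable def epsTBar : A →ₗ[k] A := contractRightMul k A (Coalgebra.comul 1)

variable {k A}

@[simp] theorem contractLeftMul_tmul (a b h : A) :
    contractLeftMul k A (a ⊗ₜ b) h = Coalgebra.counit (R := k) (a * h) • b := rfl

@[simp] theorem contractRightMul_tmul (a b h : A) :
    contractRightMul k A (a ⊗ₜ b) h = Coalgebra.counit (R := k) (h * a) • b := rfl

end Maps

section Identities

variable {k : Type u} {A : Type v} [CommRing k] [Ring A] [Algebra k A] [Coalgebra k A]
  [WeakBialgebra k A]

theorem comul_one_mul (a : A) :
    Coalgebra.comul (R := k) (1 : A) * Coalgebra.comul a = Coalgebra.comul a := by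
  rw [← comul_mul, one_mul]

theorem comul_mul_one (a : A) :
    Coalgebra.comul (R := k) a * Coalgebra.comul (1 : A) = Coalgebra.comul a := by
  rw [← comul_mul, mul_one]

/-- `ε(a₍₁₎ g) a₍₂₎ = a ε_t(g)`. -/
theorem contractLeftMul_comul (a g : A) :
    contractLeftMul k A (Coalgebra.comul a) g = a * epsT k A g := by
  let Ψ : A ⊗[k] A → (A ⊗[k] (A ⊗[k] A) →ₗ[k] A) := fun s =>
    (TensorProduct.lid k A).toLinearMap ∘ₗ TensorProduct.map
      (Coalgebra.counit (R := k) ∘ₗ LinearMap.mulRight k g)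
      ((TensorProduct.lid k A).toLinearMap ∘ₗ (Coalgebra.counit (R := k) (A := A)).rTensor A ∘ₗ
        LinearMap.mulLeft k s)
  have hΨ : ∀ s t : A ⊗[k] A, contractLeftMul k A (s * t) g =
      Ψ s (TensorProduct.assoc k A A A ((Coalgebra.comul (R := k) (A := A)).rTensor A t)) := by
    intro s t
    induction t with
    | zero => simp
    | add t₁ t₂ h₁ h₂ => simp only [mul_add, map_add, LinearMap.add_apply, h₁, h₂]
    | tmul b c =>
      induction s with
      | zero => simp [Ψ]
      | add s₁ s₂ h₁ h₂ =>
        rw [add_mul, map_add, LinearMap.add_apply, h₁, h₂]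
        generalize TensorProduct.assoc k A A A _ = X
        induction X with
        | zero => simp
        | add X Y hX hY => simp only [map_add, ← hX, ← hY]; abel
        | tmul u X => simp [Ψ, add_mul, smul_add]
      | tmul p q =>
        have e := counit_mul_mul' (k := k) p b g
        simp only [Algebra.TensorProduct.tmul_mul_tmul, contractLeftMul_tmul,
          LinearMap.rTensor_tmul, e]
        generalize Coalgebra.comul (R := k) b = X
        induction X with
        | zero => simp
        | add X Y hX hY => simp only [map_add, add_smul, hX, hY, TensorProduct.add_tmul]
        | tmul u w => simp [Ψ, smul_smul, mul_comm]
  rw [← comul_mul_one (k := k) a, hΨ, Coalgebra.coassoc_apply, epsT]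
  have key : ∀ t : A ⊗[k] A, Ψ (Coalgebra.comul a)
      ((Coalgebra.comul (R := k) (A := A)).lTensor A t) = a * contractLeftMul k A t g := by
    intro t
    induction t with
    | zero => simp
    | add t₁ t₂ h₁ h₂ => simp only [mul_add, map_add, LinearMap.add_apply, h₁, h₂]
    | tmul b c => simp [Ψ, ← comul_mul]
  exact key _

/-- `ε(a₍₂₎ g) a₍₁₎ = a ε̄_s(g)`. -/
theorem contractLeftMul_comm_comul (a g : A) :
    contractLeftMul k A (TensorProduct.comm k A A (Coalgebra.comul a)) g =
      a * epsSBar k A g := by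
  let Ψ : A ⊗[k] A → ((A ⊗[k] A) ⊗[k] A →ₗ[k] A) := fun s =>
    (TensorProduct.rid k A).toLinearMap ∘ₗ TensorProduct.map
      ((TensorProduct.rid k A).toLinearMap ∘ₗ (Coalgebra.counit (R := k) (A := A)).lTensor A ∘ₗ
        LinearMap.mulLeft k s)
      (Coalgebra.counit (R := k) ∘ₗ LinearMap.mulRight k g)
  have hΨ : ∀ s t : A ⊗[k] A,
      contractLeftMul k A (TensorProduct.comm k A A (s * t)) g =
      Ψ s ((TensorProduct.assoc k A A A).symm
        ((Coalgebra.comul (R := k) (A := A)).lTensor A t)) := by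
    intro s t
    induction t with
    | zero => simp
    | add t₁ t₂ h₁ h₂ => simp only [mul_add, map_add, LinearMap.add_apply, h₁, h₂]
    | tmul b c =>
      induction s with
      | zero => simp [Ψ]
      | add s₁ s₂ h₁ h₂ =>
        rw [add_mul, map_add, map_add, LinearMap.add_apply, h₁, h₂]
        generalize (TensorProduct.assoc k A A A).symm _ = X
        induction X with
        | zero => simp
        | add X Y hX hY => simp only [map_add, ← hX, ← hY]; abel
        | tmul X u => simp [Ψ, add_mul, smul_add]
      | tmul p q =>
        have e := counit_mul_mul (k := k) q c g
        simp only [Algebra.TensorProduct.tmul_mul_tmul, TensorProduct.comm_tmul,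
          contractLeftMul_tmul, LinearMap.lTensor_tmul, e]
        generalize Coalgebra.comul (R := k) c = X
        induction X with
        | zero => simp
        | add X Y hX hY => simp only [map_add, add_smul, hX, hY, TensorProduct.tmul_add]
        | tmul u w => simp [Ψ, smul_smul, mul_comm]
  rw [← comul_mul_one (k := k) a, hΨ, ← Coalgebra.coassoc_apply, LinearEquiv.symm_apply_apply,
    epsSBar]
  have key : ∀ t : A ⊗[k] A, Ψ (Coalgebra.comul a)
      ((Coalgebra.comul (R := k) (A := A)).rTensor A t) =
        a * contractLeftMul k A (TensorProduct.comm k A A t) g := by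
    intro t
    induction t with
    | zero => simp
    | add t₁ t₂ h₁ h₂ => simp only [mul_add, map_add, LinearMap.add_apply, h₁, h₂]
    | tmul b c => simp [Ψ, ← comul_mul]
  exact key _

/-- `ε(c a₍₁₎) a₍₂₎ = ε̄_t(c) a`. -/
theorem contractRightMul_comul (a g : A) :
    contractRightMul k A (Coalgebra.comul a) g = epsTBar k A g * a := by
  let Ψ : A ⊗[k] A → (A ⊗[k] (A ⊗[k] A) →ₗ[k] A) := fun s =>
    (TensorProduct.lid k A).toLinearMap ∘ₗ TensorProduct.map
      (Coalgebra.counit (R := k) ∘ₗ LinearMap.mulLeft k g)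
      ((TensorProduct.lid k A).toLinearMap ∘ₗ (Coalgebra.counit (R := k) (A := A)).rTensor A ∘ₗ
        LinearMap.mulRight k s)
  have hΨ : ∀ s t : A ⊗[k] A, contractRightMul k A (t * s) g =
      Ψ s (TensorProduct.assoc k A A A ((Coalgebra.comul (R := k) (A := A)).rTensor A t)) := by
    intro s t
    induction t with
    | zero => simp
    | add t₁ t₂ h₁ h₂ => simp only [add_mul, map_add, LinearMap.add_apply, h₁, h₂]
    | tmul b c =>
      induction s with
      | zero => simp [Ψ]
      | add s₁ s₂ h₁ h₂ =>
        rw [mul_add, map_add, LinearMap.add_apply, h₁, h₂]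
        generalize TensorProduct.assoc k A A A _ = X
        induction X with
        | zero => simp
        | add X Y hX hY => simp only [map_add, ← hX, ← hY]; abel
        | tmul u X => simp [Ψ, mul_add, smul_add]
      | tmul p q =>
        have e := counit_mul_mul (k := k) g b p
        simp only [Algebra.TensorProduct.tmul_mul_tmul, contractRightMul_tmul,
          LinearMap.rTensor_tmul, ← mul_assoc, e]
        generalize Coalgebra.comul (R := k) b = X
        induction X with
        | zero => simp
        | add X Y hX hY => simp only [map_add, add_smul, hX, hY, TensorProduct.add_tmul]
        | tmul u w => simp [Ψ, smul_smul, mul_comm]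
  rw [← comul_one_mul (k := k) a, hΨ, Coalgebra.coassoc_apply, epsTBar]
  have key : ∀ t : A ⊗[k] A, Ψ (Coalgebra.comul a)
      ((Coalgebra.comul (R := k) (A := A)).lTensor A t) = contractRightMul k A t g * a := by
    intro t
    induction t with
    | zero => simp
    | add t₁ t₂ h₁ h₂ => simp only [add_mul, map_add, LinearMap.add_apply, h₁, h₂]
    | tmul b c => simp [Ψ, ← comul_mul]
  exact key _

/-- `ε(a ε_t(g)) = ε(a g)`. -/
theorem counit_mul_epsT (a g : A) :
    Coalgebra.counit (R := k) (a * epsT k A g) = Coalgebra.counit (R := k) (a * g) := by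
  have e := counit_mul_mul' (k := k) a 1 g
  rw [mul_one] at e
  rw [e, epsT]
  generalize Coalgebra.comul (R := k) (1 : A) = X
  induction X with
  | zero => simp
  | add X Y hX hY => simp only [map_add, mul_add, LinearMap.add_apply, hX, hY]
  | tmul u w => simp

/-- Contractions only depend on the target part of the argument. -/
theorem contractLeftMul_epsT (t : A ⊗[k] A) (g : A) :
    contractLeftMul k A t (epsT k A g) = contractLeftMul k A t g := by
  induction t with
  | zero => simp
  | add X Y hX hY => simp only [map_add, LinearMap.add_apply, hX, hY]
  | tmul u w => simp [counit_mul_epsT]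

theorem contractLeftMul_mul_epsT (t : A ⊗[k] A) (h g : A) :
    contractLeftMul k A t (h * epsT k A g) = contractLeftMul k A t (h * g) := by
  induction t with
  | zero => simp
  | add X Y hX hY => simp only [map_add, LinearMap.add_apply, hX, hY]
  | tmul u w => simp [← mul_assoc, counit_mul_epsT]

theorem epsT_mul_epsT (h g : A) : epsT k A (h * epsT k A g) = epsT k A (h * g) :=
  contractLeftMul_mul_epsT _ h g

theorem epsT_epsT (g : A) : epsT k A (epsT k A g) = epsT k A g := contractLeftMul_epsT _ g

theorem epsSBar_epsT (g : A) : epsSBar k A (epsT k A g) = epsSBar k A g :=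
  contractLeftMul_epsT _ g

theorem epsT_one : epsT k A 1 = 1 := by
  have := contractLeftMul_comul (k := k) (1 : A) 1
  rw [one_mul] at this
  rw [← this]
  have h := congrArg (TensorProduct.lid k A) (Coalgebra.rTensor_counit_comul (R := k) (1 : A))
  simp only [TensorProduct.lid_tmul, one_smul] at h
  conv_rhs => rw [← h]
  generalize Coalgebra.comul (R := k) (1 : A) = X
  induction X with
  | zero => simp
  | add X Y hX hY => simp only [map_add, LinearMap.add_apply, hX, hY]
  | tmul u w => simp

theorem epsSBar_one : epsSBar k A 1 = 1 := by
  have := contractLeftMul_comm_comul (k := k) (1 : A) 1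
  rw [one_mul] at this
  rw [← this]
  have h := congrArg (TensorProduct.rid k A) (Coalgebra.lTensor_counit_comul (R := k) (1 : A))
  simp only [TensorProduct.rid_tmul, one_smul] at h
  conv_rhs => rw [← h]
  generalize Coalgebra.comul (R := k) (1 : A) = X
  induction X with
  | zero => simp
  | add X Y hX hY => simp only [map_add, LinearMap.add_apply, hX, hY]
  | tmul u w => simp

/-- `Δ(z) = 1₍₁₎ z ⊗ 1₍₂₎` for `z` in the target space. -/
theorem comul_epsT (g : A) :
    Coalgebra.comul (R := k) (epsT k A g) = Coalgebra.comul 1 * (epsT k A g ⊗ₜ[k] 1) := by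
  let Θ : A ⊗[k] (A ⊗[k] A) →ₗ[k] A ⊗[k] A :=
    (TensorProduct.lid k (A ⊗[k] A)).toLinearMap ∘ₗ
      (Coalgebra.counit (R := k) ∘ₗ LinearMap.mulRight k g).rTensor (A ⊗[k] A)
  have h := congrArg Θ (comul_comul_one' (k := k) (A := A))
  have h1 : ∀ t : A ⊗[k] A, Θ ((Coalgebra.comul (R := k) (A := A)).lTensor A t) =
      Coalgebra.comul (contractLeftMul k A t g) := by
    intro t
    induction t with
    | zero => simp
    | add X Y hX hY => simp only [map_add, LinearMap.add_apply, hX, hY]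
    | tmul u w => simp [Θ]
  have h2 : ∀ s t : A ⊗[k] A, Θ (((1 : A) ⊗ₜ[k] s) *
      TensorProduct.assoc k A A A (t ⊗ₜ[k] 1)) = s * (contractLeftMul k A t g ⊗ₜ[k] 1) := by
    intro s t
    induction t with
    | zero => simp
    | add X Y hX hY =>
      simp only [map_add, LinearMap.add_apply, TensorProduct.add_tmul, mul_add, hX, hY]
    | tmul u w =>
      simp only [contractLeftMul_tmul, ← TensorProduct.smul_tmul', mul_smul_comm]
      simp [Θ]
  rw [h1, h2] at h
  exact h

/-- `ε_t(1₍₁₎ z) ⊗ 1₍₂₎ = ε_t(1₍₁₎) ⊗ 1₍₂₎ z` for `z` in the target space. -/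
theorem rTensor_epsT_comul_one_mul (g : A) :
    (epsT k A).rTensor A (Coalgebra.comul 1 * (epsT k A g ⊗ₜ[k] 1)) =
      (epsT k A).rTensor A (Coalgebra.comul 1) * (1 ⊗ₜ[k] epsT k A g) := by
  rw [← comul_epsT]
  have key : ∀ h : A, (epsT k A).rTensor A (Coalgebra.comul h) =
      (epsT k A).rTensor A (Coalgebra.comul 1) * (1 ⊗ₜ[k] h) := by
    intro h
    have aux : ∀ (c d : A) (t : A ⊗[k] A), (contractLeftMul k A (c ⊗ₜ[k] d)).rTensor A t =
        d ⊗ₜ[k] contractRightMul k A t c := by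
      intro c d t
      induction t with
      | zero => simp
      | add X Y hX hY =>
        simp only [map_add, LinearMap.add_apply, TensorProduct.tmul_add, hX, hY]
      | tmul p q => simp [TensorProduct.smul_tmul]
    have main : ∀ s : A ⊗[k] A, (contractLeftMul k A s).rTensor A (Coalgebra.comul h) =
        (contractLeftMul k A s).rTensor A (Coalgebra.comul 1) * (1 ⊗ₜ[k] h) := by
      intro s
      induction s with
      | zero => simp
      | add X Y hX hY =>
        rw [map_add, LinearMap.rTensor_add, LinearMap.add_apply, LinearMap.add_apply, hX, hY,
          add_mul]
      | tmul c d =>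
        rw [aux, aux, contractRightMul_comul, contractRightMul_comul]
        simp
    exact main _
  exact key _

/-- `1₍₁₎ ε̄_s(g) ⊗ 1₍₂₎ = 1₍₁₎ ⊗ ε_t(1₍₂₎ g) = 1₍₁₎ ⊗ 1₍₂₎ ε_t(g)`. -/
theorem comul_one_epsSBar (g : A) :
    Coalgebra.comul 1 * (epsSBar k A g ⊗ₜ[k] 1) =
      (epsT k A ∘ₗ LinearMap.mulRight k g).lTensor A (Coalgebra.comul 1) ∧
    Coalgebra.comul 1 * (epsSBar k A g ⊗ₜ[k] 1) =
      Coalgebra.comul 1 * ((1 : A) ⊗ₜ[k] epsT k A g) := by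
  let Θ : A ⊗[k] (A ⊗[k] A) →ₗ[k] A ⊗[k] A :=
    ((TensorProduct.lid k A).toLinearMap ∘ₗ
      (Coalgebra.counit (R := k) ∘ₗ LinearMap.mulRight k g).rTensor A).lTensor A
  have aux : ∀ t : A ⊗[k] A, (TensorProduct.lid k A) ((Coalgebra.counit (R := k) ∘ₗ
      LinearMap.mulRight k g).rTensor A t) = contractLeftMul k A t g := by
    intro t
    induction t with
    | zero => simp
    | add X Y hX hY => simp only [map_add, LinearMap.add_apply, hX, hY]
    | tmul u w => simp
  have h1 : ∀ t : A ⊗[k] A, Θ ((Coalgebra.comul (R := k) (A := A)).lTensor A t) =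
      t * (1 ⊗ₜ[k] epsT k A g) := by
    intro t
    induction t with
    | zero => simp
    | add X Y hX hY => simp only [map_add, add_mul, hX, hY]
    | tmul u w =>
      simp only [Θ, LinearMap.lTensor_tmul, LinearMap.comp_apply, LinearEquiv.coe_coe]
      rw [aux, contractLeftMul_comul]
      simp
  have h2 : ∀ t : A ⊗[k] A, Θ (TensorProduct.assoc k A A A
      ((Coalgebra.comul (R := k) (A := A)).rTensor A t)) = t * (epsSBar k A g ⊗ₜ[k] 1) := by
    intro t
    induction t with
    | zero => simp
    | add X Y hX hY => simp only [map_add, add_mul, hX, hY]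
    | tmul u w =>
      have : ∀ s : A ⊗[k] A, Θ (TensorProduct.assoc k A A A (s ⊗ₜ[k] w)) =
          contractLeftMul k A (TensorProduct.comm k A A s) g ⊗ₜ[k] w := by
        intro s
        induction s with
        | zero => simp
        | add X Y hX hY =>
          simp only [map_add, TensorProduct.add_tmul, LinearMap.add_apply, hX, hY]
        | tmul p q => simp [Θ, TensorProduct.smul_tmul]
      rw [LinearMap.rTensor_tmul, this, contractLeftMul_comm_comul]
      simp
  have h3 : ∀ s t : A ⊗[k] A, Θ (((1 : A) ⊗ₜ[k] s) *
      TensorProduct.assoc k A A A (t ⊗ₜ[k] 1)) =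
        (contractLeftMul k A s ∘ₗ LinearMap.mulRight k g).lTensor A t := by
    intro s t
    induction t with
    | zero => simp
    | add X Y hX hY => simp only [map_add, TensorProduct.add_tmul, mul_add, hX, hY]
    | tmul u w =>
      simp only [Θ, TensorProduct.assoc_tmul, Algebra.TensorProduct.tmul_mul_tmul, one_mul,
        LinearMap.lTensor_tmul, LinearMap.comp_apply, LinearEquiv.coe_coe]
      rw [aux]
      congr 1
      induction s with
      | zero => simp
      | add X Y hX hY => simp only [add_mul, map_add, LinearMap.add_apply, hX, hY]
      | tmul p q => simp [mul_assoc]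
  have e := Coalgebra.coassoc_apply (R := k) (1 : A)
  have e1 := congrArg Θ e
  rw [h2, h1] at e1
  refine ⟨?_, e1⟩
  rw [e1, ← h1, comul_comul_one', h3]
  rfl

/-- `1₍₁₎ ⊗ ε_t(1₍₂₎) = 1₍₁₎ ⊗ 1₍₂₎`. -/
theorem lTensor_epsT_comul_one :
    (epsT k A).lTensor A (Coalgebra.comul 1) = Coalgebra.comul 1 := by
  have h := (comul_one_epsSBar (k := k) (1 : A)).1
  rw [epsSBar_one, ← Algebra.TensorProduct.one_def, mul_one, LinearMap.mulRight_one,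
    LinearMap.comp_id] at h
  exact h.symm

end Identities

end WeakBialgebra

/-! ## Modules over a `k`-algebra -/

/-- A left module over the `k`-algebra `A`: a `k`-module with a compatible action of `A`. -/
structure AlgMod (k : Type u) (A : Type v) [CommRing k] [Ring A] [Algebra k A] where
  carrier : Type w
  [addCommGroup : AddCommGroup carrier]
  [baseModule : Module k carrier]
  [module : Module A carrier]
  [isScalarTower : IsScalarTower k A carrier]

namespace AlgMod

attribute [instance] addCommGroup baseModule module isScalarTower

section Category

variable {k : Type u} {A : Type v} [CommRing k] [Ring A] [Algebra k A]

instance : CoeSort (AlgMod.{u, v, w} k A) (Type w) := ⟨carrier⟩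

/-- Morphisms are the `A`-linear maps. -/
@[ext]
structure Hom (M N : AlgMod.{u, v, w} k A) where
  hom : M →ₗ[A] N

instance : Category (AlgMod.{u, v, w} k A) where
  Hom M N := Hom M N
  id M := ⟨LinearMap.id⟩
  comp f g := ⟨g.hom ∘ₗ f.hom⟩

@[ext] theorem hom_ext {M N : AlgMod.{u, v, w} k A} {f g : M ⟶ N} (h : ∀ x, f.hom x = g.hom x) :
    f = g := Hom.ext (LinearMap.ext h)

@[simp] theorem id_hom (M : AlgMod.{u, v, w} k A) : Hom.hom (𝟙 M) = LinearMap.id := rfl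

@[simp] theorem comp_hom {M N P : AlgMod.{u, v, w} k A} (f : M ⟶ N) (g : N ⟶ P) :
    (f ≫ g).hom = g.hom ∘ₗ f.hom := rfl

/-- The underlying `k`-linear map of a morphism. -/
def Hom.lin {M N : AlgMod.{u, v, w} k A} (f : M ⟶ N) : M →ₗ[k] N := f.hom.restrictScalars k

@[simp] theorem Hom.lin_apply {M N : AlgMod.{u, v, w} k A} (f : M ⟶ N) (x : M) :
    Hom.lin f x = f.hom x := rfl

/-- An `A`-linear equivalence is an isomorphism. -/
def isoOfEquiv {M N : AlgMod.{u, v, w} k A} (e : M ≃ₗ[A] N) : M ≅ N where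
  hom := ⟨e.toLinearMap⟩
  inv := ⟨e.symm.toLinearMap⟩
  hom_inv_id := by ext x; simp
  inv_hom_id := by ext x; simp

@[simp] theorem isoOfEquiv_hom {M N : AlgMod.{u, v, w} k A} (e : M ≃ₗ[A] N) :
    (isoOfEquiv e).hom.hom = e.toLinearMap := rfl

end Category

section Action

variable {k : Type u} [CommRing k]

/-- The action of `A ⊗ B` on `M ⊗ N` built from an action of `A` on `M` and of `B` on `N`. -/
noncomputable def actHom {A B M N : Type*} [Ring A] [Algebra k A] [Ring B] [Algebra k B]
    [AddCommGroup M] [Module k M] [AddCommGroup N] [Module k N]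
    (f : A →ₐ[k] Module.End k M) (g : B →ₐ[k] Module.End k N) :
    A ⊗[k] B →ₐ[k] Module.End k (M ⊗[k] N) :=
  (Module.endTensorEndAlgHom (R := k) (S := k) (A := k)).comp (Algebra.TensorProduct.map f g)

@[simp] theorem actHom_tmul {A B M N : Type*} [Ring A] [Algebra k A] [Ring B] [Algebra k B]
    [AddCommGroup M] [Module k M] [AddCommGroup N] [Module k N]
    (f : A →ₐ[k] Module.End k M) (g : B →ₐ[k] Module.End k N) (a : A) (b : B) :
    actHom f g (a ⊗ₜ b) = TensorProduct.map (f a) (g b) := rfl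

/-- The action `(a ⊗ b)(m ⊗ n) = a m ⊗ b n` of `A ⊗ A` on `M ⊗ N`. -/
noncomputable def act (A : Type*) (M N : Type*) [Ring A] [Algebra k A]
    [AddCommGroup M] [Module k M] [Module A M] [IsScalarTower k A M]
    [AddCommGroup N] [Module k N] [Module A N] [IsScalarTower k A N] :
    A ⊗[k] A →ₐ[k] Module.End k (M ⊗[k] N) :=
  actHom (Algebra.lsmul k k M) (Algebra.lsmul k k N)

@[simp] theorem act_tmul_tmul {A : Type*} {M N : Type*} [Ring A] [Algebra k A]
    [AddCommGroup M] [Module k M] [Module A M] [IsScalarTower k A M]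
    [AddCommGroup N] [Module k N] [Module A N] [IsScalarTower k A N]
    (a b : A) (m : M) (n : N) :
    act A M N (a ⊗ₜ[k] b) (m ⊗ₜ[k] n) = (a • m) ⊗ₜ[k] (b • n) := rfl

end Action

section Tensor

variable {k : Type u} {A : Type v} [CommRing k] [Ring A] [Algebra k A] [Coalgebra k A]

/-- `M ⊗_t N = Δ(1)(M ⊗ N)`. -/
noncomputable def tensorSubmodule (M N : AlgMod.{u, v, w} k A) : Submodule k (M ⊗[k] N) :=
  LinearMap.range (act A M N (Coalgebra.comul (R := k) (1 : A)))

variable [WeakBialgebra k A]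

open WeakBialgebra

theorem act_comul_mem (M N : AlgMod.{u, v, w} k A) (a : A) (x : M ⊗[k] N) :
    act A M N (Coalgebra.comul a) x ∈ tensorSubmodule M N :=
  ⟨act A M N (Coalgebra.comul a) x, by
    rw [← Module.End.mul_apply, ← map_mul, comul_one_mul]⟩

theorem act_comul_one (M N : AlgMod.{u, v, w} k A) (x : tensorSubmodule M N) :
    act A M N (Coalgebra.comul (R := k) (1 : A)) (x : M ⊗[k] N) = x := by
  obtain ⟨x, y, rfl⟩ := x
  rw [← Module.End.mul_apply, ← map_mul, comul_one_mul]

/-- The diagonal action `a (m ⊗ n) = a₍₁₎ m ⊗ a₍₂₎ n` on `M ⊗_t N`. -/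
noncomputable instance tensorModule (M N : AlgMod.{u, v, w} k A) :
    Module A (tensorSubmodule M N) where
  smul a x := ⟨act A M N (Coalgebra.comul a) x, act_comul_mem M N a x⟩
  one_smul x := Subtype.ext (act_comul_one M N x)
  mul_smul a b x := Subtype.ext (by
    change act A M N (Coalgebra.comul (a * b)) x.1 =
      act A M N (Coalgebra.comul a) (act A M N (Coalgebra.comul b) x.1)
    rw [comul_mul, map_mul, Module.End.mul_apply])
  smul_zero a := Subtype.ext (map_zero (act A M N (Coalgebra.comul a)))
  smul_add a x y := Subtype.ext (map_add (act A M N (Coalgebra.comul a)) x.1 y.1)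
  add_smul a b x := Subtype.ext (by
    change act A M N (Coalgebra.comul (a + b)) x.1 =
      act A M N (Coalgebra.comul a) x.1 + act A M N (Coalgebra.comul b) x.1
    rw [map_add, map_add, LinearMap.add_apply])
  zero_smul x := Subtype.ext (by
    change act A M N (Coalgebra.comul 0) x.1 = 0
    rw [map_zero, map_zero, LinearMap.zero_apply])

theorem smul_coe (M N : AlgMod.{u, v, w} k A) (a : A) (x : tensorSubmodule M N) :
    ((a • x : tensorSubmodule M N) : M ⊗[k] N) = act A M N (Coalgebra.comul a) x := rfl

instance (M N : AlgMod.{u, v, w} k A) : IsScalarTower k A (tensorSubmodule M N) where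
  smul_assoc c a x := Subtype.ext (by
    rw [smul_coe, map_smul, map_smul, LinearMap.smul_apply]; rfl)

/-- The tensor product `M ⊗_t N`. -/
noncomputable def tensor (M N : AlgMod.{u, v, w} k A) : AlgMod.{u, v, w} k A where
  carrier := tensorSubmodule M N

/-- The inclusion `M ⊗_t N → M ⊗ N`. -/
noncomputable def incl (M N : AlgMod.{u, v, w} k A) : tensor M N →ₗ[k] M ⊗[k] N :=
  (tensorSubmodule M N).subtype

/-- The projection `π : M ⊗ N → M ⊗_t N`, `π(m ⊗ n) = 1₍₁₎ m ⊗ 1₍₂₎ n`. -/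
noncomputable def proj (M N : AlgMod.{u, v, w} k A) : M ⊗[k] N →ₗ[k] tensor M N :=
  (act A M N (Coalgebra.comul (R := k) (1 : A))).rangeRestrict

/-- The element `1₍₁₎ m ⊗ 1₍₂₎ n` of `M ⊗_t N`. -/
noncomputable def tm {M N : AlgMod.{u, v, w} k A} (m : M) (n : N) : tensor M N :=
  proj M N (m ⊗ₜ[k] n)

theorem incl_injective (M N : AlgMod.{u, v, w} k A) : Function.Injective (incl M N) :=
  Subtype.val_injective

theorem incl_proj (M N : AlgMod.{u, v, w} k A) (x : M ⊗[k] N) :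
    incl M N (proj M N x) = act A M N (Coalgebra.comul (R := k) (1 : A)) x := rfl

theorem incl_tm {M N : AlgMod.{u, v, w} k A} (m : M) (n : N) :
    incl M N (tm m n) = act A M N (Coalgebra.comul (R := k) (1 : A)) (m ⊗ₜ n) := rfl

theorem incl_smul (M N : AlgMod.{u, v, w} k A) (a : A) (x : tensor M N) :
    incl M N (a • x) = act A M N (Coalgebra.comul a) (incl M N x) := rfl

theorem proj_surjective (M N : AlgMod.{u, v, w} k A) : Function.Surjective (proj M N) :=
  LinearMap.surjective_rangeRestrict _

theorem proj_incl (M N : AlgMod.{u, v, w} k A) (x : tensor M N) :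
    proj M N (incl M N x) = x := incl_injective M N (act_comul_one M N x)

theorem act_map {M N M' N' : AlgMod.{u, v, w} k A} (f : M ⟶ M') (g : N ⟶ N') (t : A ⊗[k] A)
    (x : M ⊗[k] N) : TensorProduct.map (Hom.lin f) (Hom.lin g) (act A M N t x) =
      act A M' N' t (TensorProduct.map (Hom.lin f) (Hom.lin g) x) := by
  induction t with
  | zero => simp
  | add t₁ t₂ h₁ h₂ => simp only [map_add, LinearMap.add_apply, h₁, h₂]
  | tmul a b =>
    induction x with
    | zero => simp
    | add x y hx hy => simp only [map_add, hx, hy]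
    | tmul m n => simp

/-- The tensor product of two morphisms, the restriction of `f ⊗ g`. -/
noncomputable def tensorMap {M N M' N' : AlgMod.{u, v, w} k A} (f : M ⟶ M') (g : N ⟶ N') :
    tensor M N ⟶ tensor M' N' where
  hom :=
    { toFun := fun x => proj M' N' (TensorProduct.map (Hom.lin f) (Hom.lin g) (incl M N x))
      map_add' := fun x y => by simp only [map_add]
      map_smul' := fun a x => incl_injective M' N' (by
        rw [RingHom.id_apply, incl_proj, incl_smul, incl_smul, incl_proj, act_map,
          ← Module.End.mul_apply, ← Module.End.mul_apply, ← map_mul (act A M' N'),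
          ← map_mul (act A M' N'), comul_one_mul, comul_mul_one]) }

theorem incl_tensorMap {M N M' N' : AlgMod.{u, v, w} k A} (f : M ⟶ M') (g : N ⟶ N')
    (x : tensor M N) : incl M' N' ((tensorMap f g).hom x) =
      TensorProduct.map (Hom.lin f) (Hom.lin g) (incl M N x) := by
  change incl M' N' (proj M' N' _) = _
  rw [incl_proj, ← act_map]
  exact congrArg _ (act_comul_one M N x)

@[simp] theorem tensorMap_tm {M N M' N' : AlgMod.{u, v, w} k A} (f : M ⟶ M') (g : N ⟶ N')
    (m : M) (n : N) : (tensorMap f g).hom (tm m n) = tm (f.hom m) (g.hom n) :=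
  incl_injective M' N' (by
    rw [incl_tensorMap, incl_tm, incl_tm, act_map]
    rfl)

theorem tensor_ext {M N : AlgMod.{u, v, w} k A} {P : Type*} [AddCommGroup P]
    {f g : tensor M N →+ P} (h : ∀ m n, f (tm m n) = g (tm m n)) : f = g := by
  ext x
  obtain ⟨y, rfl⟩ := proj_surjective M N x
  induction y with
  | zero => simp
  | add y z hy hz => simp only [map_add, hy, hz]
  | tmul m n => exact h m n

theorem tensor_hom_ext {M N P : AlgMod.{u, v, w} k A} {f g : tensor M N ⟶ P}
    (h : ∀ m n, f.hom (tm m n) = g.hom (tm m n)) : f = g := by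
  ext x
  exact DFunLike.congr_fun (tensor_ext (f := f.hom.toAddMonoidHom) (g := g.hom.toAddMonoidHom) h) x

/-- `tm` as a bilinear map. -/
noncomputable def tmBilin (M N : AlgMod.{u, v, w} k A) : M →ₗ[k] N →ₗ[k] tensor M N :=
  LinearMap.compr₂ (TensorProduct.mk k M N) (proj M N)

theorem tensor_ext₃ {M N P : AlgMod.{u, v, w} k A} {Q : Type*} [AddCommGroup Q]
    {f g : tensor (tensor M N) P →+ Q} (h : ∀ m n p, f (tm (tm m n) p) = g (tm (tm m n) p)) :
    f = g := by
  refine tensor_ext fun x p => ?_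
  have := tensor_ext (f := f.comp ((tmBilin (tensor M N) P).flip p).toAddMonoidHom)
    (g := g.comp ((tmBilin (tensor M N) P).flip p).toAddMonoidHom) (fun m n => h m n p)
  exact DFunLike.congr_fun this x

theorem tensor_hom_ext₃ {M N P Q : AlgMod.{u, v, w} k A} {f g : tensor (tensor M N) P ⟶ Q}
    (h : ∀ m n p, f.hom (tm (tm m n) p) = g.hom (tm (tm m n) p)) : f = g := by
  ext x
  exact DFunLike.congr_fun
    (tensor_ext₃ (f := f.hom.toAddMonoidHom) (g := g.hom.toAddMonoidHom) h) x

theorem tensor_hom_ext₄ {M N P Q R : AlgMod.{u, v, w} k A}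
    {f g : tensor (tensor (tensor M N) P) Q ⟶ R}
    (h : ∀ m n p q, f.hom (tm (tm (tm m n) p) q) = g.hom (tm (tm (tm m n) p) q)) : f = g := by
  refine tensor_hom_ext fun x q => ?_
  have := tensor_ext₃
    (f := f.hom.toAddMonoidHom.comp ((tmBilin (tensor (tensor M N) P) Q).flip q).toAddMonoidHom)
    (g := g.hom.toAddMonoidHom.comp ((tmBilin (tensor (tensor M N) P) Q).flip q).toAddMonoidHom)
    (fun m n p => h m n p q)
  exact DFunLike.congr_fun this x

/-! ### Associativity -/

/-- The action of `A ⊗ (A ⊗ A)` on `M ⊗ (N ⊗ P)`. -/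
noncomputable def act3 (M N P : AlgMod.{u, v, w} k A) :
    A ⊗[k] (A ⊗[k] A) →ₐ[k] Module.End k (M ⊗[k] (N ⊗[k] P)) :=
  actHom (Algebra.lsmul k k M) (act A N P)

theorem act3_assoc (M N P : AlgMod.{u, v, w} k A) (s : A ⊗[k] A) (b : A) (x : M ⊗[k] N) (p : P) :
    act3 M N P (TensorProduct.assoc k A A A (s ⊗ₜ b)) (TensorProduct.assoc k M N P (x ⊗ₜ p)) =
      TensorProduct.assoc k M N P (act A M N s x ⊗ₜ (b • p)) := by
  induction s with
  | zero => simp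
  | add t₁ t₂ h₁ h₂ => simp only [map_add, LinearMap.add_apply, TensorProduct.add_tmul, h₁, h₂]
  | tmul a c =>
    induction x with
    | zero => simp
    | add x y hx hy => simp only [map_add, TensorProduct.add_tmul, hx, hy]
    | tmul m n => simp [act3]

/-- The inclusion of `(M ⊗_t N) ⊗_t P` in `M ⊗ (N ⊗ P)`. -/
noncomputable def inclLeft (M N P : AlgMod.{u, v, w} k A) :
    tensor (tensor M N) P →ₗ[k] M ⊗[k] (N ⊗[k] P) :=
  (TensorProduct.assoc k M N P).toLinearMap ∘ₗ (incl M N).rTensor P ∘ₗ incl (tensor M N) P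

/-- The inclusion of `M ⊗_t (N ⊗_t P)` in `M ⊗ (N ⊗ P)`. -/
noncomputable def inclRight (M N P : AlgMod.{u, v, w} k A) :
    tensor M (tensor N P) →ₗ[k] M ⊗[k] (N ⊗[k] P) :=
  (incl N P).lTensor M ∘ₗ incl M (tensor N P)

theorem inclLeft_injective (M N P : AlgMod.{u, v, w} k A) :
    Function.Injective (inclLeft M N P) := by
  refine (TensorProduct.assoc k M N P).injective.comp
    (Function.Injective.comp (g := (incl M N).rTensor P) ?_ (incl_injective (tensor M N) P))
  refine Function.LeftInverse.injective (g := (proj M N).rTensor P) fun x => ?_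
  rw [← LinearMap.comp_apply, ← LinearMap.rTensor_comp]
  have : proj M N ∘ₗ (incl M N) = LinearMap.id :=
    LinearMap.ext (proj_incl M N)
  rw [this, LinearMap.rTensor_id, LinearMap.id_apply]

theorem inclRight_injective (M N P : AlgMod.{u, v, w} k A) :
    Function.Injective (inclRight M N P) := by
  refine Function.Injective.comp (g := (incl N P).lTensor M) ?_ (incl_injective M (tensor N P))
  refine Function.LeftInverse.injective (g := (proj N P).lTensor M) fun x => ?_
  rw [← LinearMap.comp_apply, ← LinearMap.lTensor_comp]
  have : proj N P ∘ₗ (incl N P) = LinearMap.id :=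
    LinearMap.ext (proj_incl N P)
  rw [this, LinearMap.lTensor_id, LinearMap.id_apply]

theorem assoc_act (M N P : AlgMod.{u, v, w} k A) (t : A ⊗[k] A) (y : tensor M N ⊗[k] P) :
    TensorProduct.assoc k M N P ((incl M N).rTensor P
      (act A (tensor M N) P t y)) =
    act3 M N P (TensorProduct.assoc k A A A ((Coalgebra.comul (R := k) (A := A)).rTensor A t))
      (TensorProduct.assoc k M N P ((incl M N).rTensor P y)) := by
  induction t with
  | zero => simp
  | add t₁ t₂ h₁ h₂ => simp only [map_add, LinearMap.add_apply, h₁, h₂]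
  | tmul a b =>
    induction y with
    | zero => simp
    | add x y hx hy => simp only [map_add, hx, hy]
    | tmul x p =>
      rw [act_tmul_tmul, LinearMap.rTensor_tmul, LinearMap.rTensor_tmul, LinearMap.rTensor_tmul,
        act3_assoc]
      rfl

theorem act_right (M N P : AlgMod.{u, v, w} k A) (t : A ⊗[k] A) (y : M ⊗[k] tensor N P) :
    (incl N P).lTensor M (act A M (tensor N P) t y) =
    act3 M N P ((Coalgebra.comul (R := k) (A := A)).lTensor A t)
      ((incl N P).lTensor M y) := by
  induction t with
  | zero => simp
  | add t₁ t₂ h₁ h₂ => simp only [map_add, LinearMap.add_apply, h₁, h₂]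
  | tmul a b =>
    induction y with
    | zero => simp
    | add x y hx hy => simp only [map_add, hx, hy]
    | tmul m x => rfl

theorem inclLeft_smul (M N P : AlgMod.{u, v, w} k A) (a : A) (x : tensor (tensor M N) P) :
    inclLeft M N P (a • x) = act3 M N P
      ((Coalgebra.comul (R := k) (A := A)).lTensor A (Coalgebra.comul a)) (inclLeft M N P x) := by
  rw [← Coalgebra.coassoc_apply]
  exact assoc_act M N P _ (incl _ _ x)

theorem inclRight_smul (M N P : AlgMod.{u, v, w} k A) (a : A) (x : tensor M (tensor N P)) :
    inclRight M N P (a • x) = act3 M N P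
      ((Coalgebra.comul (R := k) (A := A)).lTensor A (Coalgebra.comul a)) (inclRight M N P x) :=
  act_right M N P _ (incl _ _ x)

theorem rTensor_comul_mul (t : A ⊗[k] A) :
    (Coalgebra.comul (R := k) (A := A)).rTensor A t * (Coalgebra.comul (1 : A) ⊗ₜ[k] (1 : A)) =
      (Coalgebra.comul (R := k) (A := A)).rTensor A t := by
  induction t with
  | zero => simp
  | add x y hx hy => simp only [map_add, add_mul, hx, hy]
  | tmul a b => simp [comul_mul_one]

theorem lTensor_comul_mul (t : A ⊗[k] A) :
    (Coalgebra.comul (R := k) (A := A)).lTensor A t * ((1 : A) ⊗ₜ[k] Coalgebra.comul (1 : A)) =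
      (Coalgebra.comul (R := k) (A := A)).lTensor A t := by
  induction t with
  | zero => simp
  | add x y hx hy => simp only [map_add, add_mul, hx, hy]
  | tmul a b => simp [comul_mul_one]

theorem assoc_mul (s t : (A ⊗[k] A) ⊗[k] A) :
    TensorProduct.assoc k A A A (s * t) =
      TensorProduct.assoc k A A A s * TensorProduct.assoc k A A A t :=
  map_mul (Algebra.TensorProduct.assoc k k k A A A) s t

theorem inclLeft_tm (M N P : AlgMod.{u, v, w} k A) (m : M) (n : N) (p : P) :
    inclLeft M N P (tm (tm m n) p) = act3 M N P
      ((Coalgebra.comul (R := k) (A := A)).lTensor A (Coalgebra.comul 1))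
      (m ⊗ₜ (n ⊗ₜ p)) := by
  refine (assoc_act M N P _ (tm m n ⊗ₜ p)).trans ?_
  have : TensorProduct.assoc k M N P
      ((incl M N).rTensor P (tm m n ⊗ₜ p)) =
      act3 M N P (TensorProduct.assoc k A A A (Coalgebra.comul 1 ⊗ₜ 1)) (m ⊗ₜ (n ⊗ₜ p)) := by
    have := act3_assoc M N P (Coalgebra.comul 1) 1 (m ⊗ₜ n) p
    rw [TensorProduct.assoc_tmul] at this
    rw [this, one_smul]
    rfl
  rw [this, ← Module.End.mul_apply, ← map_mul (act3 M N P), ← assoc_mul, rTensor_comul_mul,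
    Coalgebra.coassoc_apply]

theorem inclRight_tm (M N P : AlgMod.{u, v, w} k A) (m : M) (n : N) (p : P) :
    inclRight M N P (tm m (tm n p)) = act3 M N P
      ((Coalgebra.comul (R := k) (A := A)).lTensor A (Coalgebra.comul 1))
      (m ⊗ₜ (n ⊗ₜ p)) := by
  refine (act_right M N P _ (m ⊗ₜ tm n p)).trans ?_
  have : (incl N P).lTensor M (m ⊗ₜ tm n p) =
      act3 M N P (1 ⊗ₜ Coalgebra.comul 1) (m ⊗ₜ (n ⊗ₜ p)) := by
    simp only [act3, actHom_tmul, map_one, TensorProduct.map_tmul]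
    rfl
  rw [this, ← Module.End.mul_apply, ← map_mul (act3 M N P), lTensor_comul_mul]

theorem range_inclLeft (M N P : AlgMod.{u, v, w} k A) :
    LinearMap.range (inclLeft M N P) = LinearMap.range (act3 M N P
      ((Coalgebra.comul (R := k) (A := A)).lTensor A (Coalgebra.comul 1))) := by
  apply le_antisymm
  · rintro _ ⟨x, rfl⟩
    rw [← one_smul A x, inclLeft_smul]
    exact ⟨_, rfl⟩
  · rintro _ ⟨x, rfl⟩
    induction x with
    | zero => rw [map_zero]; exact Submodule.zero_mem _
    | add x y hx hy => rw [map_add]; exact Submodule.add_mem _ hx hy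
    | tmul m x =>
      induction x with
      | zero => rw [TensorProduct.tmul_zero, map_zero]; exact Submodule.zero_mem _
      | add x y hx hy => rw [TensorProduct.tmul_add, map_add]; exact Submodule.add_mem _ hx hy
      | tmul n p => exact ⟨_, inclLeft_tm M N P m n p⟩

theorem range_inclRight (M N P : AlgMod.{u, v, w} k A) :
    LinearMap.range (inclRight M N P) = LinearMap.range (act3 M N P
      ((Coalgebra.comul (R := k) (A := A)).lTensor A (Coalgebra.comul 1))) := by
  apply le_antisymm
  · rintro _ ⟨x, rfl⟩
    rw [← one_smul A x, inclRight_smul]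
    exact ⟨_, rfl⟩
  · rintro _ ⟨x, rfl⟩
    induction x with
    | zero => rw [map_zero]; exact Submodule.zero_mem _
    | add x y hx hy => rw [map_add]; exact Submodule.add_mem _ hx hy
    | tmul m x =>
      induction x with
      | zero => rw [TensorProduct.tmul_zero, map_zero]; exact Submodule.zero_mem _
      | add x y hx hy => rw [TensorProduct.tmul_add, map_add]; exact Submodule.add_mem _ hx hy
      | tmul n p => exact ⟨_, inclRight_tm M N P m n p⟩

/-- The associativity constraint as a `k`-linear equivalence: both sides are the same submodule
`Δ²(1)(M ⊗ N ⊗ P)` of the threefold tensor product. -/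
noncomputable def assocEquiv (M N P : AlgMod.{u, v, w} k A) :
    tensor (tensor M N) P ≃ₗ[k] tensor M (tensor N P) :=
  LinearEquiv.ofInjective _ (inclLeft_injective M N P) ≪≫ₗ
    LinearEquiv.ofEq _ _ ((range_inclLeft M N P).trans (range_inclRight M N P).symm) ≪≫ₗ
      (LinearEquiv.ofInjective _ (inclRight_injective M N P)).symm

theorem inclRight_assocEquiv (M N P : AlgMod.{u, v, w} k A) (x : tensor (tensor M N) P) :
    inclRight M N P (assocEquiv M N P x) = inclLeft M N P x := by
  have h := LinearEquiv.apply_symm_apply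
    (LinearEquiv.ofInjective _ (inclRight_injective M N P))
    (LinearEquiv.ofEq _ _ ((range_inclLeft M N P).trans (range_inclRight M N P).symm)
      (LinearEquiv.ofInjective _ (inclLeft_injective M N P) x))
  exact congrArg Subtype.val h

/-- The associativity constraint. -/
noncomputable def assocIso (M N P : AlgMod.{u, v, w} k A) :
    tensor (tensor M N) P ≅ tensor M (tensor N P) :=
  isoOfEquiv
    { assocEquiv M N P with
      map_smul' := fun a x => inclRight_injective M N P <| by
        change inclRight M N P (assocEquiv M N P (a • x)) =
          inclRight M N P (a • assocEquiv M N P x)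
        rw [inclRight_smul, inclRight_assocEquiv, inclRight_assocEquiv, inclLeft_smul] }

@[simp] theorem assocIso_tm (M N P : AlgMod.{u, v, w} k A) (m : M) (n : N) (p : P) :
    (assocIso M N P).hom.hom (tm (tm m n) p) = tm m (tm n p) :=
  inclRight_injective M N P <| (inclRight_assocEquiv M N P _).trans <|
    (inclLeft_tm M N P m n p).trans (inclRight_tm M N P m n p).symm

end Tensor

/-! ### The unit object -/

section Unit

variable (k : Type u) (A : Type v) [CommRing k] [Ring A] [Algebra k A] [Coalgebra k A]
  [WeakBialgebra k A]

open WeakBialgebra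

/-- The target space `A_t`, the image of `ε_t`. -/
noncomputable def targetSpace : Submodule k A := LinearMap.range (epsT k A)

variable {k A}

theorem epsT_coe (z : targetSpace k A) : epsT k A (z : A) = z := by
  obtain ⟨z, y, rfl⟩ := z
  exact epsT_epsT y

/-- The action `a ⇀ z = ε_t(a z)` on the target space. -/
noncomputable instance targetModule : Module A (targetSpace k A) where
  smul a z := ⟨epsT k A (a * z), LinearMap.mem_range_self _ _⟩
  one_smul z := Subtype.ext (by
    change epsT k A (1 * z.1) = z.1
    rw [one_mul, epsT_coe])
  mul_smul a b z := Subtype.ext (by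
    change epsT k A (a * b * z.1) = epsT k A (a * epsT k A (b * z.1))
    rw [epsT_mul_epsT, mul_assoc])
  smul_zero a := Subtype.ext (by
    change epsT k A (a * 0) = 0
    rw [mul_zero, map_zero])
  smul_add a y z := Subtype.ext (by
    change epsT k A (a * (y.1 + z.1)) = epsT k A (a * y.1) + epsT k A (a * z.1)
    rw [mul_add, map_add])
  add_smul a b z := Subtype.ext (by
    change epsT k A ((a + b) * z.1) = epsT k A (a * z.1) + epsT k A (b * z.1)
    rw [add_mul, map_add])
  zero_smul z := Subtype.ext (by
    change epsT k A (0 * z.1) = 0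
    rw [zero_mul, map_zero])

theorem target_smul_coe (a : A) (z : targetSpace k A) :
    ((a • z : targetSpace k A) : A) = epsT k A (a * z) := rfl

instance : IsScalarTower k A (targetSpace k A) where
  smul_assoc c a z := Subtype.ext (by
    rw [target_smul_coe, smul_mul_assoc, map_smul]; rfl)

variable (k A)

/-- The unit object. -/
noncomputable def unit : AlgMod.{u, v, v} k A where
  carrier := targetSpace k A

variable {k A}

/-- The inclusion of the target space. -/
noncomputable def unitIncl : unit k A →ₗ[k] A := (targetSpace k A).subtype

theorem unitIncl_injective : Function.Injective (unitIncl (k := k) (A := A)) :=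
  Subtype.val_injective

theorem epsT_unitIncl (z : unit k A) : epsT k A (unitIncl z) = unitIncl z := epsT_coe z

theorem unitIncl_smul (a : A) (z : unit k A) :
    unitIncl (a • z) = epsT k A (a * unitIncl z) := rfl

/-- `ε_t` as a map onto the unit object. -/
noncomputable def unitProj : A →ₗ[k] unit k A := (epsT k A).rangeRestrict

theorem unitIncl_unitProj (a : A) : unitIncl (unitProj (k := k) a) = epsT k A a := rfl

/-- `z ⊗ m ↦ z m`. -/
noncomputable def leftMul (M : AlgMod.{u, v, v} k A) : unit k A ⊗[k] M →ₗ[k] M :=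
  TensorProduct.lift (LinearMap.mk₂ k (fun z m => unitIncl z • m)
    (by intros; simp [add_smul]) (by intros; simp)
    (by intros; simp) (by intro c z m; exact smul_comm _ _ _))

/-- `m ⊗ z ↦ ε̄_s(z) m`. -/
noncomputable def rightMul (M : AlgMod.{u, v, v} k A) : M ⊗[k] unit k A →ₗ[k] M :=
  TensorProduct.lift (LinearMap.mk₂ k (fun m z => epsSBar k A (unitIncl z) • m)
    (by intros; simp) (by intro c z m; exact smul_comm _ _ _)
    (by intros; simp [add_smul]) (by intros; simp))

theorem leftMul_act (M : AlgMod.{u, v, v} k A) (a : A) (x : unit k A ⊗[k] M) :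
    leftMul M (act A (unit k A) M (Coalgebra.comul a) x) = a • leftMul M x := by
  induction x with
  | zero => simp
  | add x y hx hy => simp only [map_add, smul_add, hx, hy]
  | tmul z m =>
    have key : ∀ t : A ⊗[k] A, leftMul M (act A (unit k A) M t (z ⊗ₜ m)) =
        contractLeftMul k A (Coalgebra.comul (R := k) (1 : A) * t) (unitIncl z) • m := by
      intro t
      induction t with
      | zero => simp
      | add x y hx hy => simp only [map_add, mul_add, LinearMap.add_apply, add_smul, hx, hy]
      | tmul p q =>
        have h : ∀ s : A ⊗[k] A, contractLeftMul k A (s * (p ⊗ₜ q)) (unitIncl z) =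
            contractLeftMul k A s (p * unitIncl z) * q := by
          intro s
          induction s with
          | zero => simp
          | add x y hx hy => simp only [map_add, add_mul, LinearMap.add_apply, hx, hy]
          | tmul c d => simp [mul_assoc]
        rw [act_tmul_tmul, h, mul_smul]
        rfl
    rw [key, comul_one_mul, contractLeftMul_comul, epsT_unitIncl, mul_smul]
    rfl

theorem rightMul_act (M : AlgMod.{u, v, v} k A) (a : A) (x : M ⊗[k] unit k A) :
    rightMul M (act A M (unit k A) (Coalgebra.comul a) x) = a • rightMul M x := by
  induction x with
  | zero => simp
  | add x y hx hy => simp only [map_add, smul_add, hx, hy]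
  | tmul m z =>
    have key : ∀ t : A ⊗[k] A, rightMul M (act A M (unit k A) t (m ⊗ₜ z)) =
        contractLeftMul k A (TensorProduct.comm k A A
          (Coalgebra.comul (R := k) (1 : A) * t)) (unitIncl z) • m := by
      intro t
      induction t with
      | zero => simp
      | add x y hx hy => simp only [map_add, mul_add, LinearMap.add_apply, add_smul, hx, hy]
      | tmul p q =>
        have h : ∀ s : A ⊗[k] A,
            contractLeftMul k A (TensorProduct.comm k A A (s * (p ⊗ₜ q))) (unitIncl z) =
            contractLeftMul k A (TensorProduct.comm k A A s) (q * unitIncl z) * p := by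
          intro s
          induction s with
          | zero => simp
          | add x y hx hy => simp only [map_add, add_mul, LinearMap.add_apply, hx, hy]
          | tmul c d => simp [mul_assoc]
        rw [act_tmul_tmul, h, mul_smul]
        change epsSBar k A (epsT k A (q * unitIncl z)) • p • m = _
        rw [epsSBar_epsT]
        rfl
    rw [key, comul_one_mul, contractLeftMul_comm_comul, mul_smul]
    rfl

/-- `1` as an element of the target space. -/
noncomputable def unitOne : unit k A := unitProj 1

theorem unitIncl_unitOne : unitIncl (unitOne (k := k) (A := A)) = 1 := epsT_one

/-- The left unit constraint `z ⊗ m ↦ z m`. -/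
noncomputable def leftUnitorLin (M : AlgMod.{u, v, v} k A) : tensor (unit k A) M →ₗ[A] M where
  toFun x := leftMul M (incl _ _ x)
  map_add' x y := map_add (leftMul M ∘ₗ incl _ _) x y
  map_smul' a x := leftMul_act M a (incl _ _ x)

@[simp] theorem leftUnitorLin_tm (M : AlgMod.{u, v, v} k A) (z : unit k A) (m : M) :
    leftUnitorLin M (tm z m) = unitIncl z • m := by
  change leftMul M (act A (unit k A) M (Coalgebra.comul 1) (z ⊗ₜ m)) = _
  rw [leftMul_act, one_smul]
  rfl

/-- The right unit constraint `m ⊗ z ↦ ε̄_s(z) m`. -/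
noncomputable def rightUnitorLin (M : AlgMod.{u, v, v} k A) : tensor M (unit k A) →ₗ[A] M where
  toFun x := rightMul M (incl _ _ x)
  map_add' x y := map_add (rightMul M ∘ₗ incl _ _) x y
  map_smul' a x := rightMul_act M a (incl _ _ x)

@[simp] theorem rightUnitorLin_tm (M : AlgMod.{u, v, v} k A) (m : M) (z : unit k A) :
    rightUnitorLin M (tm m z) = epsSBar k A (unitIncl z) • m := by
  change rightMul M (act A M (unit k A) (Coalgebra.comul 1) (m ⊗ₜ z)) = _
  rw [rightMul_act, one_smul]
  rfl

theorem tm_one_left (M : AlgMod.{u, v, v} k A) (z : unit k A) (m : M) :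
    tm (unitOne (k := k) (A := A)) (unitIncl z • m) = tm z m := by
  have h := rTensor_epsT_comul_one_mul (k := k) (unitIncl z)
  rw [epsT_unitIncl] at h
  let g : A ⊗[k] A →ₗ[k] unit k A ⊗[k] M := TensorProduct.map unitProj
    ((LinearMap.toSpanSingleton A M m).restrictScalars k)
  have hg : ∀ t : A ⊗[k] A, g ((epsT k A).rTensor A t) = g t := by
    intro t
    induction t with
    | zero => simp
    | add x y hx hy => simp only [map_add, hx, hy]
    | tmul p q =>
      simp only [g, LinearMap.rTensor_tmul, TensorProduct.map_tmul]
      congr 1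
      exact unitIncl_injective (epsT_epsT p)
  have h1 : ∀ t : A ⊗[k] A, act A (unit k A) M t (z ⊗ₜ m) = g (t * (unitIncl z ⊗ₜ 1)) := by
    intro t
    induction t with
    | zero => simp
    | add x y hx hy => simp only [map_add, add_mul, LinearMap.add_apply, hx, hy]
    | tmul p q =>
      rw [act_tmul_tmul, Algebra.TensorProduct.tmul_mul_tmul, mul_one]
      rfl
  have h2 : ∀ t : A ⊗[k] A, act A (unit k A) M t (unitOne ⊗ₜ (unitIncl z • m)) =
      g ((epsT k A).rTensor A t * (1 ⊗ₜ unitIncl z)) := by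
    intro t
    induction t with
    | zero => simp
    | add x y hx hy => simp only [map_add, add_mul, LinearMap.add_apply, hx, hy]
    | tmul p q =>
      rw [act_tmul_tmul, LinearMap.rTensor_tmul, Algebra.TensorProduct.tmul_mul_tmul, mul_one,
        smul_smul]
      change _ = unitProj (epsT k A p) ⊗ₜ ((q * unitIncl z) • m)
      congr 1
      refine unitIncl_injective ?_
      rw [unitIncl_smul, unitIncl_unitOne, unitIncl_unitProj, epsT_epsT, mul_one]
  refine incl_injective _ _ ?_
  change act A (unit k A) M (Coalgebra.comul 1) _ = act A (unit k A) M (Coalgebra.comul 1) _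
  rw [h1, h2, ← h, hg]

theorem tm_one_right (M : AlgMod.{u, v, v} k A) (m : M) (z : unit k A) :
    tm (epsSBar k A (unitIncl z) • m) (unitOne (k := k) (A := A)) = tm m z := by
  have h := (comul_one_epsSBar (k := k) (unitIncl z)).1
  let g : A ⊗[k] A →ₗ[k] M ⊗[k] unit k A := TensorProduct.map
    ((LinearMap.toSpanSingleton A M m).restrictScalars k) unitProj
  have h1 : ∀ t : A ⊗[k] A, act A M (unit k A) t (m ⊗ₜ z) =
      g ((epsT k A ∘ₗ LinearMap.mulRight k (unitIncl z)).lTensor A t) := by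
    intro t
    induction t with
    | zero => simp
    | add x y hx hy => simp only [map_add, LinearMap.add_apply, hx, hy]
    | tmul p q =>
      rw [act_tmul_tmul, LinearMap.lTensor_tmul]
      change _ = (p • m) ⊗ₜ[k] unitProj (epsT k A (q * unitIncl z))
      congr 1
      refine unitIncl_injective ?_
      change epsT k A (q * unitIncl z) = epsT k A (epsT k A (q * unitIncl z))
      rw [epsT_epsT]
  have h2 : ∀ t : A ⊗[k] A, act A M (unit k A) t ((epsSBar k A (unitIncl z) • m) ⊗ₜ unitOne) =
      g (t * (epsSBar k A (unitIncl z) ⊗ₜ 1)) := by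
    intro t
    induction t with
    | zero => simp
    | add x y hx hy => simp only [map_add, add_mul, LinearMap.add_apply, hx, hy]
    | tmul p q =>
      rw [act_tmul_tmul, Algebra.TensorProduct.tmul_mul_tmul, smul_smul, mul_one]
      change _ = ((p * epsSBar k A (unitIncl z)) • m) ⊗ₜ[k] unitProj q
      congr 1
      refine unitIncl_injective ?_
      rw [unitIncl_smul, unitIncl_unitOne, unitIncl_unitProj, mul_one]
  refine incl_injective _ _ ?_
  change act A M (unit k A) (Coalgebra.comul 1) _ = act A M (unit k A) (Coalgebra.comul 1) _
  rw [h1, h2, h]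

theorem leftUnitorLin_bijective (M : AlgMod.{u, v, v} k A) :
    Function.Bijective (leftUnitorLin M) := by
  refine Function.bijective_iff_has_inverse.mpr ⟨fun m => tm unitOne m, fun x => ?_, fun m => ?_⟩
  · have := tensor_ext (M := unit k A) (N := M)
      (f := ((tmBilin (unit k A) M unitOne).toAddMonoidHom.comp
        (leftUnitorLin M).toAddMonoidHom)) (g := AddMonoidHom.id _)
      (fun z m => by
        change tm unitOne (leftUnitorLin M (tm z m)) = tm z m
        rw [leftUnitorLin_tm, tm_one_left])
    exact DFunLike.congr_fun this x
  · rw [leftUnitorLin_tm]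
    rw [unitIncl_unitOne, one_smul]

theorem rightUnitorLin_bijective (M : AlgMod.{u, v, v} k A) :
    Function.Bijective (rightUnitorLin M) := by
  refine Function.bijective_iff_has_inverse.mpr ⟨fun m => tm m unitOne, fun x => ?_, fun m => ?_⟩
  · have := tensor_ext (M := M) (N := unit k A)
      (f := (((tmBilin M (unit k A)).flip unitOne).toAddMonoidHom.comp
        (rightUnitorLin M).toAddMonoidHom)) (g := AddMonoidHom.id _)
      (fun m z => by
        change tm (rightUnitorLin M (tm m z)) unitOne = tm m z
        rw [rightUnitorLin_tm, tm_one_right])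
    exact DFunLike.congr_fun this x
  · rw [rightUnitorLin_tm]
    rw [unitIncl_unitOne, epsSBar_one, one_smul]

/-- `m ε̄_s(z) ⊗_t n = m ⊗_t z n`. -/
theorem tm_middle {M N : AlgMod.{u, v, v} k A} (m : M) (z : unit k A) (n : N) :
    tm (epsSBar k A (unitIncl z) • m) n = tm m (unitIncl z • n) := by
  have h := (comul_one_epsSBar (k := k) (unitIncl z)).2
  rw [epsT_unitIncl] at h
  have h1 : ∀ (a b : A), act A M N (Coalgebra.comul 1) ((a • m) ⊗ₜ (b • n)) =
      act A M N (Coalgebra.comul (R := k) (1 : A) * (a ⊗ₜ b)) (m ⊗ₜ n) := by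
    intro a b
    rw [map_mul, Module.End.mul_apply, act_tmul_tmul]
  refine incl_injective _ _ ?_
  change act A M N (Coalgebra.comul 1) _ = act A M N (Coalgebra.comul 1) _
  have e1 := h1 (epsSBar k A (unitIncl z)) 1
  have e2 := h1 1 (unitIncl z)
  rw [one_smul] at e1 e2
  rw [e1, e2, h]

/-- The monoidal category `(_A M, ⊗_t, A_t, a, l, r)`. -/
noncomputable instance monoidalCategory : MonoidalCategory (AlgMod.{u, v, v} k A) where
  tensorObj M N := tensor M N
  whiskerLeft M _ _ f := tensorMap (𝟙 M) f
  whiskerRight f N := tensorMap f (𝟙 N)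
  tensorHom f g := tensorMap f g
  tensorUnit := unit k A
  associator M N P := assocIso M N P
  leftUnitor M := isoOfEquiv (LinearEquiv.ofBijective (leftUnitorLin M) (leftUnitorLin_bijective M))
  rightUnitor M :=
    isoOfEquiv (LinearEquiv.ofBijective (rightUnitorLin M) (rightUnitorLin_bijective M))
  tensorHom_def f g := tensor_hom_ext fun m n => by
    rw [comp_hom, LinearMap.comp_apply, tensorMap_tm, tensorMap_tm, tensorMap_tm]
    rfl
  id_tensorHom_id M N := tensor_hom_ext fun m n => by
    rw [tensorMap_tm]
    rfl
  tensorHom_comp_tensorHom f g f' g' := tensor_hom_ext fun m n => by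
    rw [comp_hom, LinearMap.comp_apply, tensorMap_tm, tensorMap_tm, tensorMap_tm]
    rfl
  whiskerLeft_id M N := tensor_hom_ext fun m n => by
    rw [tensorMap_tm]
    rfl
  id_whiskerRight M N := tensor_hom_ext fun m n => by
    rw [tensorMap_tm]
    rfl
  associator_naturality f g h := tensor_hom_ext₃ fun m n p => by
    rw [comp_hom, comp_hom, LinearMap.comp_apply, LinearMap.comp_apply, tensorMap_tm,
      tensorMap_tm, assocIso_tm, assocIso_tm, tensorMap_tm, tensorMap_tm]
  leftUnitor_naturality f := tensor_hom_ext fun z m => by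
    rw [comp_hom, comp_hom, LinearMap.comp_apply, LinearMap.comp_apply, tensorMap_tm]
    change leftUnitorLin _ (tm _ _) = f.hom (leftUnitorLin _ (tm _ _))
    rw [leftUnitorLin_tm, leftUnitorLin_tm, map_smul]
    rfl
  rightUnitor_naturality f := tensor_hom_ext fun m z => by
    rw [comp_hom, comp_hom, LinearMap.comp_apply, LinearMap.comp_apply, tensorMap_tm]
    change rightUnitorLin _ (tm _ _) = f.hom (rightUnitorLin _ (tm _ _))
    rw [rightUnitorLin_tm, rightUnitorLin_tm, map_smul]
    rfl
  pentagon W X Y Z := tensor_hom_ext₄ fun m n p q => by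
    simp only [comp_hom, LinearMap.comp_apply, tensorMap_tm, assocIso_tm, id_hom,
      LinearMap.id_apply]
  triangle M N := tensor_hom_ext₃ fun m z n => by
    rw [comp_hom, LinearMap.comp_apply, assocIso_tm, tensorMap_tm, tensorMap_tm]
    change tm m (leftUnitorLin _ (tm z n)) = tm (rightUnitorLin _ (tm m z)) n
    rw [leftUnitorLin_tm, rightUnitorLin_tm, tm_middle]

end Unit

end AlgMod

/-! ## Weak Hopf algebras -/

/-- A weak Hopf algebra over `k`: a weak bialgebra with an antipode `S` such that
`S * id = ε_s`, `id * S = ε_t` and `S * id * S = S` for the convolution product. -/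
class WeakHopfAlgebra (k : Type u) (A : Type v) [CommRing k] [Ring A] [Algebra k A]
    [Coalgebra k A] extends WeakBialgebra k A where
  antipode : A →ₗ[k] A
  antipode_conv_id :
    LinearMap.mul' k A ∘ₗ TensorProduct.map antipode LinearMap.id ∘ₗ Coalgebra.comul =
      WeakBialgebra.epsS k A
  id_conv_antipode :
    LinearMap.mul' k A ∘ₗ TensorProduct.map LinearMap.id antipode ∘ₗ Coalgebra.comul =
      WeakBialgebra.epsT k A
  antipode_conv_id_conv_antipode :
    LinearMap.mul' k A ∘ₗ TensorProduct.map antipode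
      (LinearMap.mul' k A ∘ₗ TensorProduct.map LinearMap.id antipode ∘ₗ Coalgebra.comul) ∘ₗ
        Coalgebra.comul = antipode

/-- The antipode is bijective. -/
class WeakHopfAlgebra.BijectiveAntipode (k : Type u) (A : Type v) [CommRing k] [Ring A]
    [Algebra k A] [Coalgebra k A] [WeakHopfAlgebra k A] : Prop where
  bijective : Function.Bijective (WeakHopfAlgebra.antipode (k := k) (A := A))

/-- The inverse `S⁻¹` of the antipode. -/
noncomputable def WeakHopfAlgebra.antipodeInv (k : Type u) (A : Type v) [CommRing k] [Ring A]
    [Algebra k A] [Coalgebra k A] [WeakHopfAlgebra k A] [BijectiveAntipode k A] : A →ₗ[k] A :=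
  (LinearEquiv.ofBijective (WeakHopfAlgebra.antipode (k := k) (A := A))
    BijectiveAntipode.bijective).symm.toLinearMap

/-! ## Left-right Yetter-Drinfeld modules -/

open AlgMod

section YetterDrinfeld

variable {k : Type u} {H : Type v} [CommRing k] [Ring H] [Algebra k H] [Coalgebra k H]

/-- For a map `ρ(m) = m₍₀₎ ⊗ m₍₁₎` and `m : M`, the map `a ⊗ b ↦ (b m)₍₀₎ ⊗ (b m)₍₁₎ a`. -/
noncomputable def coactTwist (M : AlgMod.{u, v, w} k H) (ρ : M →ₗ[k] M ⊗[k] H) (m : M) :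
    H ⊗[k] H →ₗ[k] M ⊗[k] H :=
  TensorProduct.lift (LinearMap.mk₂ k
    (fun a b => (LinearMap.mulRight k a).lTensor M (ρ (b • m)))
    (by
      intro a a' b
      have : LinearMap.mulRight k (a + a') = LinearMap.mulRight k a + LinearMap.mulRight k a' := by
        ext; simp [mul_add]
      rw [this, LinearMap.lTensor_add, LinearMap.add_apply])
    (by
      intro c a b
      have : LinearMap.mulRight k (c • a) = c • LinearMap.mulRight k a := by
        ext; simp
      rw [this, LinearMap.lTensor_smul, LinearMap.smul_apply])
    (by intros; simp [add_smul]) (by intros; simp))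

/-- `M` with the right coaction `ρ` is a left-right Yetter-Drinfeld module. -/
structure IsYetterDrinfeld (M : AlgMod.{u, v, w} k H) (ρ : M →ₗ[k] M ⊗[k] H) : Prop where
  coassoc : ∀ m, TensorProduct.assoc k M H H (ρ.rTensor H (ρ m)) =
    (Coalgebra.comul (R := k) (A := H)).lTensor M (ρ m)
  counit : ∀ m, TensorProduct.rid k M ((Coalgebra.counit (R := k) (A := H)).lTensor M (ρ m)) = m
  /-- `ρ(m) ∈ M ⊗_t H`. -/
  mem_range : ∀ m, ρ m ∈ LinearMap.range (act H M H (Coalgebra.comul (R := k) (1 : H)))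
  /-- `h₍₁₎ m₍₀₎ ⊗ h₍₂₎ m₍₁₎ = (h₍₂₎ m)₍₀₎ ⊗ (h₍₂₎ m)₍₁₎ h₍₁₎`. -/
  compat : ∀ (h : H) m, act H M H (Coalgebra.comul h) (ρ m) =
    coactTwist M ρ m (Coalgebra.comul h)

/-- A linear map `f` is colinear: `f(m)₍₀₎ ⊗ f(m)₍₁₎ = f(m₍₀₎) ⊗ m₍₁₎`. -/
def IsColinear {M N : AlgMod.{u, v, w} k H} (ρM : M →ₗ[k] M ⊗[k] H) (ρN : N →ₗ[k] N ⊗[k] H)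
    (f : M ⟶ N) : Prop :=
  ∀ m, ρN (f.hom m) = (Hom.lin f).rTensor H (ρM m)

variable (k H) in
/-- A left-right Yetter-Drinfeld module over `H`. -/
structure YDMod where
  toAlgMod : AlgMod.{u, v, w} k H
  coact : toAlgMod →ₗ[k] toAlgMod ⊗[k] H
  isYetterDrinfeld : IsYetterDrinfeld toAlgMod coact

namespace YDMod

/-- Morphisms are the `H`-linear `H`-colinear maps. -/
@[ext]
structure Hom (M N : YDMod.{u, v, w} k H) where
  lin : M.toAlgMod ⟶ N.toAlgMod
  colinear : IsColinear M.coact N.coact lin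

instance category : Category (YDMod.{u, v, w} k H) where
  Hom M N := Hom M N
  id M := ⟨𝟙 _, fun m => (LinearMap.congr_fun (LinearMap.rTensor_id H M.toAlgMod) _).symm⟩
  comp {M N P} f g := ⟨f.lin ≫ g.lin, fun m => by
    have h1 := g.colinear (f.lin.hom m)
    rw [f.colinear m] at h1
    exact h1.trans (LinearMap.rTensor_comp_apply H (AlgMod.Hom.lin g.lin) (AlgMod.Hom.lin f.lin)
      (M.coact m)).symm⟩

theorem hom_ext {M N : YDMod.{u, v, w} k H} {f g : M ⟶ N} (h : f.lin = g.lin) : f = g := Hom.ext h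

end YDMod

end YetterDrinfeld

/-! ### The tensor product of Yetter-Drinfeld modules -/

namespace YDMod

section Tensor

variable {k : Type u} {H : Type v} [CommRing k] [Ring H] [Algebra k H] [Coalgebra k H]

/-- `m ⊗ n ↦ m₍₀₎ ⊗ n₍₀₎ ⊗ n₍₁₎ m₍₁₎` on `M ⊗ N`. -/
noncomputable def diagCoact {M N : AlgMod.{u, v, w} k H} (ρM : M →ₗ[k] M ⊗[k] H)
    (ρN : N →ₗ[k] N ⊗[k] H) : M ⊗[k] N →ₗ[k] (M ⊗[k] N) ⊗[k] H :=
  (LinearMap.mul' k H ∘ₗ (TensorProduct.comm k H H).toLinearMap).lTensor (M ⊗[k] N) ∘ₗ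
    (TensorProduct.tensorTensorTensorComm k M H N H).toLinearMap ∘ₗ TensorProduct.map ρM ρN

variable [WeakBialgebra k H]

/-- The coaction `ρ(m ⊗ n) = m₍₀₎ ⊗ n₍₀₎ ⊗ n₍₁₎ m₍₁₎` on `M ⊗_t N`. -/
noncomputable def tensorCoact {M N : AlgMod.{u, v, w} k H} (ρM : M →ₗ[k] M ⊗[k] H)
    (ρN : N →ₗ[k] N ⊗[k] H) : tensor M N →ₗ[k] tensor M N ⊗[k] H :=
  (proj M N).rTensor H ∘ₗ diagCoact ρM ρN ∘ₗ incl M N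

theorem diagCoact_map {M N M' N' : AlgMod.{u, v, w} k H} {ρM : M →ₗ[k] M ⊗[k] H}
    {ρN : N →ₗ[k] N ⊗[k] H} {ρM' : M' →ₗ[k] M' ⊗[k] H} {ρN' : N' →ₗ[k] N' ⊗[k] H}
    {f : M ⟶ M'} {g : N ⟶ N'} (hf : IsColinear ρM ρM' f) (hg : IsColinear ρN ρN' g)
    (x : M ⊗[k] N) :
    diagCoact ρM' ρN' (TensorProduct.map (AlgMod.Hom.lin f) (AlgMod.Hom.lin g) x) =
      (TensorProduct.map (AlgMod.Hom.lin f) (AlgMod.Hom.lin g)).rTensor H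
        (diagCoact ρM ρN x) := by
  induction x with
  | zero => simp
  | add x y hx hy => simp only [map_add, hx, hy]
  | tmul m n =>
    have e1 := hf m
    have e2 := hg n
    simp only [diagCoact, LinearMap.comp_apply, TensorProduct.map_tmul, AlgMod.Hom.lin_apply, e1,
      e2]
    generalize ρM m = X
    generalize ρN n = Y
    induction X with
    | zero => simp
    | add X X' hX hX' => simp only [map_add, TensorProduct.add_tmul, hX, hX']
    | tmul m a =>
      induction Y with
      | zero => simp
      | add Y Y' hY hY' => simp only [map_add, TensorProduct.tmul_add, hY, hY']
      | tmul n b => simp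

theorem isColinear_tensorMap {M N M' N' : AlgMod.{u, v, w} k H} {ρM : M →ₗ[k] M ⊗[k] H}
    {ρN : N →ₗ[k] N ⊗[k] H} {ρM' : M' →ₗ[k] M' ⊗[k] H} {ρN' : N' →ₗ[k] N' ⊗[k] H}
    {f : M ⟶ M'} {g : N ⟶ N'} (hf : IsColinear ρM ρM' f) (hg : IsColinear ρN ρN' g) :
    IsColinear (tensorCoact ρM ρN) (tensorCoact ρM' ρN') (tensorMap f g) := by
  intro x
  have hp : ∀ y : M ⊗[k] N,
      proj M' N' (TensorProduct.map (AlgMod.Hom.lin f) (AlgMod.Hom.lin g) y) =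
      AlgMod.Hom.lin (tensorMap f g) (proj M N y) := by
    intro y
    induction y with
    | zero => simp
    | add x y hx hy => simp only [map_add, hx, hy]
    | tmul m n => exact (tensorMap_tm f g m n).symm
  simp only [tensorCoact, LinearMap.comp_apply]
  rw [incl_tensorMap, diagCoact_map hf hg]
  have hp' := congrArg (LinearMap.rTensor H) (LinearMap.ext hp :
    proj M' N' ∘ₗ TensorProduct.map (AlgMod.Hom.lin f) (AlgMod.Hom.lin g) =
      AlgMod.Hom.lin (tensorMap f g) ∘ₗ proj M N)
  rw [LinearMap.rTensor_comp, LinearMap.rTensor_comp] at hp'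
  exact LinearMap.congr_fun hp' _

end Tensor

section Monoidal

variable (k : Type u) (H : Type v) [CommRing k] [Ring H] [Algebra k H] [Coalgebra k H]
  [WeakHopfAlgebra k H] [WeakHopfAlgebra.BijectiveAntipode k H]

open WeakHopfAlgebra

/-- The coaction `ρ(z) = z₍₂₎ ⊗ S⁻¹(z₍₁₎)` on the target space, with values in `H ⊗ H`. -/
noncomputable def unitCoactAux : unit k H →ₗ[k] H ⊗[k] H :=
  (TensorProduct.comm k H H).toLinearMap ∘ₗ (antipodeInv k H).rTensor H ∘ₗ
    Coalgebra.comul ∘ₗ unitIncl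

/-- The coaction `ρ(z) = z₍₂₎ ⊗ S⁻¹(z₍₁₎)` on the unit object `H_t`. -/
noncomputable def unitCoact : unit k H →ₗ[k] unit k H ⊗[k] H :=
  unitProj.rTensor H ∘ₗ unitCoactAux k H

/-- The statement that `⊗_t` and `H_t`, with the coactions above and the constraints of the
category of left `H`-modules, are well-defined in the category of left-right
Yetter-Drinfeld modules. -/
structure TensorWellDefined : Prop where
  /-- `m₍₀₎ ⊗ n₍₀₎ ⊗ n₍₁₎ m₍₁₎` takes its values in `(M ⊗_t N) ⊗ H`. -/
  incl_tensorCoact : ∀ (M N : YDMod.{u, v, v} k H) (x : tensor M.toAlgMod N.toAlgMod),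
    (incl M.toAlgMod N.toAlgMod).rTensor H (tensorCoact M.coact N.coact x) =
      diagCoact M.coact N.coact (incl _ _ x)
  /-- `ρ(1₍₁₎ m ⊗ 1₍₂₎ n) = m₍₀₎ ⊗ n₍₀₎ ⊗ n₍₁₎ m₍₁₎`. -/
  incl_tensorCoact_proj : ∀ (M N : YDMod.{u, v, v} k H) (x : M.toAlgMod ⊗[k] N.toAlgMod),
    (incl M.toAlgMod N.toAlgMod).rTensor H (tensorCoact M.coact N.coact (proj _ _ x)) =
      diagCoact M.coact N.coact x
  tensor : ∀ M N : YDMod.{u, v, v} k H,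
    IsYetterDrinfeld (tensor M.toAlgMod N.toAlgMod) (tensorCoact M.coact N.coact)
  /-- `z₍₂₎ ⊗ S⁻¹(z₍₁₎)` lies in `H_t ⊗ H` for `z` in `H_t`. -/
  incl_unitCoact : ∀ z : unit k H, unitIncl.rTensor H (unitCoact k H z) = unitCoactAux k H z
  unit : IsYetterDrinfeld (unit k H) (unitCoact k H)
  associator : ∀ M N P : YDMod.{u, v, v} k H,
    IsColinear (tensorCoact (tensorCoact M.coact N.coact) P.coact)
      (tensorCoact M.coact (tensorCoact N.coact P.coact))
      (MonoidalCategory.associator M.toAlgMod N.toAlgMod P.toAlgMod).hom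
  leftUnitor : ∀ M : YDMod.{u, v, v} k H,
    IsColinear (tensorCoact (unitCoact k H) M.coact) M.coact
      (MonoidalCategory.leftUnitor M.toAlgMod).hom
  rightUnitor : ∀ M : YDMod.{u, v, v} k H,
    IsColinear (tensorCoact M.coact (unitCoact k H)) M.coact
      (MonoidalCategory.rightUnitor M.toAlgMod).hom

variable {k H}

theorem isColinear_inv {M N : AlgMod.{u, v, w} k H} {ρM : M →ₗ[k] M ⊗[k] H}
    {ρN : N →ₗ[k] N ⊗[k] H} {e : M ≅ N} (h : IsColinear ρM ρN e.hom) :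
    IsColinear ρN ρM e.inv := by
  intro n
  have h1 : ∀ m : M, e.inv.hom (e.hom.hom m) = m := fun m =>
    congrArg (fun f : M ⟶ M => f.hom m) e.hom_inv_id
  have h2 : e.hom.hom (e.inv.hom n) = n := congrArg (fun f : N ⟶ N => f.hom n) e.inv_hom_id
  have h3 := h (e.inv.hom n)
  rw [h2] at h3
  rw [h3, ← LinearMap.comp_apply, ← LinearMap.rTensor_comp]
  have h4 : AlgMod.Hom.lin e.inv ∘ₗ AlgMod.Hom.lin e.hom = LinearMap.id := LinearMap.ext h1
  rw [h4, LinearMap.rTensor_id, LinearMap.id_apply]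

/-- An isomorphism of modules that is colinear is an isomorphism of Yetter-Drinfeld modules. -/
def isoMk {M N : YDMod.{u, v, w} k H} (e : M.toAlgMod ≅ N.toAlgMod)
    (h : IsColinear M.coact N.coact e.hom) : M ≅ N where
  hom := ⟨e.hom, h⟩
  inv := ⟨e.inv, isColinear_inv h⟩
  hom_inv_id := hom_ext e.hom_inv_id
  inv_hom_id := hom_ext e.inv_hom_id

theorem isColinear_id (M : YDMod.{u, v, w} k H) : IsColinear M.coact M.coact (𝟙 M.toAlgMod) :=
  (𝟙 M : M ⟶ M).colinear

/-- The monoidal category of left-right Yetter-Drinfeld modules. -/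
@[reducible] noncomputable def monoidalCategory (h : TensorWellDefined k H) :
    MonoidalCategory (YDMod.{u, v, v} k H) where
  tensorObj M N := ⟨_, _, h.tensor M N⟩
  whiskerLeft M _ _ f := ⟨tensorMap (𝟙 M.toAlgMod) f.lin,
    isColinear_tensorMap (isColinear_id M) f.colinear⟩
  whiskerRight f N := ⟨tensorMap f.lin (𝟙 N.toAlgMod),
    isColinear_tensorMap f.colinear (isColinear_id N)⟩
  tensorHom f g := ⟨tensorMap f.lin g.lin, isColinear_tensorMap f.colinear g.colinear⟩
  tensorUnit := ⟨_, _, h.unit⟩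
  associator M N P := isoMk _ (h.associator M N P)
  leftUnitor M := isoMk _ (h.leftUnitor M)
  rightUnitor M := isoMk _ (h.rightUnitor M)
  tensorHom_def f g := hom_ext (MonoidalCategory.tensorHom_def f.lin g.lin)
  id_tensorHom_id M N := hom_ext (MonoidalCategory.id_tensorHom_id M.toAlgMod N.toAlgMod)
  tensorHom_comp_tensorHom f₁ f₂ g₁ g₂ :=
    hom_ext (MonoidalCategory.tensorHom_comp_tensorHom f₁.lin f₂.lin g₁.lin g₂.lin)
  whiskerLeft_id M N := hom_ext (MonoidalCategory.whiskerLeft_id M.toAlgMod N.toAlgMod)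
  id_whiskerRight M N := hom_ext (MonoidalCategory.id_whiskerRight M.toAlgMod N.toAlgMod)
  associator_naturality f₁ f₂ f₃ :=
    hom_ext (MonoidalCategory.associator_naturality f₁.lin f₂.lin f₃.lin)
  leftUnitor_naturality f := hom_ext (MonoidalCategory.leftUnitor_naturality f.lin)
  rightUnitor_naturality f := hom_ext (MonoidalCategory.rightUnitor_naturality f.lin)
  pentagon M N P Q := hom_ext
    (MonoidalCategory.pentagon M.toAlgMod N.toAlgMod P.toAlgMod Q.toAlgMod)
  triangle M N := hom_ext (MonoidalCategory.triangle M.toAlgMod N.toAlgMod)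

end Monoidal

end YDMod

/-! ## The Drinfeld double -/

namespace Drinfeld

section Smash

variable (k : Type u) (H : Type v) [CommRing k] [Ring H] [Algebra k H] [Coalgebra k H]

/-- The convolution product `(f * g)(h) = f(h₍₁₎) g(h₍₂₎)` on `H*`. -/
noncomputable def dualMul :
    Module.Dual k H ⊗[k] Module.Dual k H →ₗ[k] Module.Dual k H :=
  (Coalgebra.comul (R := k) (A := H)).dualMap ∘ₗ TensorProduct.dualDistrib k H H

/-- The comultiplication of `H*` for `H` finitely generated projective:
`⟨Δ(f), h ⊗ l⟩ = ⟨f, h l⟩`. -/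
noncomputable def dualComul [Module.Finite k H] [Module.Projective k H] :
    Module.Dual k H →ₗ[k] Module.Dual k H ⊗[k] Module.Dual k H :=
  (homTensorHomEquiv k H H k k).symm.toLinearMap ∘ₗ
    LinearMap.llcomp k (H ⊗[k] H) k (k ⊗[k] k) (TensorProduct.lid k k).symm.toLinearMap ∘ₗ
      (LinearMap.mul' k H).dualMap

theorem dualDistrib_dualComul [Module.Finite k H] [Module.Projective k H]
    (f : Module.Dual k H) (h l : H) :
    TensorProduct.dualDistrib k H H (dualComul k H f) (h ⊗ₜ l) = f (h * l) := by
  have e : homTensorHomEquiv k H H k k (dualComul k H f) =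
      (TensorProduct.lid k k).symm.toLinearMap ∘ₗ f ∘ₗ LinearMap.mul' k H :=
    (homTensorHomEquiv k H H k k).apply_symm_apply _
  have e2 : TensorProduct.dualDistrib k H H (dualComul k H f) =
      (TensorProduct.lid k k).toLinearMap ∘ₗ homTensorHomEquiv k H H k k (dualComul k H f) := by
    generalize dualComul k H f = t
    induction t with
    | zero => simp
    | add x y hx hy => simp only [map_add, hx, hy, LinearMap.comp_add]
    | tmul f g => ext; simp
  rw [e2, e]
  simp

/-- The underlying `k`-module `H ⊗ H*` of `H ⋈ H*`. -/
abbrev Smash : Type (max u v) := H ⊗[k] Module.Dual k H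

variable {k H} in
/-- `hit f a c` is the functional `a ⇀ f ↼ c : l ↦ f(c l a)`. -/
noncomputable def hit (f : Module.Dual k H) : H →ₗ[k] H →ₗ[k] Module.Dual k H :=
  LinearMap.mk₂ k (fun a c => f ∘ₗ LinearMap.mulLeft k c ∘ₗ LinearMap.mulRight k a)
    (by intros; ext; simp [mul_add]) (by intros; ext; simp)
    (by intros; ext; simp [add_mul]) (by intros; ext; simp)

variable {k H} in
@[simp] theorem hit_apply (f : Module.Dual k H) (a c l : H) : hit f a c l = f (c * (l * a)) := rfl

variable [WeakHopfAlgebra k H] [WeakHopfAlgebra.BijectiveAntipode k H]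

open WeakHopfAlgebra

variable {k H} in
/-- `a ⊗ (b ⊗ c) ↦ b ⊗ (S⁻¹(a) ⇀ f ↼ c)`. -/
noncomputable def smashAux (f : Module.Dual k H) : H ⊗[k] (H ⊗[k] H) →ₗ[k] Smash k H :=
  TensorProduct.lift (LinearMap.lTensorHom H ∘ₗ hit f ∘ₗ antipodeInv k H)

variable {k H} in
@[simp] theorem smashAux_tmul (f : Module.Dual k H) (a b c : H) :
    smashAux f (a ⊗ₜ (b ⊗ₜ c)) = b ⊗ₜ[k] hit f (antipodeInv k H a) c := rfl

/-- `R(f ⊗ h) = h₍₂₎ ⊗ (S⁻¹(h₍₁₎) ⇀ f ↼ h₍₃₎)`. -/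
noncomputable def smashTwist : Module.Dual k H ⊗[k] H →ₗ[k] Smash k H :=
  TensorProduct.lift
    { toFun := fun f => smashAux f ∘ₗ (Coalgebra.comul (R := k) (A := H)).lTensor H ∘ₗ
        Coalgebra.comul
      map_add' := fun f g => by
        have : smashAux (f + g) = smashAux f + smashAux g := by
          ext a b c
          simp only [TensorProduct.AlgebraTensorModule.curry_apply, TensorProduct.curry_apply,
            LinearMap.coe_restrictScalars, smashAux_tmul, LinearMap.add_apply,
            ← TensorProduct.tmul_add]
          rfl
        rw [this, LinearMap.add_comp]
      map_smul' := fun c f => by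
        have : smashAux (c • f) = c • smashAux f := by
          ext a b d
          simp only [TensorProduct.AlgebraTensorModule.curry_apply, TensorProduct.curry_apply,
            LinearMap.coe_restrictScalars, smashAux_tmul, LinearMap.smul_apply,
            ← TensorProduct.tmul_smul]
          rfl
        rw [this, LinearMap.smul_comp, RingHom.id_apply] }

/-- The multiplication
`(h ⋈ f)(l ⋈ g) = h l₍₂₎ ⋈ (S⁻¹(l₍₁₎) ⇀ f ↼ l₍₃₎) * g` of `H ⋈ H*`. -/
noncomputable def smashMul : Smash k H ⊗[k] Smash k H →ₗ[k] Smash k H :=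
  TensorProduct.map (LinearMap.mul' k H) (dualMul k H) ∘ₗ
    (TensorProduct.tensorTensorTensorAssoc k H H (Module.Dual k H)
      (Module.Dual k H)).symm.toLinearMap ∘ₗ
    ((smashTwist k H).lTensor H).rTensor (Module.Dual k H) ∘ₗ
    (TensorProduct.tensorTensorTensorAssoc k H (Module.Dual k H) H
      (Module.Dual k H)).toLinearMap

/-- The element `1 ⋈ ε`. -/
noncomputable def preunit : Smash k H := (1 : H) ⊗ₜ[k] Coalgebra.counit (R := k) (A := H)

/-- The projection `p(x) = (1 ⋈ ε) x`. -/
noncomputable def smashProj : Smash k H →ₗ[k] Smash k H :=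
  smashMul k H ∘ₗ TensorProduct.mk k (Smash k H) (Smash k H) (preunit k H)

/-- The statement that `H ⋈ H*` is an associative algebra with preunit `1 ⋈ ε`. -/
structure SmashWellDefined : Prop where
  mul_assoc : ∀ x y z : Smash k H,
    smashMul k H (smashMul k H (x ⊗ₜ y) ⊗ₜ z) = smashMul k H (x ⊗ₜ smashMul k H (y ⊗ₜ z))
  preunit_comm : ∀ x : Smash k H,
    smashMul k H (preunit k H ⊗ₜ x) = smashMul k H (x ⊗ₜ preunit k H)
  preunit_sq : ∀ x : Smash k H, smashMul k H (x ⊗ₜ preunit k H) =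
    smashMul k H (x ⊗ₜ smashMul k H (preunit k H ⊗ₜ preunit k H))

end Smash

section Double

variable {k : Type u} {H : Type v} [CommRing k] [Ring H] [Algebra k H] [Coalgebra k H]
  [WeakHopfAlgebra k H] [WeakHopfAlgebra.BijectiveAntipode k H]

/-- The Drinfeld double `D(H) = (H ⋈ H*) / Ker p`. -/
def Double (_ : SmashWellDefined k H) : Type (max u v) :=
  Smash k H ⧸ LinearMap.ker (smashProj k H)

variable (h : SmashWellDefined k H)

noncomputable instance : AddCommGroup (Double h) :=
  inferInstanceAs (AddCommGroup (Smash k H ⧸ LinearMap.ker (smashProj k H)))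

noncomputable instance doubleModule : Module k (Double h) :=
  inferInstanceAs (Module k (Smash k H ⧸ LinearMap.ker (smashProj k H)))

theorem smashProj_mul_left (h : SmashWellDefined k H) (x y : Smash k H) (hx : smashProj k H x = 0) :
    smashProj k H (smashMul k H (x ⊗ₜ y)) = 0 := by
  change smashMul k H (_ ⊗ₜ _) = 0
  rw [← h.mul_assoc]
  change smashMul k H (smashProj k H x ⊗ₜ y) = 0
  rw [hx, TensorProduct.zero_tmul, map_zero]

theorem smashProj_mul_right (h : SmashWellDefined k H) (x y : Smash k H) (hy : smashProj k H y = 0) :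
    smashProj k H (smashMul k H (x ⊗ₜ y)) = 0 := by
  have hy' : smashMul k H (y ⊗ₜ preunit k H) = 0 := by
    rw [← h.preunit_comm]; exact hy
  change smashMul k H (_ ⊗ₜ _) = 0
  rw [h.preunit_comm, h.mul_assoc, hy', TensorProduct.tmul_zero, map_zero]

/-- The multiplication induced by `H ⋈ H*` on `D(H)`. -/
noncomputable def doubleMul : Double h →ₗ[k] Double h →ₗ[k] Double h :=
  (LinearMap.ker (smashProj k H)).liftQ
    { toFun := fun x => (LinearMap.ker (smashProj k H)).mapQ (LinearMap.ker (smashProj k H))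
        (smashMul k H ∘ₗ TensorProduct.mk k (Smash k H) (Smash k H) x)
        (fun y hy => smashProj_mul_right h x y hy)
      map_add' := fun x x' => by
        refine Submodule.linearMap_qext _ (LinearMap.ext fun y => ?_)
        refine congrArg (LinearMap.ker (smashProj k H)).mkQ (?_ : smashMul k H ((x + x') ⊗ₜ y) =
          smashMul k H (x ⊗ₜ y) + smashMul k H (x' ⊗ₜ y))
        rw [TensorProduct.add_tmul, map_add]
      map_smul' := fun c x => by
        refine Submodule.linearMap_qext _ (LinearMap.ext fun y => ?_)
        refine congrArg (LinearMap.ker (smashProj k H)).mkQ (?_ : smashMul k H ((c • x) ⊗ₜ y) =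
          c • smashMul k H (x ⊗ₜ y))
        rw [← TensorProduct.smul_tmul', map_smul] }
    (fun x hx => by
      refine Submodule.linearMap_qext _ (LinearMap.ext fun y => ?_)
      exact (Submodule.Quotient.mk_eq_zero _).mpr (smashProj_mul_left h x y hx))

/-- The class `[x]` in `D(H)` of an element of `H ⋈ H*`, as a bare additive map. -/
noncomputable def doubleMk₀ : Smash k H → Double h := (LinearMap.ker (smashProj k H)).mkQ

theorem doubleMk₀_surjective : Function.Surjective (doubleMk₀ h) :=
  Submodule.mkQ_surjective _

theorem doubleMul_mk (x y : Smash k H) :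
    doubleMul h (doubleMk₀ h x) (doubleMk₀ h y) = doubleMk₀ h (smashMul k H (x ⊗ₜ y)) := rfl

theorem doubleMk₀_preunit_mul (x : Smash k H) :
    doubleMk₀ h (smashMul k H (preunit k H ⊗ₜ x)) = doubleMk₀ h x := by
  refine (Submodule.Quotient.eq _).mpr ?_
  rw [LinearMap.mem_ker, map_sub, sub_eq_zero]
  change smashMul k H (preunit k H ⊗ₜ smashMul k H (preunit k H ⊗ₜ x)) =
    smashMul k H (preunit k H ⊗ₜ x)
  rw [h.preunit_comm (smashMul k H _), h.preunit_comm x, h.mul_assoc, ← h.preunit_sq]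

/-- `D(H)` is a ring with `[x][y] = [xy]` and unit `[1 ⋈ ε]`. -/
noncomputable instance doubleRing : Ring (Double h) :=
  { (inferInstance : AddCommGroup (Double h)) with
    mul := fun x y => doubleMul h x y
    one := doubleMk₀ h (preunit k H)
    left_distrib := fun x y z => map_add (doubleMul h x) y z
    right_distrib := fun x y z => LinearMap.map_add₂ (doubleMul h) x y z
    zero_mul := fun x => LinearMap.map_zero₂ (doubleMul h) x
    mul_zero := fun x => map_zero (doubleMul h x)
    mul_assoc := fun x y z => by
      obtain ⟨x, rfl⟩ := doubleMk₀_surjective h x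
      obtain ⟨y, rfl⟩ := doubleMk₀_surjective h y
      obtain ⟨z, rfl⟩ := doubleMk₀_surjective h z
      exact congrArg (doubleMk₀ h) (h.mul_assoc x y z)
    one_mul := fun x => by
      obtain ⟨x, rfl⟩ := doubleMk₀_surjective h x
      exact doubleMk₀_preunit_mul h x
    mul_one := fun x => by
      obtain ⟨x, rfl⟩ := doubleMk₀_surjective h x
      refine (congrArg (doubleMk₀ h) (h.preunit_comm x).symm).trans ?_
      exact doubleMk₀_preunit_mul h x }

noncomputable instance doubleAlgebra : Algebra k (Double h) :=
  Algebra.ofModule (fun c x y => LinearMap.map_smul₂ (doubleMul h) c x y)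
    (fun c x y => map_smul (doubleMul h x) c y)

/-- The canonical surjection `x ↦ [x]` from `H ⋈ H*` onto `D(H)`. -/
noncomputable def doubleMk : Smash k H →ₗ[k] Double h where
  toFun := doubleMk₀ h
  map_add' x y := map_add (LinearMap.ker (smashProj k H)).mkQ x y
  map_smul' c x := map_smul (LinearMap.ker (smashProj k H)).mkQ c x

theorem doubleMk_mul (x y : Smash k H) :
    doubleMk h x * doubleMk h y = doubleMk h (smashMul k H (x ⊗ₜ y)) := rfl

theorem doubleMk_preunit : doubleMk h (preunit k H) = 1 := rfl

theorem doubleMk_eq_zero_iff (x : Smash k H) : doubleMk h x = 0 ↔ smashProj k H x = 0 :=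
  Submodule.Quotient.mk_eq_zero _

variable (k H) in
/-- `h ⋈ f ↦ (h₍₂₎ ⋈ f₍₁₎) ⊗ (h₍₁₎ ⋈ f₍₂₎)`. -/
noncomputable def smashComul [Module.Finite k H] [Module.Projective k H] :
    Smash k H →ₗ[k] Smash k H ⊗[k] Smash k H :=
  (TensorProduct.tensorTensorTensorComm k H H (Module.Dual k H) (Module.Dual k H)).toLinearMap ∘ₗ
    TensorProduct.map ((TensorProduct.comm k H H).toLinearMap ∘ₗ Coalgebra.comul) (dualComul k H)

variable (k H) in
/-- `h ⋈ f ↦ ⟨f, 1₍₂₎⟩ ε(h 1₍₁₎)`. -/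
noncomputable def smashCounit : Smash k H →ₗ[k] k :=
  contractRight k H ∘ₗ (WeakBialgebra.epsTBar k H).rTensor (Module.Dual k H)

/-- The comultiplication `Δ[h ⋈ f] = [h₍₂₎ ⋈ f₍₁₎] ⊗ [h₍₁₎ ⋈ f₍₂₎]` and the counit
`ε[h ⋈ f] = ⟨f, 1₍₂₎⟩ ε(h 1₍₁₎)` of `D(H)`, as a condition on a coalgebra structure. -/
structure IsDoubleCoalgebra [Module.Finite k H] [Module.Projective k H]
    [Coalgebra k (Double h)] : Prop where
  comul_mk : ∀ x : Smash k H, Coalgebra.comul (R := k) (doubleMk h x) =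
    TensorProduct.map (doubleMk h) (doubleMk h) (smashComul k H x)
  counit_mk : ∀ x : Smash k H, Coalgebra.counit (R := k) (doubleMk h x) = smashCounit k H x

end Double

/-! ## The functor from Yetter-Drinfeld modules to modules over the double -/

section Functor

variable {k : Type u} {H : Type v} [CommRing k] [Ring H] [Algebra k H] [Coalgebra k H]

/-- `m ↦ ⟨f, m₍₁₎⟩ m₍₀₎`. -/
noncomputable def dualAction (M : YDMod.{u, v, w} k H) (f : Module.Dual k H) :
    M.toAlgMod →ₗ[k] M.toAlgMod :=
  (TensorProduct.rid k M.toAlgMod).toLinearMap ∘ₗ f.lTensor M.toAlgMod ∘ₗ M.coact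

/-- The action `(h ⋈ f) m = ⟨f, m₍₁₎⟩ h m₍₀₎` of `H ⋈ H*` on `M`. -/
noncomputable def smashAction (M : YDMod.{u, v, w} k H) :
    Smash k H →ₗ[k] M.toAlgMod →ₗ[k] M.toAlgMod :=
  TensorProduct.lift (LinearMap.mk₂ k
    (fun h f => Algebra.lsmul k k M.toAlgMod h ∘ₗ dualAction M f)
    (by intros; ext; simp [add_smul]) (by intros; ext; simp)
    (by intros; ext; simp [dualAction, LinearMap.lTensor_add])
    (by
      intro c h f
      ext m
      have e : dualAction M (c • f) m = c • dualAction M f m := by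
        simp [dualAction, LinearMap.lTensor_smul]
      change h • dualAction M (c • f) m = c • h • dualAction M f m
      rw [e]
      exact smul_comm _ _ _))

theorem smashAction_tmul (M : YDMod.{u, v, w} k H) (h : H) (f : Module.Dual k H)
    (m : M.toAlgMod) : smashAction M (h ⊗ₜ f) m = h • dualAction M f m := rfl

theorem smashAction_map {M N : YDMod.{u, v, w} k H} (f : M ⟶ N) (x : Smash k H)
    (m : M.toAlgMod) : f.lin.hom (smashAction M x m) = smashAction N x (f.lin.hom m) := by
  induction x using TensorProduct.induction_on with
  | zero => simp
  | add x y hx hy => simp only [map_add, LinearMap.add_apply, hx, hy]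
  | tmul h g =>
    change f.lin.hom (h • dualAction M g m) = h • dualAction N g (f.lin.hom m)
    rw [map_smul]
    congr 1
    have e := f.colinear m
    simp only [dualAction, LinearMap.comp_apply, LinearEquiv.coe_coe]
    rw [e]
    generalize M.coact m = X
    induction X with
    | zero => simp
    | add X Y hX hY => simp only [map_add, hX, hY]
    | tmul a b =>
      simp only [LinearMap.lTensor_tmul, LinearMap.rTensor_tmul, TensorProduct.rid_tmul]
      exact map_smul (AlgMod.Hom.lin f.lin) _ _

variable [WeakHopfAlgebra k H] [WeakHopfAlgebra.BijectiveAntipode k H]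

variable (k H) in
/-- The statement that `(h ⋈ f) m = ⟨f, m₍₁₎⟩ h m₍₀₎` is an action of `H ⋈ H*` on every
left-right Yetter-Drinfeld module and that the preunit acts as the identity. -/
structure ActionWellDefined : Prop where
  mul_act : ∀ (M : YDMod.{u, v, w} k H) (x y : Smash k H) (m : M.toAlgMod),
    smashAction M (smashMul k H (x ⊗ₜ y)) m = smashAction M x (smashAction M y m)
  preunit_act : ∀ (M : YDMod.{u, v, w} k H) (m : M.toAlgMod),
    smashAction M (preunit k H) m = m

variable (hD : SmashWellDefined k H) (hF : ActionWellDefined.{u, v, w} k H)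

/-- The induced action of `D(H)` on `M`. -/
noncomputable def doubleAction (M : YDMod.{u, v, w} k H) :
    Double hD →ₗ[k] M.toAlgMod →ₗ[k] M.toAlgMod :=
  (LinearMap.ker (smashProj k H)).liftQ (smashAction M) (fun x hx => by
    rw [LinearMap.mem_ker] at hx ⊢
    ext m
    rw [← hF.preunit_act M (smashAction M x m), ← hF.mul_act]
    change smashAction M (smashProj k H x) m = 0
    rw [hx, map_zero, LinearMap.zero_apply])

/-- `M` as a `D(H)`-module. -/
@[reducible] noncomputable def doubleActionModule (M : YDMod.{u, v, w} k H) :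
    Module (Double hD) M.toAlgMod where
  smul x m := doubleAction hD hF M x m
  one_smul m := hF.preunit_act M m
  mul_smul x y m := by
    obtain ⟨x, rfl⟩ := doubleMk₀_surjective hD x
    obtain ⟨y, rfl⟩ := doubleMk₀_surjective hD y
    exact hF.mul_act M x y m
  smul_zero x := map_zero (doubleAction hD hF M x)
  smul_add x m n := map_add (doubleAction hD hF M x) m n
  add_smul x y m := LinearMap.map_add₂ (doubleAction hD hF M) x y m
  zero_smul m := LinearMap.map_zero₂ (doubleAction hD hF M) m

/-- `F(M) = M` with the action `[h ⋈ f] m = ⟨f, m₍₁₎⟩ h m₍₀₎`. -/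
noncomputable def doubleObj (M : YDMod.{u, v, w} k H) : AlgMod.{u, max u v, w} k (Double hD) :=
  letI := doubleActionModule hD hF M
  { carrier := M.toAlgMod
    isScalarTower := ⟨fun c x m => LinearMap.map_smul₂ (doubleAction hD hF M) c x m⟩ }

/-- The functor `F` from left-right Yetter-Drinfeld modules to `D(H)`-modules; it is the
identity on the underlying maps. -/
noncomputable def doubleFunctor :
    YDMod.{u, v, w} k H ⥤ AlgMod.{u, max u v, w} k (Double hD) where
  obj M := doubleObj hD hF M
  map {M N} f := ⟨{
    toFun := fun m => f.lin.hom m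
    map_add' := fun m n => map_add f.lin.hom m n
    map_smul' := fun x m => by
      obtain ⟨x, rfl⟩ := doubleMk₀_surjective hD x
      exact smashAction_map f x m }⟩

end Functor

section Switch

variable {k H : Type u} [CommRing k] [Ring H] [Algebra k H] [Coalgebra k H]
  [WeakHopfAlgebra k H] [WeakHopfAlgebra.BijectiveAntipode k H]

/-- A map `F(N) ⊗_t F(M) ⟶ F(M ⊗_t N)` is the switch map if it is the restriction of
`n ⊗ m ↦ m ⊗ n`. -/
def IsSwitch (hD : SmashWellDefined k H) [Coalgebra k (Double hD)] [WeakBialgebra k (Double hD)]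
    (hY : YDMod.TensorWellDefined k H) (hF : ActionWellDefined.{u, u, u} k H)
    (M N : YDMod.{u, u, u} k H)
    (φ : tensor ((doubleFunctor hD hF).obj N) ((doubleFunctor hD hF).obj M) ⟶
      (doubleFunctor hD hF).obj ⟨_, _, hY.tensor M N⟩) : Prop :=
  ∀ x : tensor ((doubleFunctor hD hF).obj N) ((doubleFunctor hD hF).obj M),
    (incl M.toAlgMod N.toAlgMod (φ.hom x : tensor M.toAlgMod N.toAlgMod) :
        M.toAlgMod ⊗[k] N.toAlgMod) =
      TensorProduct.comm k N.toAlgMod M.toAlgMod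
        (incl ((doubleFunctor hD hF).obj N) ((doubleFunctor hD hF).obj M) x)

end Switch

end Drinfeld

/-- An isomorphism of categories: a functor with a strict inverse. -/
def IsIsomorphismOfCategories {C : Type*} [Category C] {D : Type*} [Category D] (F : C ⥤ D) :
    Prop :=
  ∃ G : D ⥤ C, F ⋙ G = 𝟭 C ∧ G ⋙ F = 𝟭 D

/-! Write T for S⁻¹. The core of the argument is that a left-right Yetter-Drinfeld structure on an
H-module M is the same as a coassociative counital coaction with ρ(l m) = l₍₂₎m₍₀₎ ⊗
l₍₃₎m₍₁₎T(l₍₁₎). The compatibility condition together with ρ(m) ∈ M ⊗_t H gives this formula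
(`coaction_smul`), and the formula gives both back (`isYetterDrinfeld_of_equivariant`). Evaluated on
functionals, the formula is the commutation rule of [1 ⋈ f] with [l ⋈ ε], coassociativity is the
multiplicativity of f ↦ [1 ⋈ f], and the counit law says that [1 ⋈ ε] acts as the identity. So
Yetter-Drinfeld modules are D(H)-modules. Since H is finitely generated projective, a dual basis eᵢ,
eⁱ recovers the coaction as ρ(m) = ∑ [1 ⋈ eⁱ]m ⊗ eᵢ. This is the inverse functor, and it is a strict
inverse because the underlying k-modules never change.

Associativity of H ⋈ H* and the properties of e = 1 ⋈ ε are direct computations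
(`smashMul_assoc_tmul`, `preunit_smashMul`, `smashMul_preunit_preunit`). They rest on the standard
facts about weak Hopf algebras: Δ(1) lies in source ⊗ target, source and target elements commute, S
reverses products and coproducts, and T agrees with `epsSBar` on the target space.

The weak bialgebra structure of D(H) is obtained by reconstruction. The regular D(H)-module, viewed
as a Yetter-Drinfeld module, separates the elements of D(H) and of D(H) ⊗ D(H) (`double_ext`,
`double_tensor_ext`). The comultiplication records the action on M ⊗_t N
(`incl_smashAction_tensorObj`), and the counit is d ↦ ε(d·1) for the action on H_t
(`counit_smashAction_unitObj`). Hence both factor through the quotient by Ker p. Multiplicativity of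
Δ and the counit laws are then tested on modules, and the weak counit axioms express that the unit
constraints of H_t ⊗_t H_t are D(H)-linear.

For the monoidal statement, h ↦ [h ⋈ ε] reverses the coproduct, so Δ(1) of the double is the flip of
Δ(1) of H. The switch therefore carries F(N) ⊗_t F(M) onto M ⊗_t N (`incl_switchLin`), and D(H)_t is
identified with H_t by d ↦ d·1. Coherence is checked on the generators `tm`. -/

/-! ## Sweedler calculus -/

namespace Sweedler

/-- Linearity as an unbundled predicate, for use with `fun_prop`. -/
@[fun_prop]
structure Lin (k : Type*) [CommRing k] {V W : Type*} [AddCommGroup V] [Module k V]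
    [AddCommGroup W] [Module k W] (f : V → W) : Prop where
  add : ∀ x y, f (x + y) = f x + f y
  smul : ∀ (c : k) x, f (c • x) = c • f x

section Lin

variable {k : Type*} [CommRing k] {U V W P : Type*} [AddCommGroup U] [Module k U]
  [AddCommGroup V] [Module k V] [AddCommGroup W] [Module k W] [AddCommGroup P] [Module k P]

/-- The bundled linear map. -/
def Lin.toLin {f : V → W} (h : Lin k f) : V →ₗ[k] W := ⟨⟨f, h.add⟩, h.smul⟩

@[fun_prop] theorem lin_id : Lin k (fun x : V => x) := ⟨fun _ _ => rfl, fun _ _ => rfl⟩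

@[fun_prop] theorem Lin.comp {f : V → W} {g : U → V} (hf : Lin k f) (hg : Lin k g) :
    Lin k (fun x => f (g x)) :=
  ⟨fun x y => by rw [hg.add, hf.add], fun c x => by rw [hg.smul, hf.smul]⟩

@[fun_prop] theorem lin_coe (φ : V →ₗ[k] W) : Lin k (fun x => φ x) := ⟨map_add φ, map_smul φ⟩

@[fun_prop] theorem lin_equiv (φ : V ≃ₗ[k] W) : Lin k (fun x => φ x) := ⟨map_add φ, map_smul φ⟩

@[fun_prop] theorem lin_eval {f : U → (V →ₗ[k] W)} (hf : Lin k f) (v : V) :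
    Lin k (fun x => f x v) :=
  ⟨fun x y => by rw [hf.add, LinearMap.add_apply], fun c x => by rw [hf.smul, LinearMap.smul_apply]⟩

@[fun_prop] theorem lin_tmul_left {f : U → V} (hf : Lin k f) (w : W) :
    Lin k (fun x => f x ⊗ₜ[k] w) :=
  ⟨fun x y => by rw [hf.add, add_tmul], fun c x => by rw [hf.smul, smul_tmul']⟩

@[fun_prop] theorem lin_tmul_right {f : U → V} (hf : Lin k f) (w : W) :
    Lin k (fun x => w ⊗ₜ[k] f x) :=
  ⟨fun x y => by rw [hf.add, tmul_add], fun c x => by rw [hf.smul, tmul_smul]⟩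

@[fun_prop] theorem lin_smul_left {f : U → k} (hf : Lin k f) (w : W) :
    Lin k (fun x => f x • w) :=
  ⟨fun x y => by rw [hf.add, add_smul], fun c x => by rw [hf.smul, smul_assoc]⟩

section Alg

variable {A : Type*} [Ring A] [Algebra k A] [Module A W] [IsScalarTower k A W]

@[fun_prop] theorem lin_mul_left {f : U → A} (hf : Lin k f) (a : A) :
    Lin k (fun x => f x * a) :=
  ⟨fun x y => by rw [hf.add, add_mul], fun c x => by rw [hf.smul, smul_mul_assoc]⟩

@[fun_prop] theorem lin_mul_right {f : U → A} (hf : Lin k f) (a : A) :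
    Lin k (fun x => a * f x) :=
  ⟨fun x y => by rw [hf.add, mul_add], fun c x => by rw [hf.smul, mul_smul_comm]⟩

@[fun_prop] theorem lin_act_left {f : U → A} (hf : Lin k f) (w : W) :
    Lin k (fun x => f x • w) :=
  ⟨fun x y => by rw [hf.add, add_smul], fun c x => by rw [hf.smul, smul_assoc]⟩

@[fun_prop] theorem lin_act_right {f : U → W} (hf : Lin k f) (a : A) :
    Lin k (fun x => a • f x) :=
  ⟨fun x y => by rw [hf.add, smul_add], fun c x => by
    rw [hf.smul, ← algebraMap_smul A c (f x), ← mul_smul, ← Algebra.commutes, mul_smul,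
      algebraMap_smul]⟩

end Alg

section Coalg

variable {C : Type*} [AddCommGroup C] [Module k C] [Coalgebra k C]

@[fun_prop] theorem lin_comul {f : U → C} (hf : Lin k f) :
    Lin k (fun x => Coalgebra.comul (R := k) (f x)) := (lin_coe _).comp hf

@[fun_prop] theorem lin_counit {f : U → C} (hf : Lin k f) :
    Lin k (fun x => Coalgebra.counit (R := k) (f x)) := (lin_coe _).comp hf

end Coalg

end Lin

/-! ### Sums over a chosen expression of a tensor. -/

section Sum

variable {k : Type*} [CommRing k] {U V W P Q : Type*} [AddCommGroup U] [Module k U]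
  [AddCommGroup V] [Module k V] [AddCommGroup W] [Module k W] [AddCommGroup P] [Module k P]
  [AddCommGroup Q] [Module k Q]

/-- `sm t F` is `∑ F aᵢ bᵢ` for a chosen expression `t = ∑ aᵢ ⊗ bᵢ`. -/
noncomputable def sm (t : V ⊗[k] W) (F : V → W → P) : P :=
  ∑ i ∈ (TensorProduct.exists_finset t).choose, F i.1 i.2

/-- A chosen finite sum: additive maps pass inside and sums may be exchanged whatever `F` is.
Bilinearity of `F` is needed only when the tensor itself is replaced. -/
theorem map_sm {G : Type*} [FunLike G P Q] [AddMonoidHomClass G P Q] (φ : G) (t : V ⊗[k] W)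
    (F : V → W → P) : φ (sm t F) = sm t fun a b => φ (F a b) := map_sum φ _ _

theorem sm_congr {t : V ⊗[k] W} {F G : V → W → P} (h : ∀ a b, F a b = G a b) :
    sm t F = sm t G := Finset.sum_congr rfl fun _ _ => h _ _

theorem sm_tmul_eq (t : V ⊗[k] W) : sm t (fun a b => a ⊗ₜ[k] b) = t :=
  (TensorProduct.exists_finset t).choose_spec.symm

theorem sm_comm {V' W' : Type*} [AddCommGroup V'] [Module k V'] [AddCommGroup W'] [Module k W']
    (t : V ⊗[k] W) (s : V' ⊗[k] W') (F : V → W → V' → W' → P) :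
    (sm t fun a b => sm s fun c d => F a b c d) = sm s fun c d => sm t fun a b => F a b c d :=
  Finset.sum_comm

theorem sm_eq_lift (t : V ⊗[k] W) (φ : V →ₗ[k] W →ₗ[k] P) :
    (sm t fun a b => φ a b) = lift φ t := by
  conv_rhs => rw [← sm_tmul_eq t, map_sm]
  rfl

/-- A bilinear function as a bundled bilinear map. -/
def bil {F : V → W → P} (h₁ : ∀ b, Lin k fun a => F a b) (h₂ : ∀ a, Lin k (F a)) :
    V →ₗ[k] W →ₗ[k] P :=
  LinearMap.mk₂ k F (fun a a' b => (h₁ b).add a a') (fun c a b => (h₁ b).smul c a)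
    (fun a => (h₂ a).add) (fun c a b => (h₂ a).smul c b)

theorem sm_eq_lift' (t : V ⊗[k] W) {F : V → W → P} (h₁ : ∀ b, Lin k fun a => F a b)
    (h₂ : ∀ a, Lin k fun b => F a b) : sm t F = lift (bil h₁ h₂) t := sm_eq_lift t (bil h₁ h₂)

/-- The expression chosen for a pure tensor need not be the obvious one; bilinearity makes the value
independent of the choice. -/
theorem sm_tmul (a : V) (b : W) {F : V → W → P} (h₁ : ∀ b, Lin k fun a => F a b)
    (h₂ : ∀ a, Lin k fun b => F a b) : sm (a ⊗ₜ[k] b) F = F a b := by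
  rw [sm_eq_lift' _ h₁ h₂]; rfl

@[fun_prop] theorem lin_sm_left {f : U → V ⊗[k] W} {F : V → W → P} (hf : Lin k f)
    (h₁ : ∀ b, Lin k fun a => F a b) (h₂ : ∀ a, Lin k fun b => F a b) :
    Lin k (fun x => sm (f x) F) := by
  simp_rw [sm_eq_lift' _ h₁ h₂]
  fun_prop

@[fun_prop] theorem lin_sm_right (t : V ⊗[k] W) {F : U → V → W → P}
    (hF : ∀ a b, Lin k fun x => F x a b) : Lin k (fun x => sm t (F x)) :=
  ⟨fun x y => by simp only [sm, (hF _ _).add, Finset.sum_add_distrib],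
    fun c x => by simp only [sm, (hF _ _).smul, Finset.smul_sum]⟩

theorem Lin.map_sm {φ : P → Q} (h : Lin k φ) (t : V ⊗[k] W) (F : V → W → P) :
    φ (sm t F) = sm t fun a b => φ (F a b) := Sweedler.map_sm h.toLin t F

theorem smul_sm {R : Type*} [Monoid R] [DistribMulAction R P] (c : R) (t : V ⊗[k] W)
    (F : V → W → P) : c • sm t F = sm t fun a b => c • F a b := Finset.smul_sum

theorem sm_map {V' W' : Type*} [AddCommGroup V'] [Module k V'] [AddCommGroup W'] [Module k W']
    (f : V →ₗ[k] V') (g : W →ₗ[k] W') (t : V ⊗[k] W) {F : V' → W' → P}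
    (h₁ : ∀ b, Lin k fun a => F a b) (h₂ : ∀ a, Lin k fun b => F a b) :
    sm (TensorProduct.map f g t) F = sm t fun a b => F (f a) (g b) := by
  have h : Lin k fun s : V' ⊗[k] W' => sm s F := by fun_prop
  conv_lhs => rw [← sm_tmul_eq t, Sweedler.map_sm]
  rw [h.map_sm]
  exact sm_congr fun a b => sm_tmul _ _ h₁ h₂

theorem sm_sm {V' W' : Type*} [AddCommGroup V'] [Module k V'] [AddCommGroup W'] [Module k W']
    (t : V ⊗[k] W) (G : V → W → V' ⊗[k] W') {F : V' → W' → P}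
    (h₁ : ∀ b, Lin k fun a => F a b) (h₂ : ∀ a, Lin k fun b => F a b) :
    sm (sm t G) F = sm t fun a b => sm (G a b) F := by
  have h : Lin k fun s : V' ⊗[k] W' => sm s F := by fun_prop
  exact h.map_sm t G

theorem sm_swap (t : V ⊗[k] W) {F : W → V → P}
    (h₁ : ∀ b, Lin k fun a => F a b) (h₂ : ∀ a, Lin k fun b => F a b) :
    sm (TensorProduct.comm k V W t) F = sm t fun a b => F b a := by
  have h : Lin k fun s : W ⊗[k] V => sm s F := by fun_prop
  conv_lhs => rw [← sm_tmul_eq t, Sweedler.map_sm]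
  rw [h.map_sm]
  exact sm_congr fun a b => sm_tmul _ _ h₁ h₂

theorem sm_lTensor {W' : Type*} [AddCommGroup W'] [Module k W'] (g : W →ₗ[k] W') (t : V ⊗[k] W)
    {F : V → W' → P} (h₁ : ∀ b, Lin k fun a => F a b) (h₂ : ∀ a, Lin k fun b => F a b) :
    sm (g.lTensor V t) F = sm t fun a b => F a (g b) := sm_map LinearMap.id g t h₁ h₂

theorem sm_rTensor {V' : Type*} [AddCommGroup V'] [Module k V'] (g : V →ₗ[k] V') (t : V ⊗[k] W)
    {F : V' → W → P} (h₁ : ∀ b, Lin k fun a => F a b) (h₂ : ∀ a, Lin k fun b => F a b) :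
    sm (g.rTensor W t) F = sm t fun a b => F (g a) b := sm_map g LinearMap.id t h₁ h₂

theorem sm_assoc (t : (U ⊗[k] V) ⊗[k] W) {F : U → V → W → P} (h₁ : ∀ b c, Lin k fun a => F a b c)
    (h₂ : ∀ a c, Lin k fun b => F a b c) (h₃ : ∀ a b, Lin k fun c => F a b c) :
    (sm (TensorProduct.assoc k U V W t) fun a s => sm s fun b c => F a b c) =
      sm t fun s c => sm s fun a b => F a b c := by
  have h : Lin k fun s : U ⊗[k] (V ⊗[k] W) => sm s fun a s => sm s fun b c => F a b c := by fun_prop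
  have h' : ∀ c, Lin k fun s : U ⊗[k] V => sm (TensorProduct.assoc k U V W (s ⊗ₜ[k] c))
    fun a s => sm s fun b c => F a b c := by fun_prop
  conv_lhs => rw [← sm_tmul_eq t, Sweedler.map_sm]
  rw [h.map_sm]
  refine sm_congr fun s c => ?_
  conv_lhs => rw [← sm_tmul_eq s]
  rw [(h' c).map_sm]
  refine sm_congr fun a b => ?_
  rw [TensorProduct.assoc_tmul, sm_tmul, sm_tmul] <;> fun_prop

theorem lin_ext {f g : V ⊗[k] W → P} (hf : Lin k f) (hg : Lin k g)
    (h : ∀ a b, f (a ⊗ₜ b) = g (a ⊗ₜ b)) (t : V ⊗[k] W) : f t = g t := by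
  rw [← sm_tmul_eq t, hf.map_sm, hg.map_sm]
  exact sm_congr h

section Mul

variable {A B : Type*} [Ring A] [Algebra k A] [Ring B] [Algebra k B]

theorem sm_mul (s t : A ⊗[k] B) {F : A → B → P}
    (h₁ : ∀ b, Lin k fun a => F a b) (h₂ : ∀ a, Lin k fun b => F a b) :
    sm (s * t) F = sm s fun a b => sm t fun c d => F (a * c) (b * d) := by
  have e : s * t = sm s fun a b => sm t fun c d => (a * c) ⊗ₜ[k] (b * d) := by
    conv_lhs => rw [← sm_tmul_eq s, ← sm_tmul_eq t]
    simp only [sm, Finset.sum_mul, Finset.mul_sum, Algebra.TensorProduct.tmul_mul_tmul]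
    exact Finset.sum_comm
  have h : Lin k fun s : A ⊗[k] B => sm s F := by fun_prop
  rw [e, h.map_sm]
  refine sm_congr fun a b => ?_
  rw [h.map_sm]
  exact sm_congr fun c d => sm_tmul _ _ h₁ h₂

theorem sm_mul_const {V W : Type*} [AddCommGroup V] [Module k V] [AddCommGroup W] [Module k W]
    (t : V ⊗[k] W) (F : V → W → A) (a : A) :
    sm t F * a = sm t fun x y => F x y * a := Finset.sum_mul _ _ _

theorem const_mul_sm {V W : Type*} [AddCommGroup V] [Module k V] [AddCommGroup W] [Module k W]
    (t : V ⊗[k] W) (F : V → W → A) (a : A) :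
    a * sm t F = sm t fun x y => a * F x y := Finset.mul_sum _ _ _

end Mul

section Coalg

variable {C : Type*} [AddCommGroup C] [Module k C] [Coalgebra k C]

local notation "δ" => Coalgebra.comul (R := k)
local notation "ε" => Coalgebra.counit (R := k)

/-- The arguments of `F` are the three legs in order. Rewrites below name `F` explicitly, since the
two bracketings bind the legs differently. -/
theorem sm_coassoc (x : C) {F : C → C → C → P} (h₁ : ∀ b c, Lin k fun a => F a b c)
    (h₂ : ∀ a c, Lin k fun b => F a b c) (h₃ : ∀ a b, Lin k fun c => F a b c) :
    (sm (δ x) fun a b => sm (δ a) fun c d => F c d b) =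
      sm (δ x) fun a b => sm (δ b) fun c d => F a c d := by
  have h := congrArg (fun T => sm T fun a s => sm s fun b c => F a b c)
    (Coalgebra.coassoc_apply (R := k) x)
  rwa [sm_assoc _ h₁ h₂ h₃, sm_rTensor, sm_lTensor] at h <;> fun_prop

theorem sm_counit_left (x : C) {F : C → P} (hF : Lin k F) :
    (sm (δ x) fun a b => ε a • F b) = F x := by
  have h := congrArg (fun T => F (TensorProduct.lid k C T)) (Coalgebra.rTensor_counit_comul (R := k) x)
  simp only [TensorProduct.lid_tmul, one_smul] at h
  rw [← h]
  conv_rhs => rw [← sm_tmul_eq (δ x)]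
  simp only [Sweedler.map_sm, hF.map_sm, LinearMap.rTensor_tmul, TensorProduct.lid_tmul, hF.smul]

theorem sm_counit_right (x : C) {F : C → P} (hF : Lin k F) :
    (sm (δ x) fun a b => ε b • F a) = F x := by
  have h := congrArg (fun T => F (TensorProduct.rid k C T)) (Coalgebra.lTensor_counit_comul (R := k) x)
  simp only [TensorProduct.rid_tmul, one_smul] at h
  rw [← h]
  conv_rhs => rw [← sm_tmul_eq (δ x)]
  simp only [Sweedler.map_sm, hF.map_sm, LinearMap.lTensor_tmul, TensorProduct.rid_tmul, hF.smul]

end Coalg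

end Sum

end Sweedler

/-! ## Identities in weak bialgebras -/

namespace WeakBialgebra

open Sweedler

section Lin

variable {k : Type*} {A : Type*} [CommRing k] [Ring A] [Algebra k A] [Coalgebra k A]
  {U : Type*} [AddCommGroup U] [Module k U]

@[fun_prop] theorem lin_epsT {f : U → A} (hf : Lin k f) : Lin k fun x => epsT k A (f x) :=
  (lin_coe _).comp hf

@[fun_prop] theorem lin_epsS {f : U → A} (hf : Lin k f) : Lin k fun x => epsS k A (f x) :=
  (lin_coe _).comp hf

@[fun_prop] theorem lin_epsTBar {f : U → A} (hf : Lin k f) : Lin k fun x => epsTBar k A (f x) :=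
  (lin_coe _).comp hf

@[fun_prop] theorem lin_epsSBar {f : U → A} (hf : Lin k f) : Lin k fun x => epsSBar k A (f x) :=
  (lin_coe _).comp hf

end Lin

section Basic

variable {k : Type*} {A : Type*} [CommRing k] [Ring A] [Algebra k A] [Coalgebra k A]
  {P : Type*} [AddCommGroup P] [Module k P]

local notation "δ" => Coalgebra.comul (R := k)
local notation "ε" => Coalgebra.counit (R := k)

theorem contractLeftMul_eq_sm (t : A ⊗[k] A) (g : A) :
    contractLeftMul k A t g = sm t fun a b => ε (a * g) • b := by
  conv_lhs => rw [← sm_tmul_eq t]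
  rw [map_sm]
  exact map_sm (LinearMap.applyₗ (R := k) g) _ _

theorem contractRightMul_eq_sm (t : A ⊗[k] A) (g : A) :
    contractRightMul k A t g = sm t fun a b => ε (g * a) • b := by
  conv_lhs => rw [← sm_tmul_eq t]
  rw [map_sm]
  exact map_sm (LinearMap.applyₗ (R := k) g) _ _

theorem epsT_eq_sm (g : A) : epsT k A g = sm (δ (1 : A)) fun a b => ε (a * g) • b :=
  contractLeftMul_eq_sm _ _

theorem epsS_eq_sm (g : A) : epsS k A g = sm (δ (1 : A)) fun a b => ε (g * b) • a := by
  refine (contractRightMul_eq_sm _ _).trans (sm_swap _ ?_ ?_) <;> fun_prop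

theorem epsSBar_eq_sm (g : A) : epsSBar k A g = sm (δ (1 : A)) fun a b => ε (b * g) • a := by
  refine (contractLeftMul_eq_sm _ _).trans (sm_swap _ ?_ ?_) <;> fun_prop

theorem epsTBar_eq_sm (g : A) : epsTBar k A g = sm (δ (1 : A)) fun a b => ε (g * a) • b :=
  contractRightMul_eq_sm _ _

variable [WeakBialgebra k A]

theorem sm_comul_mul (a b : A) {F : A → A → P}
    (h₁ : ∀ b, Lin k fun a => F a b) (h₂ : ∀ a, Lin k fun b => F a b) :
    sm (δ (a * b)) F = sm (δ a) fun p q => sm (δ b) fun r s => F (p * r) (q * s) := by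
  rw [comul_mul, sm_mul _ _ h₁ h₂]

/-- This and `sm_comul_one'` are the two factorizations of Δ²(1). They differ only in the order of
the product in the middle leg, which is the origin of the commutation of source and target elements.
-/
theorem sm_comul_one (F : A → A → A → P) (h₁ : ∀ b c, Lin k fun a => F a b c)
    (h₂ : ∀ a c, Lin k fun b => F a b c) (h₃ : ∀ a b, Lin k fun c => F a b c) :
    (sm (δ (1 : A)) fun a b => sm (δ b) fun c d => F a c d) =
      sm (δ (1 : A)) fun a b => sm (δ (1 : A)) fun c d => F a (b * c) d := by
  have h := congrArg (fun T => sm T fun a s => sm s fun b c => F a b c)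
    (comul_comul_one (k := k) (A := A))
  simp (disch := fun_prop) only [sm_lTensor, sm_mul, sm_tmul] at h
  rw [h, sm_assoc] <;> try fun_prop
  simp (disch := fun_prop) only [sm_tmul, mul_one, one_mul]

theorem sm_comul_one' (F : A → A → A → P) (h₁ : ∀ b c, Lin k fun a => F a b c)
    (h₂ : ∀ a c, Lin k fun b => F a b c) (h₃ : ∀ a b, Lin k fun c => F a b c) :
    (sm (δ (1 : A)) fun a b => sm (δ b) fun c d => F a c d) =
      sm (δ (1 : A)) fun a b => sm (δ (1 : A)) fun c d => F a (c * b) d := by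
  have h := congrArg (fun T => sm T fun a s => sm s fun b c => F a b c)
    (comul_comul_one' (k := k) (A := A))
  simp (disch := fun_prop) only [sm_lTensor, sm_mul, sm_tmul] at h
  rw [h, sm_comm, sm_comm (δ (1 : A)) (δ (1 : A))]
  refine sm_congr fun a b => ?_
  rw [sm_assoc] <;> try fun_prop
  simp (disch := fun_prop) only [sm_tmul, mul_one, one_mul]

theorem sm_counit_mul_mul (a b c : A) :
    (sm (δ b) fun p q => ε (a * p) * ε (q * c)) = ε (a * b * c) := by
  rw [counit_mul_mul]
  conv_rhs => rw [← sm_tmul_eq (δ b)]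
  rw [map_sm, map_sm]
  rfl

theorem sm_counit_mul_mul' (a b c : A) :
    (sm (δ b) fun p q => ε (p * c) * ε (a * q)) = ε (a * b * c) := by
  rw [counit_mul_mul']
  conv_rhs => rw [← sm_tmul_eq (δ b)]
  rw [map_sm, map_sm]
  rfl

/-- The four contractions remove a counit applied to one leg of Δ(a) times a fixed element. The leg
and the side of multiplication decide which of the four counital maps appears. -/
theorem sm_contract₁ (a g : A) {F : A → P} (hF : Lin k F) :
    (sm (δ a) fun p q => ε (p * g) • F q) = F (a * epsT k A g) := by
  rw [← contractLeftMul_comul, contractLeftMul_eq_sm, hF.map_sm]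
  exact sm_congr fun p q => (hF.smul _ _).symm

theorem sm_contract₂ (a g : A) {F : A → P} (hF : Lin k F) :
    (sm (δ a) fun p q => ε (q * g) • F p) = F (a * epsSBar k A g) := by
  rw [← contractLeftMul_comm_comul, contractLeftMul_eq_sm, sm_swap, hF.map_sm] <;> try fun_prop
  exact sm_congr fun p q => (hF.smul _ _).symm

theorem sm_contract₃ (a g : A) {F : A → P} (hF : Lin k F) :
    (sm (δ a) fun p q => ε (g * p) • F q) = F (epsTBar k A g * a) := by
  rw [← contractRightMul_comul, contractRightMul_eq_sm, hF.map_sm]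
  exact sm_congr fun p q => (hF.smul _ _).symm

/-- Write a = 1a and split ε(g·1₍₂₎·a₍₂₎) by the weak counit axiom as ε(1₍₂₎a₍₂₎)ε(g1₍₃₎).
Regrouping the first two legs of Δ²(1) produces Δ(1₍₁₎a), and the ordinary counit law finishes. -/
theorem sm_contract₄ (a g : A) {F : A → P} (hF : Lin k F) :
    (sm (δ a) fun p q => ε (g * q) • F p) = F (epsS k A g * a) := by
  calc (sm (δ a) fun p q => ε (g * q) • F p)
    _ = sm (δ (1 * a)) fun p q => ε (g * q) • F p := by rw [one_mul]
    _ = sm (δ (1 : A)) fun c d => sm (δ a) fun p q => ε (g * (d * q)) • F (c * p) := by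
        rw [sm_comul_mul] <;> fun_prop
    _ = sm (δ a) fun p q => sm (δ (1 : A)) fun c d => ε (g * d * q) • F (c * p) := by
        rw [sm_comm]; simp only [mul_assoc]
    _ = sm (δ a) fun p q => sm (δ (1 : A)) fun c d => sm (δ d) fun r s =>
          (ε (r * q) * ε (g * s)) • F (c * p) := by
        refine sm_congr fun p q => sm_congr fun c d => ?_
        rw [← sm_counit_mul_mul' g d q]
        exact (lin_smul_left (k := k) (U := k) lin_id (F (c * p))).map_sm _ _
    _ = sm (δ a) fun p q => sm (δ (1 : A)) fun c d => sm (δ c) fun r s =>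
          (ε (s * q) * ε (g * d)) • F (r * p) := by
        refine sm_congr fun p q => ?_
        rw [sm_coassoc (1 : A) (F := fun r s d => (ε (s * q) * ε (g * d)) • F (r * p))] <;>
          fun_prop
    _ = sm (δ (1 : A)) fun c d => sm (δ (c * a)) fun r s => ε s • ε (g * d) • F r := by
        rw [sm_comm]
        refine sm_congr fun c d => ?_
        rw [sm_comul_mul, sm_comm] <;> try fun_prop
        simp only [mul_smul]
    _ = sm (δ (1 : A)) fun c d => ε (g * d) • F (c * a) := by
        refine sm_congr fun c d => ?_
        rw [sm_counit_right] ; fun_prop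
    _ = F (epsS k A g * a) := by
        rw [epsS_eq_sm, sm_mul_const, hF.map_sm]
        exact sm_congr fun c d => by rw [smul_mul_assoc, hF.smul]

/-! ### The target and source spaces -/

variable (k) in
/-- `z` lies in the target space: `Δ(z) = 1₍₁₎ z ⊗ 1₍₂₎ = z 1₍₁₎ ⊗ 1₍₂₎`. -/
structure IsTarget (z : A) : Prop where
  comul : δ z = δ 1 * (z ⊗ₜ[k] 1)
  comul' : δ z = (z ⊗ₜ[k] 1) * δ 1

variable (k) in
/-- `y` lies in the source space: `Δ(y) = 1₍₁₎ ⊗ 1₍₂₎ y = 1₍₁₎ ⊗ y 1₍₂₎`. -/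
structure IsSource (y : A) : Prop where
  comul : δ y = δ 1 * (1 ⊗ₜ[k] y)
  comul' : δ y = (1 ⊗ₜ[k] y) * δ 1

theorem IsTarget.sm_mul {z : A} (hz : IsTarget k z) (x : A) {F : A → A → P}
    (h₁ : ∀ b, Lin k fun a => F a b) (h₂ : ∀ a, Lin k fun b => F a b) :
    sm (δ (x * z)) F = sm (δ x) fun a b => F (a * z) b := by
  rw [comul_mul, hz.comul, ← mul_assoc, ← comul_mul, mul_one]
  simp (disch := fun_prop) only [Sweedler.sm_mul, sm_tmul, mul_one]

theorem IsTarget.sm_mul' {z : A} (hz : IsTarget k z) (x : A) {F : A → A → P}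
    (h₁ : ∀ b, Lin k fun a => F a b) (h₂ : ∀ a, Lin k fun b => F a b) :
    sm (δ (z * x)) F = sm (δ x) fun a b => F (z * a) b := by
  rw [comul_mul, hz.comul', mul_assoc, ← comul_mul, one_mul]
  simp (disch := fun_prop) only [Sweedler.sm_mul, sm_tmul, one_mul]

theorem IsSource.sm_mul {y : A} (hy : IsSource k y) (x : A) {F : A → A → P}
    (h₁ : ∀ b, Lin k fun a => F a b) (h₂ : ∀ a, Lin k fun b => F a b) :
    sm (δ (x * y)) F = sm (δ x) fun a b => F a (b * y) := by
  rw [comul_mul, hy.comul, ← mul_assoc, ← comul_mul, mul_one]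
  simp (disch := fun_prop) only [Sweedler.sm_mul, sm_tmul, mul_one]

theorem IsSource.sm_mul' {y : A} (hy : IsSource k y) (x : A) {F : A → A → P}
    (h₁ : ∀ b, Lin k fun a => F a b) (h₂ : ∀ a, Lin k fun b => F a b) :
    sm (δ (y * x)) F = sm (δ x) fun a b => F a (y * b) := by
  rw [comul_mul, hy.comul', mul_assoc, ← comul_mul, one_mul]
  simp (disch := fun_prop) only [Sweedler.sm_mul, sm_tmul, one_mul]

theorem sm_mul_one (x : A) {F : A → A → P}
    (h₁ : ∀ b, Lin k fun a => F a b) (h₂ : ∀ a, Lin k fun b => F a b) :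
    (sm (δ x) fun a b => sm (δ (1 : A)) fun c d => F (a * c) (b * d)) = sm (δ x) F := by
  rw [← sm_comul_mul _ _ h₁ h₂, mul_one]

theorem sm_one_mul (x : A) {F : A → A → P}
    (h₁ : ∀ b, Lin k fun a => F a b) (h₂ : ∀ a, Lin k fun b => F a b) :
    (sm (δ (1 : A)) fun a b => sm (δ x) fun c d => F (a * c) (b * d)) = sm (δ x) F := by
  rw [← sm_comul_mul _ _ h₁ h₂, one_mul]

theorem mul_tmul_eq_sm (t : A ⊗[k] A) (a b : A) :
    t * (a ⊗ₜ b) = sm t fun c d => (c * a) ⊗ₜ[k] (d * b) := by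
  conv_lhs => rw [← sm_tmul_eq t, sm_mul_const]
  simp only [Algebra.TensorProduct.tmul_mul_tmul]

theorem tmul_mul_eq_sm (t : A ⊗[k] A) (a b : A) :
    (a ⊗ₜ b) * t = sm t fun c d => (a * c) ⊗ₜ[k] (b * d) := by
  conv_lhs => rw [← sm_tmul_eq t, const_mul_sm]
  simp only [Algebra.TensorProduct.tmul_mul_tmul]

/-- Apply φ to the first leg of Δ²(1): its two factorizations become the two required formulas for
Δ. The values of `epsT` and `epsTBar` are slices of this kind. -/
theorem isTarget_of_sm (φ : A →ₗ[k] k) : IsTarget k (sm (δ (1 : A)) fun a b => φ a • b) := by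
  have h := sm_comul_one (k := k) (A := A) (fun a b c => φ a • (b ⊗ₜ[k] c))
    (by fun_prop) (by fun_prop) (by fun_prop)
  have h' := sm_comul_one' (k := k) (A := A) (fun a b c => φ a • (b ⊗ₜ[k] c))
    (by fun_prop) (by fun_prop) (by fun_prop)
  have e : δ (sm (δ (1 : A)) fun a b => φ a • b) =
      sm (δ (1 : A)) fun a b => sm (δ b) fun c d => φ a • (c ⊗ₜ[k] d) := by
    rw [map_sm]
    refine sm_congr fun a b => ?_
    rw [map_smul]
    conv_lhs => rw [← sm_tmul_eq (δ b)]
    exact map_sm (LinearMap.lsmul k (A ⊗[k] A) (φ a)) _ _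
  constructor
  · rw [e, h', mul_tmul_eq_sm, sm_comm]
    refine sm_congr fun a b => ?_
    rw [(by fun_prop : Lin k fun x : A => (a * x) ⊗ₜ[k] (b * 1)).map_sm]
    exact sm_congr fun c d => by rw [mul_one, mul_smul_comm, ← smul_tmul']
  · rw [e, h, tmul_mul_eq_sm, sm_comm]
    refine sm_congr fun a b => ?_
    rw [(by fun_prop : Lin k fun x : A => (x * a) ⊗ₜ[k] (1 * b)).map_sm]
    exact sm_congr fun c d => by rw [one_mul, smul_mul_assoc, ← smul_tmul']

/-- Mirror image: φ is applied to the last leg of Δ²(1). -/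
theorem isSource_of_sm (φ : A →ₗ[k] k) : IsSource k (sm (δ (1 : A)) fun a b => φ b • a) := by
  have h := sm_comul_one (k := k) (A := A) (fun a b c => φ c • (a ⊗ₜ[k] b))
    (by fun_prop) (by fun_prop) (by fun_prop)
  have h' := sm_comul_one' (k := k) (A := A) (fun a b c => φ c • (a ⊗ₜ[k] b))
    (by fun_prop) (by fun_prop) (by fun_prop)
  have e : δ (sm (δ (1 : A)) fun a b => φ b • a) =
      sm (δ (1 : A)) fun a b => sm (δ b) fun c d => φ d • (a ⊗ₜ[k] c) := by
    rw [map_sm, ← sm_coassoc (1 : A) (F := fun a c d => φ d • (a ⊗ₜ[k] c))] <;> try fun_prop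
    refine sm_congr fun a b => ?_
    rw [map_smul]
    conv_lhs => rw [← sm_tmul_eq (δ a)]
    exact map_sm (LinearMap.lsmul k (A ⊗[k] A) (φ b)) _ _
  constructor
  · rw [e, h, mul_tmul_eq_sm]
    refine sm_congr fun a b => ?_
    rw [(by fun_prop : Lin k fun x : A => (a * 1) ⊗ₜ[k] (b * x)).map_sm]
    exact sm_congr fun c d => by rw [mul_one, mul_smul_comm, tmul_smul]
  · rw [e, h', tmul_mul_eq_sm]
    refine sm_congr fun a b => ?_
    rw [(by fun_prop : Lin k fun x : A => (1 * a) ⊗ₜ[k] (x * b)).map_sm]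
    exact sm_congr fun c d => by rw [one_mul, smul_mul_assoc, tmul_smul]

theorem isTarget_epsT (g : A) : IsTarget k (epsT k A g) := by
  rw [epsT_eq_sm]; exact isTarget_of_sm (Coalgebra.counit ∘ₗ LinearMap.mulRight k g)

theorem isTarget_epsTBar (g : A) : IsTarget k (epsTBar k A g) := by
  rw [epsTBar_eq_sm]; exact isTarget_of_sm (Coalgebra.counit ∘ₗ LinearMap.mulLeft k g)

theorem isSource_epsS (g : A) : IsSource k (epsS k A g) := by
  rw [epsS_eq_sm]; exact isSource_of_sm (Coalgebra.counit ∘ₗ LinearMap.mulLeft k g)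

theorem isSource_epsSBar (g : A) : IsSource k (epsSBar k A g) := by
  rw [epsSBar_eq_sm]; exact isSource_of_sm (Coalgebra.counit ∘ₗ LinearMap.mulRight k g)

theorem IsTarget.sm {z : A} (hz : IsTarget k z) {F : A → A → P}
    (h₁ : ∀ b, Lin k fun a => F a b) (h₂ : ∀ a, Lin k fun b => F a b) :
    sm (δ z) F = sm (δ (1 : A)) fun a b => F (a * z) b := by
  rw [← hz.sm_mul _ h₁ h₂, one_mul]

theorem IsTarget.sm' {z : A} (hz : IsTarget k z) {F : A → A → P}
    (h₁ : ∀ b, Lin k fun a => F a b) (h₂ : ∀ a, Lin k fun b => F a b) :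
    Sweedler.sm (δ z) F = Sweedler.sm (δ (1 : A)) fun a b => F (z * a) b := by
  rw [← hz.sm_mul' _ h₁ h₂, mul_one]

theorem IsSource.sm {y : A} (hy : IsSource k y) {F : A → A → P}
    (h₁ : ∀ b, Lin k fun a => F a b) (h₂ : ∀ a, Lin k fun b => F a b) :
    sm (δ y) F = sm (δ (1 : A)) fun a b => F a (b * y) := by
  rw [← hy.sm_mul _ h₁ h₂, one_mul]

theorem IsSource.sm' {y : A} (hy : IsSource k y) {F : A → A → P}
    (h₁ : ∀ b, Lin k fun a => F a b) (h₂ : ∀ a, Lin k fun b => F a b) :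
    Sweedler.sm (δ y) F = Sweedler.sm (δ (1 : A)) fun a b => F a (y * b) := by
  rw [← hy.sm_mul' _ h₁ h₂, mul_one]

/-- The counit law applied to Δ(z) = 1₍₁₎z ⊗ 1₍₂₎. Together with `isTarget_epsT` it identifies
`IsTarget` with the image of `epsT`. -/
theorem IsTarget.epsT_eq {z : A} (hz : IsTarget k z) : epsT k A z = z := by
  rw [epsT_eq_sm, ← hz.sm (F := fun a b => ε a • b) (by fun_prop) (by fun_prop)]
  exact sm_counit_left z lin_id

theorem IsTarget.epsTBar_eq {z : A} (hz : IsTarget k z) : epsTBar k A z = z := by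
  rw [epsTBar_eq_sm, ← hz.sm' (F := fun a b => ε a • b) (by fun_prop) (by fun_prop)]
  exact sm_counit_left z lin_id

theorem IsSource.epsSBar_eq {y : A} (hy : IsSource k y) : epsSBar k A y = y := by
  rw [epsSBar_eq_sm, ← hy.sm (F := fun a b => ε b • a) (by fun_prop) (by fun_prop)]
  exact sm_counit_right y lin_id

theorem IsSource.epsS_eq {y : A} (hy : IsSource k y) : epsS k A y = y := by
  rw [epsS_eq_sm, ← hy.sm' (F := fun a b => ε b • a) (by fun_prop) (by fun_prop)]
  exact sm_counit_right y lin_id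

/-- Contract the outer legs of Δ²(1) with ε(z·) and ε(·y). As z = ε(z1₍₁₎)1₍₂₎ and y = 1₍₁₎ε(1₍₂₎y),
one factorization yields zy and the other yz. -/
theorem IsTarget.commute {z y : A} (hz : IsTarget k z) (hy : IsSource k y) : z * y = y * z := by
  have h := (sm_comul_one (k := k) (A := A) (fun a b c => ε (z * a) • ε (c * y) • b)
    (by fun_prop) (by fun_prop) (by fun_prop)).symm.trans (sm_comul_one' _
    (by fun_prop) (by fun_prop) (by fun_prop))
  have e₁ := epsTBar_eq_sm (k := k) z
  have e₂ := epsSBar_eq_sm (k := k) y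
  rw [hz.epsTBar_eq] at e₁
  rw [hy.epsSBar_eq] at e₂
  conv_lhs => rw [e₁, e₂]
  conv_rhs => rw [e₁, e₂]
  simp only [sm_mul_const, const_mul_sm, smul_mul_assoc, mul_smul_comm, smul_sm]
  refine Eq.trans ?_ h
  rw [sm_comm]
  exact sm_congr fun a b => sm_congr fun c d => smul_comm _ _ _

/-- Let `epsT` act on the second leg, which is harmless by `lTensor_epsT_comul_one`, and let `epsS`
act on the first. Expanded, both give the same double sum weighted by ε of a first leg times a
second leg. -/
theorem sm_one_left (F : A → A → P) (h₁ : ∀ b, Lin k fun a => F a b)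
    (h₂ : ∀ a, Lin k fun b => F a b) :
    sm (δ (1 : A)) F = sm (δ (1 : A)) fun a b => F (epsS k A a) b := by
  have e : ∀ F : A → A → P, (∀ b, Lin k fun a => F a b) → (∀ a, Lin k fun b => F a b) →
      (sm (δ (1 : A)) fun a b => F a (epsT k A b)) = sm (δ (1 : A)) F := by
    intro F h₁ h₂
    conv_rhs => rw [← lTensor_epsT_comul_one, sm_lTensor _ _ h₁ h₂]
  conv_lhs => rw [← e F h₁ h₂]
  simp_rw [epsS_eq_sm, (h₁ _).map_sm, (h₁ _).smul]
  rw [sm_comm]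
  refine sm_congr fun a b => ?_
  rw [sm_contract₁, one_mul]
  exact h₂ a

theorem sm_one_right (F : A → A → P) (h₁ : ∀ b, Lin k fun a => F a b)
    (h₂ : ∀ a, Lin k fun b => F a b) :
    sm (δ (1 : A)) F = sm (δ (1 : A)) fun a b => F a (epsT k A b) := by
  conv_lhs => rw [← lTensor_epsT_comul_one, sm_lTensor _ _ h₁ h₂]

/-- `Δ(1)` lies in the tensor product of the source and the target space. -/
theorem sm_one_congr {F G : A → A → P} (h₁ : ∀ b, Lin k fun a => F a b)
    (h₂ : ∀ a, Lin k fun b => F a b) (h₃ : ∀ b, Lin k fun a => G a b)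
    (h₄ : ∀ a, Lin k fun b => G a b)
    (h : ∀ a b, IsSource k a → IsTarget k b → F a b = G a b) :
    sm (δ (1 : A)) F = sm (δ (1 : A)) G := by
  rw [sm_one_left F h₁ h₂, sm_one_left G h₃ h₄,
    sm_one_right (fun a b => F (epsS k A a) b), sm_one_right (fun a b => G (epsS k A a) b)]
    <;> try fun_prop
  exact sm_congr fun a b => h _ _ (isSource_epsS a) (isTarget_epsT b)

theorem epsS_one : epsS k A 1 = 1 := by
  rw [epsS_eq_sm]
  simp only [one_mul]
  exact sm_counit_right _ lin_id

/-- In this and the next three lemmas a counital map on one leg of Δ(x) is traded for a fresh copy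
of Δ(1) and an undivided x. The antipode and module computations below end with this step. -/
theorem sm_epsT_right (x : A) {F : A → A → P} (h₁ : ∀ b, Lin k fun a => F a b)
    (h₂ : ∀ a, Lin k fun b => F a b) :
    (sm (δ x) fun a b => F a (epsT k A b)) = sm (δ (1 : A)) fun c d => F (c * x) d := by
  simp_rw [epsT_eq_sm, (h₂ _).map_sm, (h₂ _).smul]
  rw [sm_comm]
  simp_rw [sm_contract₄ x _ (h₁ _)]
  exact (sm_one_left (fun a b => F (a * x) b) (by fun_prop) (by fun_prop)).symm

theorem sm_epsS_left (x : A) {F : A → A → P} (h₁ : ∀ b, Lin k fun a => F a b)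
    (h₂ : ∀ a, Lin k fun b => F a b) :
    (sm (δ x) fun a b => F (epsS k A a) b) = sm (δ (1 : A)) fun c d => F c (x * d) := by
  simp_rw [epsS_eq_sm, (h₁ _).map_sm, (h₁ _).smul]
  rw [sm_comm]
  simp_rw [sm_contract₁ x _ (h₂ _)]
  exact (sm_one_right (fun a b => F a (x * b)) (by fun_prop) (by fun_prop)).symm

theorem sm_epsT_left (x : A) {F : A → A → P} (h₁ : ∀ b, Lin k fun a => F a b)
    (h₂ : ∀ a, Lin k fun b => F a b) :
    (sm (δ x) fun a b => F (epsT k A a) b) =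
      sm (δ (1 : A)) fun c d => F d (epsTBar k A c * x) := by
  simp_rw [epsT_eq_sm, (h₁ _).map_sm, (h₁ _).smul]
  rw [sm_comm]
  simp_rw [sm_contract₃ x _ (h₂ _)]

theorem sm_epsS_right (x : A) {F : A → A → P} (h₁ : ∀ b, Lin k fun a => F a b)
    (h₂ : ∀ a, Lin k fun b => F a b) :
    (sm (δ x) fun a b => F a (epsS k A b)) =
      sm (δ (1 : A)) fun c d => F (x * epsSBar k A d) c := by
  simp_rw [epsS_eq_sm, (h₂ _).map_sm, (h₂ _).smul]
  rw [sm_comm]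
  simp_rw [sm_contract₂ x _ (h₁ _)]

/-- The weak counit axiom with middle factor 1. -/
theorem counit_epsS_mul (a g : A) : ε (epsS k A a * g) = ε (a * g) := by
  rw [epsS_eq_sm, sm_mul_const, map_sm, ← mul_one a, ← sm_counit_mul_mul', mul_one]
  exact sm_congr fun p q => by rw [smul_mul_assoc, map_smul, smul_eq_mul, mul_comm]

theorem epsS_epsS_mul (h g : A) : epsS k A (epsS k A h * g) = epsS k A (h * g) := by
  rw [epsS_eq_sm (epsS k A h * g), epsS_eq_sm (h * g)]
  exact sm_congr fun a b => by rw [mul_assoc, counit_epsS_mul, mul_assoc]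

theorem counit_mul_epsSBar (a g : A) : ε (a * epsSBar k A g) = ε (a * g) := by
  rw [epsSBar_eq_sm, const_mul_sm, map_sm, ← mul_one a, ← sm_counit_mul_mul, mul_one]
  exact sm_congr fun p q => by rw [mul_smul_comm, map_smul, smul_eq_mul, mul_comm]

end Basic

end WeakBialgebra

/-! ## Identities in weak Hopf algebras -/

namespace WeakHopfAlgebra

open Sweedler WeakBialgebra

section Antipode

variable {k : Type*} {H : Type*} [CommRing k] [Ring H] [Algebra k H] [Coalgebra k H]
  [WeakHopfAlgebra k H] {P : Type*} [AddCommGroup P] [Module k P]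

local notation "δ" => Coalgebra.comul (R := k)
local notation "ε" => Coalgebra.counit (R := k)
local notation "S" => antipode (k := k) (A := H)

@[fun_prop] theorem lin_antipode {U : Type*} [AddCommGroup U] [Module k U] {f : U → H}
    (hf : Lin k f) : Lin k fun x => S (f x) := (lin_coe _).comp hf

theorem mul'_map_eq_sm (f g : H →ₗ[k] H) (x : H) :
    (LinearMap.mul' k H ∘ₗ TensorProduct.map f g ∘ₗ Coalgebra.comul) x =
      sm (δ x) fun a b => f a * g b := by
  rw [LinearMap.comp_apply, LinearMap.comp_apply]
  conv_lhs => rw [← sm_tmul_eq (δ x)]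
  rw [map_sm, map_sm]
  rfl

theorem sm_antipode_mul (x : H) {F : H → P} (hF : Lin k F) :
    (sm (δ x) fun a b => F (S a * b)) = F (epsS k H x) := by
  rw [← antipode_conv_id, mul'_map_eq_sm, hF.map_sm]
  rfl

theorem sm_mul_antipode (x : H) {F : H → P} (hF : Lin k F) :
    (sm (δ x) fun a b => F (a * S b)) = F (epsT k H x) := by
  rw [← id_conv_antipode, mul'_map_eq_sm, hF.map_sm]
  rfl

theorem sm_antipode_mul_epsT (x : H) {F : H → P} (hF : Lin k F) :
    (sm (δ x) fun a b => F (S a * epsT k H b)) = F (S x) := by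
  conv_rhs => rw [← antipode_conv_id_conv_antipode, mul'_map_eq_sm, hF.map_sm, id_conv_antipode]

/-- By coassociativity, (S * id) * S = S * (id * S). -/
theorem sm_epsS_mul_antipode (x : H) {F : H → P} (hF : Lin k F) :
    (sm (δ x) fun a b => F (epsS k H a * S b)) = F (S x) := by
  rw [← sm_antipode_mul_epsT x hF]
  calc (sm (δ x) fun a b => F (epsS k H a * S b))
    _ = sm (δ x) fun a b => sm (δ a) fun c d => F (S c * d * S b) :=
        sm_congr fun a b =>
          (sm_antipode_mul a (F := fun y => F (y * S b)) (by fun_prop)).symm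
    _ = sm (δ x) fun a b => sm (δ b) fun c d => F (S a * c * S d) := by
        rw [sm_coassoc x (F := fun a c d => F (S a * c * S d))] <;> fun_prop
    _ = _ := by
        refine sm_congr fun a b => ?_
        rw [← sm_mul_antipode b (F := fun y => F (S a * y))] <;> try fun_prop
        simp only [mul_assoc]

/-- Compare S(y) = ε_s(y₍₁₎)S(y₍₂₎) with ε_t(y) = y₍₁₎S(y₍₂₎). Since Δ(y) = 1₍₁₎ ⊗ 1₍₂₎y, the first
leg is a source element, which ε_s fixes. -/
theorem _root_.WeakBialgebra.IsSource.antipode_eq {y : H} (hy : IsSource k y) :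
    S y = epsT k H y := by
  rw [← sm_epsS_mul_antipode y lin_id, ← sm_mul_antipode y lin_id, hy.sm, hy.sm] <;> try fun_prop
  exact sm_one_congr (by fun_prop) (by fun_prop) (by fun_prop) (by fun_prop)
    fun a b ha hb => by rw [ha.epsS_eq]

theorem _root_.WeakBialgebra.IsTarget.antipode_eq {z : H} (hz : IsTarget k z) :
    S z = epsS k H z := by
  rw [← sm_antipode_mul_epsT z lin_id, ← sm_antipode_mul z lin_id, hz.sm, hz.sm] <;> try fun_prop
  exact sm_one_congr (by fun_prop) (by fun_prop) (by fun_prop) (by fun_prop)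
    fun a b ha hb => by rw [hb.epsT_eq]

theorem isSource_one : IsSource k (1 : H) := by
  rw [← epsS_one (k := k)]; exact isSource_epsS _

variable (k H) in
theorem antipode_one : S 1 = 1 := by
  rw [isSource_one.antipode_eq, epsT_one]

/-- On the legs of Δ(1) the antipode is ε_t on the source side and ε_s on the target side. Expanding
both introduces two more copies of Δ(1); the weak counit axiom eliminates the original one. -/
theorem sm_antipode_one {F : H → H → P} (h₁ : ∀ b, Lin k fun a => F a b)
    (h₂ : ∀ a, Lin k fun b => F a b) :
    (sm (δ (1 : H)) fun a b => F (S b) (S a)) = sm (δ (1 : H)) F := by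
  calc (sm (δ (1 : H)) fun a b => F (S b) (S a))
    _ = sm (δ (1 : H)) fun a b => F (epsS k H b) (epsT k H a) :=
        sm_one_congr (by fun_prop) (by fun_prop) (by fun_prop) (by fun_prop)
          fun a b ha hb => by rw [ha.antipode_eq, hb.antipode_eq]
    _ = sm (δ (1 : H)) fun a b => sm (δ (1 : H)) fun p q => sm (δ (1 : H)) fun r s =>
          (ε (r * a) * ε (b * q)) • F p s := by
        refine sm_congr fun a b => ?_
        rw [epsS_eq_sm, (h₁ _).map_sm]
        refine sm_congr fun p q => ?_
        rw [epsT_eq_sm, (h₂ _).map_sm]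
        refine sm_congr fun r s => ?_
        rw [(h₁ _).smul, (h₂ _).smul, smul_smul, mul_comm]
    _ = sm (δ (1 : H)) fun p q => sm (δ (1 : H)) fun r s => ε (r * q) • F p s := by
        rw [sm_comm]
        refine sm_congr fun p q => ?_
        rw [sm_comm]
        refine sm_congr fun r s => ?_
        rw [← mul_one r, ← sm_counit_mul_mul r 1 q]
        simp only [mul_one]
        exact ((lin_smul_left (k := k) lin_id (F p s)).map_sm _ _).symm
    _ = sm (δ (1 : H)) fun p q => F p (epsT k H q) := by
        refine sm_congr fun p q => ?_
        rw [epsT_eq_sm, (h₂ _).map_sm]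
        exact sm_congr fun r s => by rw [(h₂ _).smul]
    _ = _ := (sm_one_right F h₁ h₂).symm

/-- Inside ε_t the factor y may be replaced by ε_t(y), and a target factor stays on the first leg of
the coproduct. -/
theorem epsT_mul (x y : H) : epsT k H (x * y) = sm (δ x) fun p q => p * epsT k H y * S q := by
  rw [← epsT_mul_epsT, ← sm_mul_antipode _ lin_id, (isTarget_epsT y).sm_mul] <;> fun_prop

theorem epsS_mul (x y : H) : epsS k H (x * y) = sm (δ y) fun p q => S p * epsS k H x * q := by
  rw [← epsS_epsS_mul, ← sm_antipode_mul _ lin_id, (isSource_epsS x).sm_mul'] <;> try fun_prop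
  simp only [mul_assoc]

/-- The chain is S(ab) = S(a₍₁₎b₍₁₎)ε_t(a₍₂₎b₍₂₎) = S(a₍₁₎b₍₁₎)a₍₂₎b₍₂₎S(b₍₃₎)S(a₍₃₎) =
ε_s(a₍₁₎b₍₁₎)S(b₍₂₎)S(a₍₂₎) = S(b₍₁₎)ε_s(a₍₁₎)ε_t(b₍₂₎)S(a₍₂₎). The two counital factors commute,
after which each half collapses. -/
theorem antipode_mul (a b : H) : S (a * b) = S b * S a := by
  calc S (a * b)
    _ = sm (δ a) fun p q => sm (δ b) fun r s => S (p * r) * epsT k H (q * s) := by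
        rw [← sm_antipode_mul_epsT (a * b) lin_id, sm_comul_mul] <;> fun_prop
    _ = sm (δ a) fun p q => sm (δ b) fun r s => sm (δ q) fun c d => sm (δ s) fun e f =>
          S (p * r) * (c * (e * S f) * S d) := by
        refine sm_congr fun p q => sm_congr fun r s => ?_
        rw [epsT_mul, const_mul_sm]
        refine sm_congr fun c d => ?_
        rw [sm_mul_antipode s (F := fun y => S (p * r) * (c * y * S d))]
        fun_prop
    _ = sm (δ a) fun p q => sm (δ q) fun c d => sm (δ b) fun r s => sm (δ s) fun e f =>
          S (p * r) * (c * (e * S f) * S d) := sm_congr fun p q => sm_comm _ _ _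
    _ = sm (δ a) fun p q => sm (δ p) fun c d => sm (δ b) fun r s => sm (δ r) fun e f =>
          S (c * e) * (d * (f * S s) * S q) := by
        rw [← sm_coassoc a (F := fun p c d => sm (δ b) fun r s => sm (δ s) fun e f =>
          S (p * r) * (c * (e * S f) * S d))] <;> try fun_prop
        refine sm_congr fun p q => sm_congr fun c d => ?_
        rw [← sm_coassoc b (F := fun r e f => S (c * r) * (d * (e * S f) * S q))] <;> fun_prop
    _ = sm (δ a) fun p q => sm (δ b) fun r s => epsS k H (p * r) * (S s * S q) := by
        refine sm_congr fun p q => ?_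
        rw [sm_comm]
        refine sm_congr fun r s => ?_
        rw [← sm_antipode_mul (p * r) (F := fun y => y * (S s * S q)), sm_comul_mul] <;>
          try fun_prop
        simp only [mul_assoc]
    _ = sm (δ a) fun p q => sm (δ b) fun r s => sm (δ s) fun e f =>
          S r * epsS k H p * (e * S f) * S q := by
        refine sm_congr fun p q => ?_
        rw [← sm_coassoc b (F := fun r e f => S r * epsS k H p * (e * S f) * S q)] <;>
          try fun_prop
        refine sm_congr fun r s => ?_
        rw [epsS_mul, sm_mul_const]
        simp only [mul_assoc]
    _ = sm (δ a) fun p q => sm (δ b) fun r s => (S r * epsT k H s) * (epsS k H p * S q) := by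
        refine sm_congr fun p q => sm_congr fun r s => ?_
        rw [sm_mul_antipode s (F := fun y => S r * epsS k H p * y * S q), mul_assoc (S r),
          ← (isTarget_epsT s).commute (isSource_epsS p)] <;> try fun_prop
        simp only [mul_assoc]
    _ = S b * S a := by
        simp_rw [← sm_mul_const, ← const_mul_sm]
        rw [sm_antipode_mul_epsT b lin_id, sm_epsS_mul_antipode a lin_id]

theorem counit_epsS (x : H) : ε (epsS k H x) = ε x := by
  have := counit_epsS_mul (k := k) x 1
  rwa [mul_one, mul_one] at this

theorem counit_epsT (x : H) : ε (epsT k H x) = ε x := by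
  have := counit_mul_epsT (k := k) 1 x
  rwa [one_mul, one_mul] at this

/-- Under ε the factor ε_t(x₍₂₎) in S(x) = S(x₍₁₎)ε_t(x₍₂₎) may be replaced by x₍₂₎, which leaves
ε(ε_s(x)). -/
theorem counit_antipode (x : H) : ε (S x) = ε x := by
  rw [← sm_antipode_mul_epsT x (F := fun y => ε y) (by fun_prop)]
  simp only [counit_mul_epsT]
  rw [sm_antipode_mul x (F := fun y => ε y) (by fun_prop), counit_epsS]

/-- Start from Δ(S(x)) = Δ(S(x₍₁₎))Δ(ε_t(x₍₂₎)) and expand Δ(ε_t(q)) as q₍₁₎S(q₍₄₎) ⊗ q₍₂₎S(q₍₃₎).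
The factors Δ(S(x₍₁₎))Δ(x₍₂₎) merge to Δ(ε_s(x₍₁₎)), which leaves Δ(1)(S(x₍₂₎) ⊗ S(x₍₁₎)). The
remaining Δ(1) is absorbed because S flips it. -/
theorem sm_comul_antipode (x : H) {F : H → H → P} (h₁ : ∀ b, Lin k fun a => F a b)
    (h₂ : ∀ a, Lin k fun b => F a b) :
    sm (δ (S x)) F = sm (δ x) fun a b => F (S b) (S a) := by
  calc sm (δ (S x)) F
    _ = sm (δ x) fun p q => sm (δ (S p)) fun a b => sm (δ (epsT k H q)) fun c d =>
          F (a * c) (b * d) := by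
        rw [← sm_antipode_mul_epsT x (F := fun y => sm (δ y) F) (by fun_prop)]
        exact sm_congr fun p q => sm_comul_mul _ _ h₁ h₂
    _ = sm (δ x) fun p q => sm (δ (S p)) fun a b => sm (δ q) fun c d => sm (δ d) fun e f =>
          sm (δ e) fun g h => F (a * (c * S f)) (b * (g * S h)) := by
        refine sm_congr fun p q => sm_congr fun a b => ?_
        rw [(isTarget_epsT q).sm] <;> try fun_prop
        calc (sm (δ (1 : H)) fun r s => F (a * (r * epsT k H q)) (b * s))
          _ = sm (δ q) fun c f => sm (δ (1 : H)) fun r s => F (a * (r * c * S f)) (b * s) := by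
            rw [sm_comm]
            refine sm_congr fun r s => ?_
            rw [← sm_mul_antipode q (F := fun y => F (a * (r * y)) (b * s))] <;> try fun_prop
            simp only [mul_assoc]
          _ = sm (δ q) fun c f => sm (δ c) fun d e => F (a * (d * S f)) (b * epsT k H e) := by
            refine sm_congr fun c f => ?_
            rw [sm_epsT_right c (F := fun d e => F (a * (d * S f)) (b * e))] <;> fun_prop
          _ = sm (δ q) fun c d => sm (δ d) fun e f => F (a * (c * S f)) (b * epsT k H e) := by
            rw [sm_coassoc q (F := fun c e f => F (a * (c * S f)) (b * epsT k H e))] <;> fun_prop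
          _ = _ := by
            refine sm_congr fun c d => sm_congr fun e f => ?_
            rw [sm_mul_antipode e (F := fun y => F (a * (c * S f)) (b * y))]
            fun_prop
    _ = sm (δ x) fun p q => sm (δ q) fun c d => sm (δ d) fun e f => sm (δ e) fun g h =>
          sm (δ (S p)) fun a b => F (a * (c * S f)) (b * (g * S h)) := by
        refine sm_congr fun p q => ?_
        rw [sm_comm]
        refine sm_congr fun c d => ?_
        rw [sm_comm]
        exact sm_congr fun e f => sm_comm _ _ _
    _ = sm (δ x) fun p q => sm (δ q) fun c d => sm (δ d) fun g v => sm (δ v) fun h f =>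
          sm (δ (S p)) fun a b => F (a * (c * S f)) (b * (g * S h)) := by
        refine sm_congr fun p q => sm_congr fun c d => ?_
        rw [sm_coassoc d (F := fun g h f => sm (δ (S p)) fun a b =>
          F (a * (c * S f)) (b * (g * S h)))] <;> fun_prop
    _ = sm (δ x) fun p q => sm (δ q) fun w v => sm (δ w) fun c g => sm (δ v) fun h f =>
          sm (δ (S p)) fun a b => F (a * (c * S f)) (b * (g * S h)) := by
        refine sm_congr fun p q => ?_
        rw [sm_coassoc q (F := fun c g v => sm (δ v) fun h f => sm (δ (S p)) fun a b =>
          F (a * (c * S f)) (b * (g * S h)))] <;> fun_prop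
    _ = sm (δ x) fun u v => sm (δ u) fun p w => sm (δ w) fun c g => sm (δ v) fun h f =>
          sm (δ (S p)) fun a b => F (a * (c * S f)) (b * (g * S h)) := by
        rw [sm_coassoc x (F := fun p w v => sm (δ w) fun c g => sm (δ v) fun h f =>
          sm (δ (S p)) fun a b => F (a * (c * S f)) (b * (g * S h)))] <;> fun_prop
    _ = sm (δ x) fun u v => sm (δ v) fun h f => sm (δ (epsS k H u)) fun a b =>
          F (a * S f) (b * S h) := by
        refine sm_congr fun u v => ?_
        rw [← sm_antipode_mul u (F := fun y => sm (δ v) fun h f => sm (δ y) fun a b =>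
          F (a * S f) (b * S h)) (by fun_prop)]
        refine sm_congr fun p w => ?_
        rw [sm_comm]
        refine sm_congr fun h f => ?_
        rw [sm_comul_mul, sm_comm] <;> try fun_prop
        simp only [mul_assoc]
    _ = sm (δ x) fun u f => sm (δ u) fun u h => sm (δ (1 : H)) fun a b =>
          F (a * S f) (b * (epsS k H u * S h)) := by
        rw [sm_coassoc x (F := fun u h f => sm (δ (1 : H)) fun a b =>
          F (a * S f) (b * (epsS k H u * S h)))] <;> try fun_prop
        refine sm_congr fun u v => sm_congr fun h f => ?_
        rw [(isSource_epsS u).sm] <;> try fun_prop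
        simp only [mul_assoc]
    _ = sm (δ x) fun p q => sm (δ (1 : H)) fun a b => F (a * S q) (b * S p) := by
        refine sm_congr fun p q => ?_
        rw [sm_comm]
        refine sm_congr fun a b => ?_
        rw [sm_epsS_mul_antipode p (F := fun y => F (a * S q) (b * y))]
        fun_prop
    _ = sm (δ x) fun p q => sm (δ (1 : H)) fun a b => F (S (q * b)) (S (p * a)) := by
        refine sm_congr fun p q => ?_
        rw [← sm_antipode_one (F := fun a b => F (a * S q) (b * S p))] <;> try fun_prop
        simp only [antipode_mul]
    _ = _ := sm_mul_one x (F := fun p q => F (S q) (S p)) (by fun_prop) (by fun_prop)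

/-- The antipode is ε_t on the source element ε̄_s(z); the middle copy of Δ(1) then disappears by
the weak counit axiom. Hence ε̄_s inverts S on the target space, where it agrees with `antipodeInv`.
-/
theorem antipode_epsSBar {z : H} (hz : IsTarget k z) : S (epsSBar k H z) = z := by
  rw [(isSource_epsSBar z).antipode_eq, epsSBar_eq_sm, map_sm]
  calc (sm (δ (1 : H)) fun a b => epsT k H (ε (b * z) • a))
    _ = sm (δ (1 : H)) fun a b => sm (δ (1 : H)) fun c d => (ε (c * a) * ε (b * z)) • d := by
        refine sm_congr fun a b => ?_
        rw [map_smul, epsT_eq_sm, smul_sm]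
        exact sm_congr fun c d => by rw [smul_smul, mul_comm]
    _ = sm (δ (1 : H)) fun c d => ε (c * z) • d := by
        rw [sm_comm]
        refine sm_congr fun c d => ?_
        rw [← mul_one c, ← sm_counit_mul_mul c 1 z]
        simp only [mul_one]
        exact ((lin_smul_left (k := k) lin_id d).map_sm _ _).symm
    _ = z := by rw [← epsT_eq_sm, hz.epsT_eq]

theorem antipode_epsTBar {y : H} (hy : IsSource k y) : S (epsTBar k H y) = y := by
  rw [(isTarget_epsTBar y).antipode_eq, epsTBar_eq_sm, map_sm]
  calc (sm (δ (1 : H)) fun a b => epsS k H (ε (y * a) • b))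
    _ = sm (δ (1 : H)) fun a b => sm (δ (1 : H)) fun c d => (ε (y * a) * ε (b * d)) • c := by
        refine sm_congr fun a b => ?_
        rw [map_smul, epsS_eq_sm, smul_sm]
        exact sm_congr fun c d => by rw [smul_smul]
    _ = sm (δ (1 : H)) fun c d => ε (y * d) • c := by
        rw [sm_comm]
        refine sm_congr fun c d => ?_
        rw [← mul_one y, ← sm_counit_mul_mul y 1 d]
        simp only [mul_one]
        exact ((lin_smul_left (k := k) lin_id c).map_sm _ _).symm
    _ = y := by rw [← epsS_eq_sm, hy.epsS_eq]

end Antipode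

/-! ### The inverse of the antipode -/

section AntipodeInv

variable {k : Type u} {H : Type v} [CommRing k] [Ring H] [Algebra k H] [Coalgebra k H]
  [WeakHopfAlgebra k H] [BijectiveAntipode k H] {P : Type*} [AddCommGroup P] [Module k P]

local notation "δ" => Coalgebra.comul (R := k)
local notation "ε" => Coalgebra.counit (R := k)
local notation "S" => antipode (k := k) (A := H)
local notation "T" => antipodeInv k H

@[fun_prop] theorem lin_antipodeInv {U : Type*} [AddCommGroup U] [Module k U] {f : U → H}
    (hf : Lin k f) : Lin k fun x => T (f x) := (lin_coe _).comp hf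

@[simp] theorem antipode_antipodeInv (x : H) : S (T x) = x :=
  LinearEquiv.apply_symm_apply (LinearEquiv.ofBijective S BijectiveAntipode.bijective) x

@[simp] theorem antipodeInv_antipode (x : H) : T (S x) = x :=
  LinearEquiv.symm_apply_apply (LinearEquiv.ofBijective S BijectiveAntipode.bijective) x

theorem antipode_injective : Function.Injective S := BijectiveAntipode.bijective.1

theorem antipodeInv_mul (a b : H) : T (a * b) = T b * T a :=
  antipode_injective (k := k) (by simp [antipode_mul])

variable (k H) in
theorem antipodeInv_one : T 1 = 1 := antipode_injective (k := k) (by simp [antipode_one])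

theorem counit_antipodeInv (x : H) : ε (T x) = ε x := by
  rw [← counit_antipode, antipode_antipodeInv]

theorem sm_comul_antipodeInv (x : H) {F : H → H → P} (h₁ : ∀ b, Lin k fun a => F a b)
    (h₂ : ∀ a, Lin k fun b => F a b) :
    sm (δ (T x)) F = sm (δ x) fun a b => F (T b) (T a) := by
  conv_rhs => rw [← antipode_antipodeInv (k := k) x, sm_comul_antipode _ (by fun_prop) (by fun_prop)]
  simp only [antipodeInv_antipode]

theorem sm_antipodeInv_one {F : H → H → P} (h₁ : ∀ b, Lin k fun a => F a b)
    (h₂ : ∀ a, Lin k fun b => F a b) :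
    (sm (δ (1 : H)) fun a b => F (T b) (T a)) = sm (δ (1 : H)) F := by
  rw [← sm_comul_antipodeInv _ h₁ h₂, antipodeInv_one]

/-- Apply T to S(x₍₁₎)x₍₂₎ = ε_s(x); T reverses the product, so the legs appear in the opposite
order. -/
theorem sm_antipodeInv_mul (x : H) {F : H → P} (hF : Lin k F) :
    (sm (δ x) fun a b => F (T b * a)) = F (T (epsS k H x)) := by
  rw [← sm_antipode_mul x (F := fun y => F (T y)) (by fun_prop)]
  simp only [antipodeInv_mul, antipodeInv_antipode]

theorem sm_mul_antipodeInv (x : H) {F : H → P} (hF : Lin k F) :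
    (sm (δ x) fun a b => F (b * T a)) = F (T (epsT k H x)) := by
  rw [← sm_mul_antipode x (F := fun y => F (T y)) (by fun_prop)]
  simp only [antipodeInv_mul, antipodeInv_antipode]

theorem _root_.WeakBialgebra.IsTarget.epsSBar_eq {z : H} (hz : IsTarget k z) :
    epsSBar k H z = T z :=
  antipode_injective (k := k) (by rw [antipode_epsSBar hz, antipode_antipodeInv])

theorem _root_.WeakBialgebra.IsSource.epsTBar_eq {y : H} (hy : IsSource k y) :
    epsTBar k H y = T y :=
  antipode_injective (k := k) (by rw [antipode_epsTBar hy, antipode_antipodeInv])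

theorem _root_.WeakBialgebra.IsTarget.antipodeInv {z : H} (hz : IsTarget k z) :
    IsSource k (T z) := by
  rw [← hz.epsSBar_eq]; exact isSource_epsSBar _

/-- Put Δ(1) = T(1₍₂₎) ⊗ T(1₍₁₎) and cancel S against T in the first leg. -/
theorem sm_antipode_one_left {F : H → H → P} (h₁ : ∀ b, Lin k fun a => F a b)
    (h₂ : ∀ a, Lin k fun b => F a b) :
    (sm (δ (1 : H)) fun a b => F (S a) b) = sm (δ (1 : H)) fun a b => F b (T a) := by
  rw [← sm_antipodeInv_one (F := fun a b => F (S a) b)] <;> try fun_prop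
  simp only [antipode_antipodeInv]

end AntipodeInv

end WeakHopfAlgebra

/-! ## The algebra `H ⋈ H*` -/

namespace Drinfeld

open Sweedler WeakBialgebra WeakHopfAlgebra

section Smash

variable {k : Type u} {H : Type v} [CommRing k] [Ring H] [Algebra k H] [Coalgebra k H]

local notation "δ" => Coalgebra.comul (R := k)
local notation "ε" => Coalgebra.counit (R := k)

section Lin

variable {U : Type*} [AddCommGroup U] [Module k U]

@[fun_prop] theorem lin_dualMul {f : U → Module.Dual k H ⊗[k] Module.Dual k H} (hf : Lin k f) :
    Lin k fun x => dualMul k H (f x) := (lin_coe _).comp hf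

@[fun_prop] theorem lin_hit_left (f : Module.Dual k H) {g : U → H} (hg : Lin k g) (c : H) :
    Lin k fun x => hit f (g x) c := (lin_eval (lin_coe (hit f)) c).comp hg

@[fun_prop] theorem lin_hit_right (f : Module.Dual k H) (a : H) {g : U → H} (hg : Lin k g) :
    Lin k fun x => hit f a (g x) := (lin_coe (hit f a)).comp hg

end Lin

theorem dualMul_apply (f g : Module.Dual k H) (x : H) :
    dualMul k H (f ⊗ₜ g) x = sm (δ x) fun a b => f a * g b := by
  change TensorProduct.dualDistrib k H H (f ⊗ₜ g) (δ x) = _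
  conv_lhs => rw [← sm_tmul_eq (δ x), map_sm]
  rfl

theorem dualMul_assoc (f g h : Module.Dual k H) :
    dualMul k H (dualMul k H (f ⊗ₜ g) ⊗ₜ h) = dualMul k H (f ⊗ₜ dualMul k H (g ⊗ₜ h)) := by
  ext x
  simp only [dualMul_apply, sm_mul_const, const_mul_sm]
  rw [sm_coassoc x (F := fun a b c => f a * g b * h c)] <;> try fun_prop
  simp only [mul_assoc]

theorem dualMul_counit (f : Module.Dual k H) :
    dualMul k H (f ⊗ₜ Coalgebra.counit) = f := by
  ext x
  rw [dualMul_apply]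
  simp_rw [mul_comm (f _)]
  exact sm_counit_right x (F := fun a => f a) (by fun_prop)

theorem counit_dualMul (f : Module.Dual k H) :
    dualMul k H (Coalgebra.counit ⊗ₜ f) = f := by
  ext x
  rw [dualMul_apply]
  exact sm_counit_left x (F := fun a => f a) (by fun_prop)

variable [WeakHopfAlgebra k H] [BijectiveAntipode k H]

local notation "S" => antipode (k := k) (A := H)
local notation "T" => antipodeInv k H

@[fun_prop] theorem lin_smashMul {U : Type*} [AddCommGroup U] [Module k U]
    {f : U → Smash k H ⊗[k] Smash k H} (hf : Lin k f) :
    Lin k fun x => smashMul k H (f x) := (lin_coe _).comp hf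

/-- Convolution is dual to Δ, and Δ is multiplicative on d·x·T(a). The legs of a come out reversed
because T reverses the coproduct. -/
theorem hit_dualMul (f g : Module.Dual k H) (a d : H) :
    hit (dualMul k H (f ⊗ₜ g)) (T a) d =
      sm (δ a) fun a₁ a₂ => sm (δ d) fun d₁ d₂ =>
        dualMul k H (hit f (T a₂) d₁ ⊗ₜ hit g (T a₁) d₂) := by
  ext x
  rw [hit_apply, dualMul_apply]
  simp (disch := fun_prop) only [sm_comul_mul, sm_comul_antipodeInv]
  rw [(by fun_prop : Lin k fun φ : Module.Dual k H => φ x).map_sm, sm_comm]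
  conv_lhs => enter [2, a, b]; rw [sm_comm]
  rw [sm_comm]
  conv_lhs => enter [2, a, b]; rw [sm_comm]
  refine sm_congr fun a₁ a₂ => ?_
  rw [(by fun_prop : Lin k fun φ : Module.Dual k H => φ x).map_sm]
  refine sm_congr fun d₁ d₂ => ?_
  rw [dualMul_apply]
  rfl

theorem smashTwist_tmul (f : Module.Dual k H) (h : H) :
    smashTwist k H (f ⊗ₜ h) = sm (δ h) fun a b => sm (δ b) fun c d => c ⊗ₜ hit f (T a) d := by
  change smashAux f ((Coalgebra.comul (R := k) (A := H)).lTensor H (δ h)) = _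
  conv_lhs => rw [← sm_tmul_eq (δ h)]
  rw [map_sm, map_sm]
  refine sm_congr fun a b => ?_
  rw [LinearMap.lTensor_tmul]
  conv_lhs => rw [← sm_tmul_eq (δ b)]
  rw [(by fun_prop : Lin k fun s : H ⊗[k] H => smashAux f (a ⊗ₜ s)).map_sm]
  rfl

theorem smashMul_tmul (h l : H) (f g : Module.Dual k H) :
    smashMul k H ((h ⊗ₜ f) ⊗ₜ (l ⊗ₜ g)) =
      sm (δ l) fun a b => sm (δ b) fun c d => (h * c) ⊗ₜ dualMul k H (hit f (T a) d ⊗ₜ g) := by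
  change TensorProduct.map (LinearMap.mul' k H) (dualMul k H)
    ((TensorProduct.tensorTensorTensorAssoc k H H (Module.Dual k H)
      (Module.Dual k H)).symm ((h ⊗ₜ smashTwist k H (f ⊗ₜ l)) ⊗ₜ g)) = _
  rw [smashTwist_tmul]
  have e : Lin k fun s : Smash k H => TensorProduct.map (LinearMap.mul' k H) (dualMul k H)
    ((TensorProduct.tensorTensorTensorAssoc k H H (Module.Dual k H)
      (Module.Dual k H)).symm ((h ⊗ₜ s) ⊗ₜ g)) := by fun_prop
  rw [e.map_sm]
  refine sm_congr fun a b => ?_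
  rw [e.map_sm]
  rfl

theorem hit_hit (f : Module.Dual k H) (a c a' c' : H) :
    hit (hit f a c) a' c' = hit f (a' * a) (c * c') := by
  ext x
  simp only [hit_apply, mul_assoc]

/-- Two bracketings of the fivefold coproduct, (2,1,2) and (1,3,1). These are the shapes in which
the last factor is comultiplied in the two sides of associativity. -/
theorem sm_coassoc₅ {P : Type*} [AddCommGroup P] [Module k P] (x : H) {F : H → H → H → H → H → P}
    (h₁ : ∀ b c d e, Lin k fun a => F a b c d e) (h₂ : ∀ a c d e, Lin k fun b => F a b c d e)
    (h₃ : ∀ a b d e, Lin k fun c => F a b c d e) (h₄ : ∀ a b c e, Lin k fun d => F a b c d e)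
    (h₅ : ∀ a b c d, Lin k fun e => F a b c d e) :
    (sm (δ x) fun p q => sm (δ q) fun c r => sm (δ p) fun a b => sm (δ r) fun d e => F a b c d e) =
      sm (δ x) fun a q => sm (δ q) fun r e => sm (δ r) fun b s => sm (δ s) fun c d =>
        F a b c d e := by
  calc _ = sm (δ x) fun p q => sm (δ p) fun a b => sm (δ q) fun c r => sm (δ r) fun d e =>
          F a b c d e := sm_congr fun p q => sm_comm _ _ _
    _ = sm (δ x) fun a q => sm (δ q) fun b s => sm (δ s) fun c r => sm (δ r) fun d e =>
          F a b c d e := by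
        rw [sm_coassoc x (F := fun a b q => sm (δ q) fun c r => sm (δ r) fun d e =>
          F a b c d e)] <;> fun_prop
    _ = _ := by
        refine sm_congr fun a q => ?_
        rw [sm_coassoc q (F := fun b s e => sm (δ s) fun c d => F a b c d e)] <;> try fun_prop
        refine sm_congr fun b s => ?_
        rw [sm_coassoc s (F := fun c d e => F a b c d e)] <;> fun_prop

/-- Both sides equal h l₍₂₎p₍₃₎ ⋈ (T(l₍₁₎p₍₂₎) ⇀ f ↼ l₍₃₎p₍₄₎) * (T(p₍₁₎) ⇀ g ↼ p₍₅₎) * q. This uses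
that Δ is multiplicative, that T reverses products and coproducts, and coassociativity. -/
theorem smashMul_assoc_tmul (h l p : H) (f g q : Module.Dual k H) :
    smashMul k H (smashMul k H ((h ⊗ₜ f) ⊗ₜ (l ⊗ₜ g)) ⊗ₜ (p ⊗ₜ q)) =
      smashMul k H ((h ⊗ₜ f) ⊗ₜ smashMul k H ((l ⊗ₜ g) ⊗ₜ (p ⊗ₜ q))) := by
  have eL : Lin k fun s : Smash k H => smashMul k H (s ⊗ₜ (p ⊗ₜ q)) := by fun_prop
  have eR : Lin k fun s : Smash k H => smashMul k H ((h ⊗ₜ f) ⊗ₜ s) := by fun_prop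
  -- The common normal form, as a function of the three legs of l and the five legs of p.
  let G : H → H → H → H → H → H → H → H → Smash k H := fun l₁ l₂ l₃ p₁ p₂ p₃ p₄ p₅ =>
    (h * (l₂ * p₃)) ⊗ₜ dualMul k H (hit f (T (l₁ * p₂)) (l₃ * p₄) ⊗ₜ
      dualMul k H (hit g (T p₁) p₅ ⊗ₜ q))
  calc _ = sm (δ l) fun l₁ l' => sm (δ l') fun l₂ l₃ => sm (δ p) fun a b => sm (δ b) fun c d =>
          sm (δ a) fun a₁ a₂ => sm (δ d) fun d₁ d₂ => G l₁ l₂ l₃ a₁ a₂ c d₁ d₂ := by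
        rw [smashMul_tmul, eL.map_sm]
        refine sm_congr fun l₁ l' => ?_
        rw [eL.map_sm]
        refine sm_congr fun l₂ l₃ => ?_
        rw [smashMul_tmul]
        refine sm_congr fun a b => sm_congr fun c d => ?_
        have e : Lin k fun φ => (h * l₂ * c) ⊗ₜ[k] dualMul k H (φ ⊗ₜ q) := by fun_prop
        rw [hit_dualMul, e.map_sm]
        refine sm_congr fun a₁ a₂ => ?_
        rw [e.map_sm]
        refine sm_congr fun d₁ d₂ => ?_
        simp only [G, mul_assoc, hit_hit, dualMul_assoc, antipodeInv_mul]
    _ = sm (δ l) fun l₁ l' => sm (δ l') fun l₂ l₃ => sm (δ p) fun a b => sm (δ b) fun c d =>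
          sm (δ c) fun c₁ c' => sm (δ c') fun c₂ c₃ => G l₁ l₂ l₃ a c₁ c₂ c₃ d := by
        refine sm_congr fun l₁ l' => sm_congr fun l₂ l₃ => ?_
        exact sm_coassoc₅ p (by fun_prop) (by fun_prop) (by fun_prop) (by fun_prop) (by fun_prop)
    _ = sm (δ p) fun a b => sm (δ b) fun c d => sm (δ l) fun l₁ l' => sm (δ c) fun c₁ c' =>
          sm (δ l') fun l₂ l₃ => sm (δ c') fun c₂ c₃ => G l₁ l₂ l₃ a c₁ c₂ c₃ d := by
        conv_lhs => enter [2, l₁, l']; rw [sm_comm]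
        rw [sm_comm]
        refine sm_congr fun a b => ?_
        conv_lhs => enter [2, l₁, l']; rw [sm_comm]
        rw [sm_comm]
        exact sm_congr fun c d => sm_congr fun l₁ l' => sm_comm _ _ _
    _ = _ := by
        rw [smashMul_tmul, eR.map_sm]
        refine sm_congr fun a b => ?_
        rw [eR.map_sm]
        refine sm_congr fun c d => ?_
        rw [smashMul_tmul]
        simp (disch := fun_prop) only [sm_comul_mul, G]

theorem smashMul_assoc (x y z : Smash k H) :
    smashMul k H (smashMul k H (x ⊗ₜ y) ⊗ₜ z) = smashMul k H (x ⊗ₜ smashMul k H (y ⊗ₜ z)) := by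
  refine lin_ext (k := k) (f := fun x => smashMul k H (smashMul k H (x ⊗ₜ y) ⊗ₜ z))
    (g := fun x => smashMul k H (x ⊗ₜ smashMul k H (y ⊗ₜ z))) (by fun_prop) (by fun_prop)
    (fun h f => ?_) x
  refine lin_ext (k := k) (f := fun y => smashMul k H (smashMul k H ((h ⊗ₜ f) ⊗ₜ y) ⊗ₜ z))
    (g := fun y => smashMul k H ((h ⊗ₜ f) ⊗ₜ smashMul k H (y ⊗ₜ z))) (by fun_prop) (by fun_prop)
    (fun l g => ?_) y
  exact lin_ext (k := k)
    (f := fun z => smashMul k H (smashMul k H ((h ⊗ₜ f) ⊗ₜ (l ⊗ₜ g)) ⊗ₜ z))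
    (g := fun z => smashMul k H ((h ⊗ₜ f) ⊗ₜ smashMul k H ((l ⊗ₜ g) ⊗ₜ z)))
    (by fun_prop) (by fun_prop) (fun p q => smashMul_assoc_tmul h l p f g q) z

theorem smashMul_preunit (h : H) (f : Module.Dual k H) :
    smashMul k H ((h ⊗ₜ f) ⊗ₜ preunit k H) =
      sm (δ (1 : H)) fun a b => sm (δ b) fun c d => (h * c) ⊗ₜ hit f (T a) d := by
  rw [preunit, smashMul_tmul]
  simp only [dualMul_counit]

theorem epsSBar_antipodeInv (x : H) : epsSBar k H (T x) = T (epsTBar k H x) := by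
  rw [epsSBar_eq_sm, epsTBar_eq_sm, map_sm, ← sm_antipodeInv_one] <;> try fun_prop
  refine sm_congr fun a b => ?_
  rw [map_smul, ← antipodeInv_mul, counit_antipodeInv]

/-- In ε(d x T(a)) only the source part of d and the ε̄_s-part of T(a) matter. -/
theorem hit_counit (a d : H) :
    hit Coalgebra.counit (T a) d =
      hit (Coalgebra.counit (R := k)) (T (epsTBar k H a)) (epsS k H d) := by
  ext x
  rw [hit_apply, hit_apply, ← counit_epsS_mul, ← mul_assoc, ← counit_mul_epsSBar,
    epsSBar_antipodeInv, mul_assoc]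

/-- Contraction turns the first leg c of Δ(1) into ε_t(c), which is S(c) because c is a source
element. -/
theorem sm_epsTBar_left {P : Type*} [AddCommGroup P] [Module k P] (x : H) {F : H → H → P}
    (h₁ : ∀ b, Lin k fun a => F a b) (h₂ : ∀ a, Lin k fun b => F a b) :
    (sm (δ x) fun a b => F (epsTBar k H a) b) = sm (δ (1 : H)) fun c d => F d (x * S c) := by
  simp_rw [epsTBar_eq_sm, (h₁ _).map_sm, (h₁ _).smul]
  rw [sm_comm]
  simp_rw [sm_contract₁ x _ (h₂ _)]
  exact sm_one_congr (by fun_prop) (by fun_prop) (by fun_prop) (by fun_prop)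
    fun a b ha hb => by rw [ha.antipode_eq]

/-- A source factor on the right crosses from the first leg to the second at the price of S. For x =
1 this is `comul_one_epsSBar`; multiply by Δ(x). -/
theorem _root_.WeakBialgebra.IsSource.sm_mul_left {P : Type*} [AddCommGroup P] [Module k P] {y : H}
    (hy : IsSource k y) (x : H) {F : H → H → P} (h₁ : ∀ b, Lin k fun a => F a b)
    (h₂ : ∀ a, Lin k fun b => F a b) :
    (sm (δ x) fun a b => F (a * y) b) = sm (δ x) fun a b => F a (b * S y) := by
  have h := (comul_one_epsSBar (k := k) y).2
  rw [hy.epsSBar_eq, ← hy.antipode_eq] at h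
  have h' := congrArg (fun t => sm (δ x * t) F) h
  simp only [← mul_assoc, comul_mul_one] at h'
  simpa (disch := fun_prop) only [sm_mul, sm_tmul, mul_one] using h'

/-- In ε(y x₍₁₎T(z))g(x₍₂₎) the source element T(z) crosses to the other leg as z, and ε(y·)
contracts to left multiplication by ε̄_t(y) = T(y). -/
theorem dualMul_hit_counit {y z : H} (hy : IsSource k y) (hz : IsTarget k z)
    (g : Module.Dual k H) :
    dualMul k H (hit Coalgebra.counit (T z) y ⊗ₜ g) = hit g z (T y) := by
  ext x
  rw [dualMul_apply, hit_apply]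
  simp only [hit_apply]
  rw [hz.antipodeInv.sm_mul_left x (F := fun a b => ε (y * a) * g b), antipode_antipodeInv]
    <;> try fun_prop
  refine (sm_contract₃ x y (F := fun b => g (b * z)) (by fun_prop)).trans ?_
  rw [hy.epsTBar_eq, mul_assoc]

/-- By `hit_counit` the outer legs of l enter only through counital maps, so they can be traded for
two copies of Δ(1). The functional ε then becomes a hit on g, and the antipodes are moved between
the legs of Δ(1). The resulting double sum is a factorization of Δ²(1), as it occurs in
`smashMul_preunit`. -/
theorem preunit_smashMul (l : H) (g : Module.Dual k H) :
    smashMul k H (preunit k H ⊗ₜ (l ⊗ₜ g)) =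
      smashMul k H ((l ⊗ₜ g) ⊗ₜ preunit k H) := by
  calc smashMul k H (preunit k H ⊗ₜ (l ⊗ₜ g))
    _ = sm (δ l) fun a b => sm (δ b) fun c d => c ⊗ₜ dualMul k H
          (hit (Coalgebra.counit (R := k)) (T (epsTBar k H a)) (epsS k H d) ⊗ₜ g) := by
        rw [preunit, smashMul_tmul]
        refine sm_congr fun a b => sm_congr fun c d => ?_
        rw [one_mul, hit_counit]
    _ = sm (δ (1 : H)) fun p' q' => sm (δ (1 : H)) fun p q => (l * S p' * epsSBar k H q) ⊗ₜ
          dualMul k H (hit (Coalgebra.counit (R := k)) (T q') p ⊗ₜ g) := by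
        refine (sm_congr fun a b => sm_epsS_right b (F := fun c d => c ⊗ₜ[k] dualMul k H
          (hit (Coalgebra.counit (R := k)) (T (epsTBar k H a)) d ⊗ₜ g)) (by fun_prop)
          (by fun_prop)).trans ?_
        rw [sm_epsTBar_left l (F := fun a b => sm (δ (1 : H)) fun p q => (b * epsSBar k H q) ⊗ₜ
          dualMul k H (hit (Coalgebra.counit (R := k)) (T a) p ⊗ₜ g))] <;> fun_prop
    _ = sm (δ (1 : H)) fun p' q' => sm (δ (1 : H)) fun p q =>
          (l * S p' * T q) ⊗ₜ hit g q' (T p) := by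
        refine sm_one_congr (by fun_prop) (by fun_prop) (by fun_prop) (by fun_prop)
          fun p' q' hp' hq' => sm_one_congr (by fun_prop) (by fun_prop) (by fun_prop) (by fun_prop)
          fun p q hp hq => ?_
        rw [dualMul_hit_counit hp hq', IsTarget.epsSBar_eq hq]
    _ = sm (δ (1 : H)) fun p q => sm (δ (1 : H)) fun c d => (l * (q * c)) ⊗ₜ hit g (T p) d := by
        rw [sm_antipode_one_left (F := fun a q' => sm (δ (1 : H)) fun p q =>
          (l * a * T q) ⊗ₜ[k] hit g q' (T p)) (by fun_prop) (by fun_prop)]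
        refine sm_congr fun p' q' => ?_
        rw [sm_antipodeInv_one (F := fun a b => (l * q' * a) ⊗ₜ[k] hit g (T p') b)
          (by fun_prop) (by fun_prop)]
        simp only [mul_assoc]
    _ = _ := by
        rw [smashMul_preunit, sm_comul_one (fun a c d => (l * c) ⊗ₜ hit g (T a) d)] <;> fun_prop

theorem preunit_comm (x : Smash k H) :
    smashMul k H (preunit k H ⊗ₜ x) = smashMul k H (x ⊗ₜ preunit k H) :=
  lin_ext (k := k) (f := fun x => smashMul k H (preunit k H ⊗ₜ x))
    (g := fun x => smashMul k H (x ⊗ₜ preunit k H)) (by fun_prop) (by fun_prop)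
    preunit_smashMul x

/-- Two multiplications by e hit with Δ²(1) twice. As hits compose and T reverses products, this is
one hit with Δ²(1·1). -/
theorem smashMul_preunit_preunit (x : Smash k H) :
    smashMul k H (smashMul k H (x ⊗ₜ preunit k H) ⊗ₜ preunit k H) =
      smashMul k H (x ⊗ₜ preunit k H) := by
  refine lin_ext (k := k)
    (f := fun x => smashMul k H (smashMul k H (x ⊗ₜ preunit k H) ⊗ₜ preunit k H))
    (g := fun x => smashMul k H (x ⊗ₜ preunit k H)) (by fun_prop) (by fun_prop) (fun h f => ?_) x
  have e : Lin k fun s : Smash k H => smashMul k H (s ⊗ₜ preunit k H) := by fun_prop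
  rw [smashMul_preunit, e.map_sm]
  simp_rw [e.map_sm, smashMul_preunit]
  calc _ = sm (δ ((1 : H) * 1)) fun a b => sm (δ b) fun c d => (h * c) ⊗ₜ hit f (T a) d := by
        rw [sm_comul_mul _ _ (by fun_prop) (by fun_prop)]
        refine sm_congr fun a b => ?_
        rw [sm_comm]
        refine sm_congr fun a' b' => ?_
        rw [sm_comul_mul _ _ (by fun_prop) (by fun_prop)]
        simp only [hit_hit, antipodeInv_mul, mul_assoc]
    _ = _ := by rw [mul_one]

variable (k H) in
theorem smashWellDefined : SmashWellDefined k H where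
  mul_assoc := smashMul_assoc
  preunit_comm := preunit_comm
  preunit_sq x := by
    rw [← smashMul_preunit_preunit x, smashMul_assoc]

end Smash

end Drinfeld

/-! ## Yetter-Drinfeld modules and equivariant coactions -/

open Sweedler WeakBialgebra WeakHopfAlgebra AlgMod

section Act

variable {k : Type u} {A : Type v} [CommRing k] [Ring A] [Algebra k A]
  {M N : Type*} [AddCommGroup M] [Module k M] [Module A M] [IsScalarTower k A M]
  [AddCommGroup N] [Module k N] [Module A N] [IsScalarTower k A N]
  {U : Type*} [AddCommGroup U] [Module k U]

@[fun_prop] theorem lin_act_elem {f : U → A ⊗[k] A} (hf : Lin k f) (x : M ⊗[k] N) :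
    Lin k fun t => act A M N (f t) x :=
  ⟨fun s t => by rw [hf.add, map_add, LinearMap.add_apply],
    fun c t => by rw [hf.smul, map_smul, LinearMap.smul_apply]⟩

theorem AlgMod.act_eq_sm (t : A ⊗[k] A) (s : M ⊗[k] N) :
    act A M N t s = sm t fun a b => sm s fun m n => (a • m) ⊗ₜ[k] (b • n) := by
  conv_lhs => rw [← sm_tmul_eq t, ← sm_tmul_eq s]
  refine ((by fun_prop : Lin k fun t => act A M N t (sm s fun a b => a ⊗ₜ[k] b)).map_sm t
    fun a b => a ⊗ₜ b).trans ?_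
  exact sm_congr fun a b => map_sm _ _ _

end Act

namespace Drinfeld

/-! ### Equivariant coactions give actions of H ⋈ H*. -/

section Equivariant

variable {k : Type u} {H : Type v} [CommRing k] [Ring H] [Algebra k H] [Coalgebra k H]
  [WeakHopfAlgebra k H] [BijectiveAntipode k H]
  {V : Type*} [AddCommGroup V] [Module k V] {P : Type*} [AddCommGroup P] [Module k P]

local notation "δ" => Coalgebra.comul (R := k)
local notation "ε" => Coalgebra.counit (R := k)
local notation "S" => antipode (k := k) (A := H)
local notation "T" => antipodeInv k H

/-- A coassociative coaction `ρ` on `V` with `ρ(l v) = l₍₂₎ v₍₀₎ ⊗ l₍₃₎ v₍₁₎ S⁻¹(l₍₁₎)`. -/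
structure IsEquivariant (α : H →ₗ[k] V →ₗ[k] V) (ρ : V →ₗ[k] V ⊗[k] H) : Prop where
  mul : ∀ a b v, α (a * b) v = α a (α b v)
  coassoc : ∀ v, TensorProduct.assoc k V H H (ρ.rTensor H (ρ v)) =
    (Coalgebra.comul (R := k) (A := H)).lTensor V (ρ v)
  equivariant : ∀ l v, ρ (α l v) = sm (δ l) fun a b => sm (δ b) fun c d => sm (ρ v) fun w x =>
    α c w ⊗ₜ[k] (d * (x * T a))

theorem sm_coaction_coassoc {ρ : V →ₗ[k] V ⊗[k] H} {v : V}
    (h : TensorProduct.assoc k V H H (ρ.rTensor H (ρ v)) =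
      (Coalgebra.comul (R := k) (A := H)).lTensor V (ρ v)) {F : V → H → H → P}
    (h₁ : ∀ b c, Lin k fun a => F a b c) (h₂ : ∀ a c, Lin k fun b => F a b c)
    (h₃ : ∀ a b, Lin k fun c => F a b c) :
    (sm (ρ v) fun w x => sm (ρ w) fun c d => F c d x) =
      sm (ρ v) fun w x => sm (δ x) fun c d => F w c d := by
  have h := congrArg (fun t => sm t fun a s => sm s fun b c => F a b c) h
  rwa [sm_assoc _ h₁ h₂ h₃, sm_rTensor, sm_lTensor] at h <;> fun_prop

/-- The action `(h ⋈ f) v = ⟨f, v₍₁₎⟩ h v₍₀₎` attached to an equivariant coaction is an action. -/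
theorem IsEquivariant.smash_mul {α : H →ₗ[k] V →ₗ[k] V} {ρ : V →ₗ[k] V ⊗[k] H}
    (hρ : IsEquivariant α ρ) (Φ : Smash k H →ₗ[k] V →ₗ[k] V)
    (hΦ : ∀ h f v, Φ (h ⊗ₜ f) v = α h (sm (ρ v) fun w x => f x • w)) (x y : Smash k H) (v : V) :
    Φ (smashMul k H (x ⊗ₜ y)) v = Φ x (Φ y v) := by
  refine lin_ext (k := k) (f := fun x => Φ (smashMul k H (x ⊗ₜ y)) v)
    (g := fun x => Φ x (Φ y v)) (by fun_prop) (by fun_prop) (fun h f => ?_) x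
  refine lin_ext (k := k) (f := fun y => Φ (smashMul k H ((h ⊗ₜ f) ⊗ₜ y)) v)
    (g := fun y => Φ (h ⊗ₜ f) (Φ y v)) (by fun_prop) (by fun_prop) (fun l g => ?_) y
  have e : Lin k fun s => Φ s v := by fun_prop
  calc Φ (smashMul k H ((h ⊗ₜ f) ⊗ₜ (l ⊗ₜ g))) v
    _ = sm (δ l) fun a b => sm (δ b) fun c d => sm (ρ v) fun w x => sm (δ x) fun p q =>
          (f (d * (p * T a)) * g q) • α h (α c w) := by
        rw [smashMul_tmul, e.map_sm]
        refine sm_congr fun a b => ?_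
        rw [e.map_sm]
        refine sm_congr fun c d => ?_
        rw [hΦ, hρ.mul, map_sm, map_sm]
        refine sm_congr fun w x => ?_
        rw [map_smul, map_smul, dualMul_apply,
          (by fun_prop : Lin k fun r : k => r • α h (α c w)).map_sm]
        rfl
    _ = sm (δ l) fun a b => sm (δ b) fun c d => sm (ρ v) fun w x => sm (ρ w) fun w' p =>
          (f (d * (p * T a)) * g x) • α h (α c w') := by
        -- Coassociativity turns the convolution f * g into two successive coactions, with g read
        -- off from the outer one.
        refine sm_congr fun a b => sm_congr fun c d => ?_
        rw [sm_coaction_coassoc (hρ.coassoc v)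
          (F := fun w p q => (f (d * (p * T a)) * g q) • α h (α c w))] <;> fun_prop
    _ = sm (ρ v) fun w x => sm (δ l) fun a b => sm (δ b) fun c d => sm (ρ w) fun w' p =>
          (f (d * (p * T a)) * g x) • α h (α c w') := by
        rw [sm_comm]
        refine sm_congr fun a b => ?_
        rw [sm_comm]
    -- The three legs of l now appear exactly as in the equivariance formula for ρ(l w).
    _ = sm (ρ v) fun w x => g x • α h (sm (ρ (α l w)) fun w' y => f y • w') := by
        refine sm_congr fun w x => ?_
        have e' : Lin k fun t : V ⊗[k] H => g x • α h (sm t fun w' y => f y • w') := by fun_prop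
        rw [hρ.equivariant, e'.map_sm]
        refine sm_congr fun a b => ?_
        rw [e'.map_sm]
        refine sm_congr fun c d => ?_
        rw [e'.map_sm]
        refine sm_congr fun w' y => ?_
        rw [sm_tmul, map_smul, smul_smul, mul_comm] <;> fun_prop
    _ = Φ (h ⊗ₜ f) (Φ (l ⊗ₜ g) v) := by
        have e' : Lin k fun u => α h (sm (ρ (α l u)) fun w' y => f y • w') := by fun_prop
        rw [hΦ, hΦ, e'.map_sm]
        exact sm_congr fun w x => (e'.smul _ _).symm

end Equivariant

/-! ### Yetter-Drinfeld modules are the equivariant counital comodules. -/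

section YetterDrinfeld

variable {k : Type u} {H : Type v} [CommRing k] [Ring H] [Algebra k H] [Coalgebra k H]
  {P : Type*} [AddCommGroup P] [Module k P]

local notation "δ" => Coalgebra.comul (R := k)
local notation "ε" => Coalgebra.counit (R := k)

theorem coactTwist_eq_sm (M : AlgMod.{u, v, w} k H) (ρ : M →ₗ[k] M ⊗[k] H) (m : M)
    (t : H ⊗[k] H) :
    coactTwist M ρ m t = sm t fun a b => sm (ρ (b • m)) fun n x => n ⊗ₜ[k] (x * a) := by
  conv_lhs => rw [← sm_tmul_eq t]
  rw [map_sm]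
  refine sm_congr fun a b => ?_
  change (LinearMap.mulRight k a).lTensor M (ρ (b • m)) = _
  conv_lhs => rw [← sm_tmul_eq (ρ (b • m))]
  exact map_sm _ _ _

theorem smashAction_eq_sm (M : YDMod.{u, v, w} k H) (h : H) (f : Module.Dual k H)
    (m : M.toAlgMod) :
    smashAction M (h ⊗ₜ f) m = h • sm (M.coact m) fun w x => f x • w := by
  rw [smashAction_tmul]
  congr 1
  change TensorProduct.rid k M.toAlgMod (f.lTensor M.toAlgMod (M.coact m)) = _
  conv_lhs => rw [← sm_tmul_eq (M.coact m)]
  rw [map_sm, map_sm]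
  exact sm_congr fun w x => by rw [LinearMap.lTensor_tmul, TensorProduct.rid_tmul]

variable [WeakHopfAlgebra k H] [BijectiveAntipode k H]

local notation "S" => antipode (k := k) (A := H)
local notation "T" => antipodeInv k H

section

variable {M : AlgMod.{u, v, w} k H} {ρ : M →ₗ[k] M ⊗[k] H} 

theorem sm_counit_coaction (hρ : IsYetterDrinfeld M ρ) (m : M) :
    (sm (ρ m) fun n x => ε x • n) = m := by
  conv_rhs => rw [← hρ.counit m]
  conv_rhs => rw [← sm_tmul_eq (ρ m)]
  rw [map_sm, map_sm]
  exact sm_congr fun n x => by rw [LinearMap.lTensor_tmul, TensorProduct.rid_tmul]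

/-- Δ(1) is idempotent and ρ(m) lies in its image. -/
theorem act_one_coaction (hρ : IsYetterDrinfeld M ρ) (m : M) :
    (sm (δ (1 : H)) fun a b => sm (ρ m) fun n x => (a • n) ⊗ₜ[k] (b * x)) = ρ m := by
  obtain ⟨s, hs⟩ := hρ.mem_range m
  refine (act_eq_sm (δ (1 : H)) (ρ m)).symm.trans ?_
  rw [← hs, ← Module.End.mul_apply, ← map_mul, comul_mul_one]

theorem coaction_compat (hρ : IsYetterDrinfeld M ρ) (h : H) (m : M) :
    (sm (δ h) fun a b => sm (ρ m) fun n x => (a • n) ⊗ₜ[k] (b * x)) =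
      sm (δ h) fun a b => sm (ρ (b • m)) fun n x => n ⊗ₜ[k] (x * a) :=
  (act_eq_sm _ _).symm.trans ((hρ.compat h m).trans (coactTwist_eq_sm M ρ m _))

/-- `ρ(l m) = l₍₂₎ m₍₀₎ ⊗ l₍₃₎ m₍₁₎ S⁻¹(l₍₁₎)`. -/
theorem coaction_smul (hρ : IsYetterDrinfeld M ρ) (l : H) (m : M) :
    ρ (l • m) = sm (δ l) fun a b => sm (δ b) fun c d => sm (ρ m) fun n x =>
      (c • n) ⊗ₜ[k] (d * (x * T a)) := by
  symm
  calc (sm (δ l) fun a b => sm (δ b) fun c d => sm (ρ m) fun n x =>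
      (c • n) ⊗ₜ[k] (d * (x * T a)))
    -- Compatibility is applied to the last two legs of l. It brings l₍₂₎ next to T(l₍₁₎), and
    -- l₍₂₎T(l₍₁₎) becomes T(ε_t(l₍₁₎)).
    _ = sm (δ l) fun a b => sm (δ b) fun c d => sm (ρ (d • m)) fun n x =>
          n ⊗ₜ[k] (x * (c * T a)) := by
        refine sm_congr fun a b => ?_
        have h := congrArg (fun t => sm t fun n x => n ⊗ₜ[k] (x * T a)) (coaction_compat hρ b m)
        simpa (disch := fun_prop) only [sm_sm, sm_tmul, mul_assoc] using h
    _ = sm (δ l) fun a b => sm (ρ (b • m)) fun n x => n ⊗ₜ[k] (x * T (epsT k H a)) := by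
        rw [← sm_coassoc l (F := fun a c d => sm (ρ (d • m)) fun n x => n ⊗ₜ[k] (x * (c * T a)))]
          <;> try fun_prop
        refine sm_congr fun a b => ?_
        rw [sm_mul_antipodeInv a (F := fun y => sm (ρ (b • m)) fun n x => n ⊗ₜ[k] (x * y))]
        fun_prop
    _ = sm (δ (1 : H)) fun c d => sm (ρ ((T c * l) • m)) fun n x => n ⊗ₜ[k] (x * T d) := by
        rw [sm_epsT_left l (F := fun a b => sm (ρ (b • m)) fun n x => n ⊗ₜ[k] (x * T a))]
          <;> try fun_prop
        exact sm_one_congr (by fun_prop) (by fun_prop) (by fun_prop) (by fun_prop)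
          fun c d hc hd => by rw [IsSource.epsTBar_eq hc]
    _ = sm (δ (1 : H)) fun c d => sm (ρ (d • l • m)) fun n x => n ⊗ₜ[k] (x * c) := by
        rw [sm_antipodeInv_one (F := fun c d => sm (ρ ((d * l) • m)) fun n x => n ⊗ₜ[k] (x * c))]
          <;> try fun_prop
        simp only [mul_smul]
    -- What is left is the right side of the compatibility condition at h = 1 for the vector l m.
    -- Its left side is Δ(1)ρ(l m), and here the condition ρ(l m) ∈ M ⊗_t H enters.
    _ = _ := by
        rw [← coaction_compat hρ, act_one_coaction hρ]

/-- An equivariant counital comodule is a Yetter-Drinfeld module. -/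
theorem isYetterDrinfeld_of_equivariant
    (coassoc : ∀ m, TensorProduct.assoc k M H H (ρ.rTensor H (ρ m)) =
      (Coalgebra.comul (R := k) (A := H)).lTensor M (ρ m))
    (counit : ∀ m,
      TensorProduct.rid k M ((Coalgebra.counit (R := k) (A := H)).lTensor M (ρ m)) = m)
    (equiv : ∀ (l : H) m, ρ (l • m) = sm (δ l) fun a b => sm (δ b) fun c d => sm (ρ m) fun n x =>
      (c • n) ⊗ₜ[k] (d * (x * T a))) : IsYetterDrinfeld M ρ where
  coassoc := coassoc
  counit := counit
  mem_range m := by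
    refine ⟨ρ m, ?_⟩
    refine (act_eq_sm (δ (1 : H)) (ρ m)).trans ?_
    -- At l = 1 the last two legs of Δ²(1) carry a coproduct, so they absorb another Δ(1).
    have e₁ := equiv 1 m
    rw [one_smul] at e₁
    conv_rhs => rw [e₁]
    conv_lhs => rw [e₁]
    simp (disch := fun_prop) only [sm_sm, sm_tmul, smul_eq_mul]
    rw [sm_comm]
    refine sm_congr fun a b => ?_
    rw [← sm_one_mul b (F := fun c d => sm (ρ m) fun n x => (c • n) ⊗ₜ[k] (d * (x * T a)))]
      <;> try fun_prop
    simp only [mul_smul, mul_assoc]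
  compat h m := by
    rw [coactTwist_eq_sm]
    refine (act_eq_sm _ _).trans ?_
    symm
    calc (sm (δ h) fun a b => sm (ρ (b • m)) fun n x => n ⊗ₜ[k] (x * a))
      _ = sm (δ h) fun a b => sm (δ b) fun p q => sm (δ q) fun c d => sm (ρ m) fun n x =>
            (c • n) ⊗ₜ[k] (d * (x * (T p * a))) := by
          refine sm_congr fun a b => ?_
          rw [equiv]
          simp (disch := fun_prop) only [sm_sm, sm_tmul, mul_assoc]
      -- T(h₍₂₎)h₍₁₎ collapses to T(ε_s(h₍₁₎)). The ε_s is then traded for Δ(1), leaving h acting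
      -- diagonally on ρ(1·m).
      _ = sm (δ h) fun a q => sm (δ q) fun c d => sm (ρ m) fun n x =>
            (c • n) ⊗ₜ[k] (d * (x * T (epsS k H a))) := by
          rw [← sm_coassoc h (F := fun a p q => sm (δ q) fun c d => sm (ρ m) fun n x =>
            (c • n) ⊗ₜ[k] (d * (x * (T p * a))))] <;> try fun_prop
          refine sm_congr fun a q => ?_
          rw [sm_antipodeInv_mul a (F := fun y => sm (δ q) fun c d => sm (ρ m) fun n x =>
            (c • n) ⊗ₜ[k] (d * (x * y)))]
          fun_prop
      _ = sm (δ (1 : H)) fun a b => sm (δ (h * b)) fun c d => sm (ρ m) fun n x =>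
            (c • n) ⊗ₜ[k] (d * (x * T a)) := by
          rw [sm_epsS_left h (F := fun a q => sm (δ q) fun c d => sm (ρ m) fun n x =>
            (c • n) ⊗ₜ[k] (d * (x * T a)))] <;> fun_prop
      _ = sm (δ h) fun p q => sm (ρ ((1 : H) • m)) fun n x => (p • n) ⊗ₜ[k] (q * x) := by
          rw [equiv 1 m]
          simp (disch := fun_prop) only [sm_sm, sm_tmul, sm_comul_mul]
          rw [sm_comm]
          simp only [mul_smul, mul_assoc]
      _ = _ := by rw [one_smul]; rfl

/-- In Δ²(y) a source element sits on the last leg, so the equivariance formula places it to the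
left of m₍₁₎. -/
theorem sm_coaction_source (hρ : IsYetterDrinfeld M ρ) {y : H} (hy : IsSource k y) (m : M)
    {F : M → H → P} (h₁ : ∀ b, Lin k fun a => F a b) (h₂ : ∀ a, Lin k fun b => F a b) :
    sm (ρ (y • m)) F = sm (ρ m) fun n x => F n (y * x) := by
  conv_rhs => rw [← one_smul H m]
  rw [coaction_smul hρ, coaction_smul hρ, hy.sm'] <;> try fun_prop
  simp (disch := fun_prop) only [sm_sm, sm_tmul]
  refine sm_congr fun a b => ?_
  rw [hy.sm_mul'] <;> try fun_prop
  simp only [mul_assoc]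

/-- A target element sits on the first leg of Δ²(z), the one that reaches m₍₁₎ from the right
through T. -/
theorem sm_coaction_target (hρ : IsYetterDrinfeld M ρ) {z : H} (hz : IsTarget k z) (m : M)
    {F : M → H → P} (h₁ : ∀ b, Lin k fun a => F a b) (h₂ : ∀ a, Lin k fun b => F a b) :
    sm (ρ (z • m)) F = sm (ρ m) fun n x => F n (x * T z) := by
  conv_rhs => rw [← one_smul H m]
  rw [coaction_smul hρ, coaction_smul hρ, hz.sm'] <;> try fun_prop
  simp (disch := fun_prop) only [sm_sm, sm_tmul]
  refine sm_congr fun a b => ?_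
  simp only [mul_assoc, antipodeInv_mul]

/-- This moves a target element from m₍₀₎ to m₍₁₎. -/
theorem sm_target_smul_coaction (hρ : IsYetterDrinfeld M ρ) {z : H} (hz : IsTarget k z) (m : M)
    {F : M → H → P} (h₁ : ∀ b, Lin k fun a => F a b) (h₂ : ∀ a, Lin k fun b => F a b) :
    (sm (ρ m) fun n x => F (z • n) x) = sm (ρ m) fun n x => F n (x * z) := by
  -- The counit law for z n expresses the action of z by the coaction. After coassociativity
  -- ε(x₍₁₎T(z))x₍₂₎ = x ε_t(T(z)) = x z, as T(z) is a source element.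
  have e : ∀ n : M, z • n = sm (ρ n) fun n' x => ε (x * T z) • n' := by
    intro n
    rw [← sm_coaction_target hρ hz n (F := fun n' x => ε x • n') (by fun_prop) (by fun_prop),
      sm_counit_coaction hρ]
  simp_rw [e, (h₁ _).map_sm, (h₁ _).smul]
  rw [sm_coaction_coassoc (hρ.coassoc m) (F := fun n' y x => ε (y * T z) • F n' x)]
    <;> try fun_prop
  refine sm_congr fun n x => ?_
  rw [sm_contract₁ x (T z) (h₂ n), ← hz.antipodeInv.antipode_eq, antipode_antipodeInv]

end

theorem isEquivariant (M : YDMod.{u, v, w} k H) :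
    IsEquivariant (V := M.toAlgMod) (Algebra.lsmul k k M.toAlgMod).toLinearMap M.coact where
  mul a b v := mul_smul a b v
  coassoc := M.isYetterDrinfeld.coassoc
  equivariant l v := coaction_smul M.isYetterDrinfeld l v

variable (k H) in
theorem actionWellDefined : ActionWellDefined.{u, v, w} k H where
  mul_act M x y m :=
    (isEquivariant M).smash_mul (smashAction M) (smashAction_eq_sm M) x y m
  preunit_act M m := by
    rw [preunit, smashAction_eq_sm, one_smul, sm_counit_coaction M.isYetterDrinfeld]

end YetterDrinfeld

end Drinfeld

/-! ## The monoidal structure on Yetter-Drinfeld modules -/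

namespace YDMod

open Sweedler WeakBialgebra WeakHopfAlgebra AlgMod Drinfeld

section Lin

variable {k : Type u} {H : Type v} [CommRing k] [Ring H] [Algebra k H] [Coalgebra k H]
  {U : Type*} [AddCommGroup U] [Module k U]

@[fun_prop] theorem lin_diagCoact {M N : AlgMod.{u, v, w} k H} (ρM : M →ₗ[k] M ⊗[k] H)
    (ρN : N →ₗ[k] N ⊗[k] H) {f : U → M ⊗[k] N} (hf : Lin k f) :
    Lin k fun x => diagCoact ρM ρN (f x) := (lin_coe _).comp hf

theorem diagCoact_tmul {M N : AlgMod.{u, v, w} k H} (ρM : M →ₗ[k] M ⊗[k] H)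
    (ρN : N →ₗ[k] N ⊗[k] H) (m : M) (n : N) :
    diagCoact ρM ρN (m ⊗ₜ n) = sm (ρM m) fun m₀ m₁ => sm (ρN n) fun n₀ n₁ =>
      (m₀ ⊗ₜ n₀) ⊗ₜ[k] (n₁ * m₁) := by
  change (LinearMap.mul' k H ∘ₗ (TensorProduct.comm k H H).toLinearMap).lTensor (M ⊗[k] N)
    (TensorProduct.tensorTensorTensorComm k M H N H (ρM m ⊗ₜ ρN n)) = _
  have e : ∀ s, Lin k fun t : M ⊗[k] H =>
      (LinearMap.mul' k H ∘ₗ (TensorProduct.comm k H H).toLinearMap).lTensor (M ⊗[k] N)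
      (TensorProduct.tensorTensorTensorComm k M H N H (t ⊗ₜ s)) := by intro s; fun_prop
  have e' : ∀ t, Lin k fun s : N ⊗[k] H =>
      (LinearMap.mul' k H ∘ₗ (TensorProduct.comm k H H).toLinearMap).lTensor (M ⊗[k] N)
      (TensorProduct.tensorTensorTensorComm k M H N H (t ⊗ₜ s)) := by intro s; fun_prop
  conv_lhs => rw [← sm_tmul_eq (ρM m), ← sm_tmul_eq (ρN n)]
  rw [(e _).map_sm]
  refine sm_congr fun m₀ m₁ => ?_
  rw [(e' _).map_sm]
  rfl

variable [WeakBialgebra k H]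

@[fun_prop] theorem lin_proj (M N : AlgMod.{u, v, w} k H) {f : U → M ⊗[k] N} (hf : Lin k f) :
    Lin k fun x => proj M N (f x) := (lin_coe _).comp hf

@[fun_prop] theorem lin_incl (M N : AlgMod.{u, v, w} k H) {f : U → tensor M N} (hf : Lin k f) :
    Lin k fun x => incl M N (f x) := (lin_coe _).comp hf

@[fun_prop] theorem lin_tm_left {M N : AlgMod.{u, v, w} k H} {f : U → M} (hf : Lin k f) (n : N) :
    Lin k fun x => tm (f x) n := by unfold tm; fun_prop

@[fun_prop] theorem lin_tm_right {M N : AlgMod.{u, v, w} k H} {f : U → N} (hf : Lin k f) (m : M) :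
    Lin k fun x => tm m (f x) := by unfold tm; fun_prop

@[fun_prop] theorem lin_unitIncl {f : U → unit k H} (hf : Lin k f) :
    Lin k fun x => unitIncl (f x) := (lin_coe _).comp hf

@[fun_prop] theorem lin_unitProj {f : U → H} (hf : Lin k f) :
    Lin k fun x => unitProj (k := k) (f x) := (lin_coe _).comp hf

theorem proj_act (M N : AlgMod.{u, v, w} k H) (a : H) (x : M ⊗[k] N) :
    proj M N (act H M N (Coalgebra.comul a) x) = a • proj M N x := by
  apply incl_injective
  rw [incl_proj, incl_smul, incl_proj, ← Module.End.mul_apply, ← Module.End.mul_apply,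
    ← map_mul (act H M N), ← map_mul (act H M N), comul_one_mul, comul_mul_one]

theorem _root_.AlgMod.act_tmul_eq_sm (M N : AlgMod.{u, v, w} k H) (t : H ⊗[k] H) (m : M) (n : N) :
    act H M N t (m ⊗ₜ n) = sm t fun a b => (a • m) ⊗ₜ[k] (b • n) := by
  rw [act_eq_sm]
  exact sm_congr fun a b => sm_tmul _ _ (by fun_prop) (by fun_prop)

end Lin

/-! ### The diagonal coaction on the full tensor product M ⊗ N. -/

section Diag

variable {k : Type u} {H : Type v} [CommRing k] [Ring H] [Algebra k H] [Coalgebra k H]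
  [WeakHopfAlgebra k H] [BijectiveAntipode k H] {P : Type*} [AddCommGroup P] [Module k P]

local notation "δ" => Coalgebra.comul (R := k)
local notation "ε" => Coalgebra.counit (R := k)
local notation "S" => antipode (k := k) (A := H)
local notation "T" => antipodeInv k H

variable (M N : YDMod.{u, v, w} k H)

local notation "D" => diagCoact (YDMod.coact M) (YDMod.coact N)
local notation "ρM" => YDMod.coact M
local notation "ρN" => YDMod.coact N

theorem sm_diagCoact_tmul (m : M.toAlgMod) (n : N.toAlgMod)
    {F : M.toAlgMod ⊗[k] N.toAlgMod → H → P}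
    (h₁ : ∀ b, Lin k fun a => F a b) (h₂ : ∀ a, Lin k fun b => F a b) :
    sm (D (m ⊗ₜ n)) F = sm (ρM m) fun m₀ m₁ => sm (ρN n) fun n₀ n₁ =>
      F (m₀ ⊗ₜ n₀) (n₁ * m₁) := by
  rw [diagCoact_tmul]
  simp (disch := fun_prop) only [sm_sm, sm_tmul]

/-- The diagonal coaction has values in (M ⊗_t N) ⊗ H. The target leg 1₍₂₎ moves from n₍₀₎ through
n₍₁₎ to the left of m₍₁₎, where Δ(1) is absorbed by ρ(m). -/
theorem sm_diagCoact_act_one (x : M.toAlgMod ⊗[k] N.toAlgMod)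
    {F : M.toAlgMod ⊗[k] N.toAlgMod → H → P}
    (h₁ : ∀ b, Lin k fun a => F a b) (h₂ : ∀ a, Lin k fun b => F a b) :
    (sm (D x) fun w y => F (act H M.toAlgMod N.toAlgMod (δ (1 : H)) w) y) = sm (D x) F := by
  refine lin_ext (k := k)
    (f := fun x => sm (D x) fun w y => F (act H M.toAlgMod N.toAlgMod (δ (1 : H)) w) y)
    (g := fun x => sm (D x) F) (by fun_prop) (by fun_prop) (fun m n => ?_) x
  rw [sm_diagCoact_tmul, sm_diagCoact_tmul] <;> try fun_prop
  calc _ = sm (δ (1 : H)) fun a b => sm (ρM m) fun m₀ m₁ => sm (ρN n) fun n₀ n₁ =>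
          F ((a • m₀) ⊗ₜ (b • n₀)) (n₁ * m₁) := by
        refine Eq.trans (sm_congr fun m₀ m₁ => ?_) (sm_comm _ _ _)
        refine Eq.trans (sm_congr fun n₀ n₁ => ?_) (sm_comm _ _ _)
        rw [act_tmul_eq_sm, (h₁ _).map_sm]
    _ = sm (δ (1 : H)) fun a b => sm (ρM m) fun m₀ m₁ => sm (ρN n) fun n₀ n₁ =>
          F ((a • m₀) ⊗ₜ n₀) (n₁ * (b * m₁)) := by
        refine sm_one_congr (by fun_prop) (by fun_prop) (by fun_prop) (by fun_prop)
          fun a b ha hb => sm_congr fun m₀ m₁ => ?_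
        rw [sm_target_smul_coaction N.isYetterDrinfeld hb n
          (F := fun n₀ n₁ => F ((a • m₀) ⊗ₜ n₀) (n₁ * m₁))] <;> try fun_prop
        simp only [mul_assoc]
    _ = _ := by
        conv_rhs => rw [← act_one_coaction M.isYetterDrinfeld m]
        simp (disch := fun_prop) only [sm_sm, sm_tmul]

/-- The diagonal coaction factors through the projection onto M ⊗_t N. The legs of Δ(1) meet between
n₍₁₎ and m₍₁₎ as T(1₍₂₎)1₍₁₎ = T(ε_s(1)) = 1. -/
theorem diagCoact_act_one (x : M.toAlgMod ⊗[k] N.toAlgMod) :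
    D (act H M.toAlgMod N.toAlgMod (δ (1 : H)) x) = D x := by
  refine lin_ext (k := k) (f := fun x => D (act H M.toAlgMod N.toAlgMod (δ (1 : H)) x))
    (g := fun x => D x) (by fun_prop) (by fun_prop) (fun m n => ?_) x
  rw [act_tmul_eq_sm, map_sm]
  calc _ = sm (δ (1 : H)) fun a b => sm (ρM m) fun m₀ m₁ => sm (ρN n) fun n₀ n₁ =>
          (m₀ ⊗ₜ[k] n₀) ⊗ₜ[k] (n₁ * (T b * a * m₁)) := by
        refine sm_one_congr (by fun_prop) (by fun_prop) (by fun_prop) (by fun_prop)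
          fun a b ha hb => ?_
        rw [diagCoact_tmul, sm_coaction_source M.isYetterDrinfeld ha] <;> try fun_prop
        refine sm_congr fun m₀ m₁ => ?_
        rw [sm_coaction_target N.isYetterDrinfeld hb] <;> try fun_prop
        simp only [mul_assoc]
    _ = _ := by
        rw [sm_antipodeInv_mul (1 : H) (F := fun y => sm (ρM m) fun m₀ m₁ => sm (ρN n) fun n₀ n₁ =>
          (m₀ ⊗ₜ[k] n₀) ⊗ₜ[k] (n₁ * (y * m₁))) (by fun_prop), epsS_one, antipodeInv_one,
          diagCoact_tmul]
        simp only [one_mul]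

/-- Isolates the third and fourth legs as a coproduct of one element: these two meet in
`diagCoact_act`. -/
theorem sm_coassoc_pairs (x : H) {F : H → H → H → H → H → P}
    (h₁ : ∀ b c d e, Lin k fun a => F a b c d e) (h₂ : ∀ a c d e, Lin k fun b => F a b c d e)
    (h₃ : ∀ a b d e, Lin k fun c => F a b c d e) (h₄ : ∀ a b c e, Lin k fun d => F a b c d e)
    (h₅ : ∀ a b c d, Lin k fun e => F a b c d e) :
    (sm (δ x) fun p q => sm (δ p) fun a r => sm (δ r) fun b c => sm (δ q) fun d e =>
      F a b c d e) =
      sm (δ x) fun a r => sm (δ r) fun b v => sm (δ v) fun u e => sm (δ u) fun c d =>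
        F a b c d e := by
  rw [sm_coassoc x (F := fun a r q => sm (δ r) fun b c => sm (δ q) fun d e => F a b c d e)]
    <;> try fun_prop
  refine sm_congr fun a r => ?_
  rw [sm_coassoc r (F := fun b c q => sm (δ q) fun d e => F a b c d e)] <;> try fun_prop
  refine sm_congr fun b v => ?_
  rw [sm_coassoc v (F := fun c d e => F a b c d e)] <;> fun_prop

/-- Equivariance for M and N gives a coefficient with T(l₍₄₎)l₍₃₎ between n₍₁₎ and m₍₁₎. This is
T(ε_s(l₍₃₎)), and it is traded for a copy of Δ(1). -/
theorem diagCoact_act (l : H) (x : M.toAlgMod ⊗[k] N.toAlgMod) :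
    D (act H M.toAlgMod N.toAlgMod (δ l) x) = sm (δ l) fun a b => sm (δ b) fun c d =>
      sm (D x) fun w y => act H M.toAlgMod N.toAlgMod (δ c) w ⊗ₜ[k] (d * (y * T a)) := by
  refine lin_ext (k := k) (f := fun x => D (act H M.toAlgMod N.toAlgMod (δ l) x))
    (g := fun x => sm (δ l) fun a b => sm (δ b) fun c d =>
      sm (D x) fun w y => act H M.toAlgMod N.toAlgMod (δ c) w ⊗ₜ[k] (d * (y * T a)))
    (by fun_prop) (by fun_prop) (fun m n => ?_) x
  let G : H → H → H → H → H → (M.toAlgMod ⊗[k] N.toAlgMod) ⊗[k] H := fun a b y d e =>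
    sm (ρM m) fun m₀ m₁ => sm (ρN n) fun n₀ n₁ =>
      ((b • m₀) ⊗ₜ[k] (d • n₀)) ⊗ₜ[k] (e * (n₁ * (y * (m₁ * T a))))
  rw [act_tmul_eq_sm, map_sm]
  calc _ = sm (δ l) fun p q => sm (δ p) fun a r => sm (δ r) fun b c => sm (δ q) fun d' s =>
          sm (δ s) fun d e => G a b (T d' * c) d e := by
        refine sm_congr fun p q => ?_
        rw [diagCoact_tmul, coaction_smul M.isYetterDrinfeld, coaction_smul N.isYetterDrinfeld]
        simp (disch := fun_prop) only [sm_sm, sm_tmul]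
        refine sm_congr fun a r => sm_congr fun b c => ?_
        rw [sm_comm]
        refine sm_congr fun d' s => ?_
        rw [sm_comm]
        refine sm_congr fun d e => ?_
        simp only [G, mul_assoc]
    _ = sm (δ l) fun a r => sm (δ r) fun b v => sm (δ v) fun u s => sm (δ u) fun c d' =>
          sm (δ s) fun d e => G a b (T d' * c) d e :=
        sm_coassoc_pairs l (F := fun a b c d' s => sm (δ s) fun d e => G a b (T d' * c) d e)
          (by fun_prop) (by fun_prop) (by fun_prop) (by fun_prop) (by fun_prop)
    _ = sm (δ l) fun a r => sm (δ r) fun b v => sm (δ v) fun u s =>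
          sm (δ s) fun d e => G a b (T (epsS k H u)) d e := by
        refine sm_congr fun a r => sm_congr fun b v => sm_congr fun u s => ?_
        rw [sm_antipodeInv_mul u (F := fun y => sm (δ s) fun d e => G a b y d e)]
        fun_prop
    _ = sm (δ l) fun a r => sm (δ r) fun b v => sm (δ (1 : H)) fun p q => sm (δ (v * q)) fun d e =>
          G a b (T p) d e := by
        refine sm_congr fun a r => sm_congr fun b v => ?_
        rw [sm_epsS_left v (F := fun u s => sm (δ s) fun d e => G a b (T u) d e)] <;> fun_prop
    _ = sm (δ l) fun a r => sm (δ r) fun b v => sm (δ v) fun d e => G a b 1 d e := by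
        refine sm_congr fun a r => sm_congr fun b v => ?_
        -- The surplus legs of Δ²(1) are those of the equivariance formula for ρ(1·n), so they
        -- disappear.
        calc _ = sm (δ v) fun d e => sm (δ (1 : H)) fun p q => sm (δ q) fun q₁ q₂ =>
              G a b (T p) (d * q₁) (e * q₂) := by
              rw [sm_comm]
              refine sm_congr fun p q => ?_
              rw [sm_comul_mul] <;> fun_prop
          _ = _ := by
              refine sm_congr fun d e => ?_
              simp only [G]
              conv_rhs => enter [2, m₀, m₁]; rw [← one_smul H n, coaction_smul N.isYetterDrinfeld]
              simp (disch := fun_prop) only [sm_sm, sm_tmul, one_mul]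
              refine Eq.trans ?_ (sm_comm _ _ _)
              refine sm_congr fun p q => ?_
              refine Eq.trans ?_ (sm_comm _ _ _)
              refine sm_congr fun q₁ q₂ => sm_congr fun m₀ m₁ => sm_congr fun n₀ n₁ => ?_
              simp only [mul_smul, mul_assoc]
    _ = _ := by
        refine sm_congr fun a r => ?_
        rw [← sm_coassoc r (F := fun b d e => G a b 1 d e)] <;> try fun_prop
        refine sm_congr fun c d => ?_
        rw [sm_diagCoact_tmul] <;> try fun_prop
        refine (sm_comm _ _ _).trans (sm_congr fun m₀ m₁ => ?_)
        refine (sm_comm _ _ _).trans (sm_congr fun n₀ n₁ => ?_)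
        rw [act_tmul_eq_sm, (by fun_prop : Lin k fun s : M.toAlgMod ⊗[k] N.toAlgMod =>
          s ⊗ₜ[k] (d * (n₁ * m₁ * T a))).map_sm]
        exact sm_congr fun b e => by rw [one_mul, mul_assoc]

theorem diagCoact_coassoc (x : M.toAlgMod ⊗[k] N.toAlgMod) :
    TensorProduct.assoc k _ H H (LinearMap.rTensor H D (D x)) =
      (Coalgebra.comul (R := k) (A := H)).lTensor _ (D x) := by
  refine lin_ext (k := k) (f := fun x => TensorProduct.assoc k _ H H (LinearMap.rTensor H D (D x)))
    (g := fun x => (Coalgebra.comul (R := k) (A := H)).lTensor _ (D x)) (by fun_prop) (by fun_prop)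
    (fun m n => ?_) x
  rw [diagCoact_tmul]
  simp only [Sweedler.map_sm, LinearMap.rTensor_tmul, LinearMap.lTensor_tmul, diagCoact_tmul]
  have e : ∀ y : H, Lin k fun s : (M.toAlgMod ⊗[k] N.toAlgMod) ⊗[k] H =>
      TensorProduct.assoc k _ H H (s ⊗ₜ[k] y) := by intro y; fun_prop
  let G : M.toAlgMod → H → H → N.toAlgMod → H → H → (M.toAlgMod ⊗[k] N.toAlgMod) ⊗[k] (H ⊗[k] H) :=
    fun m₀ a b n₀ c d => (m₀ ⊗ₜ n₀) ⊗ₜ ((c * a) ⊗ₜ (d * b))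
  calc _ = sm (ρN n) fun n₀ n₁ => sm (ρN n₀) fun n₀' n₁' => sm (ρM m) fun m₀ m₁ =>
        sm (ρM m₀) fun m₀' m₁' => G m₀' m₁' m₁ n₀' n₁' n₁ := by
        rw [sm_comm]
        refine sm_congr fun n₀ n₁ => ?_
        rw [sm_comm]
        refine sm_congr fun m₀ m₁ => ?_
        rw [sm_comm, (e _).map_sm]
        refine sm_congr fun m₀' m₁' => ?_
        rw [(e _).map_sm]
        exact sm_congr fun n₀' n₁' => rfl
    _ = sm (ρN n) fun n₀ n₁ => sm (δ n₁) fun c d => sm (ρM m) fun m₀ m₁ =>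
        sm (δ m₁) fun a b => G m₀ a b n₀ c d := by
        rw [sm_coaction_coassoc (N.isYetterDrinfeld.coassoc n) (F := fun n₀ c d =>
          sm (ρM m) fun m₀ m₁ => sm (ρM m₀) fun m₀' m₁' => G m₀' m₁' m₁ n₀ c d)] <;> try fun_prop
        refine sm_congr fun n₀ n₁ => sm_congr fun c d => ?_
        rw [sm_coaction_coassoc (M.isYetterDrinfeld.coassoc m) (F := fun m₀ a b =>
          G m₀ a b n₀ c d)] <;> fun_prop
    _ = _ := by
        rw [sm_comm (ρM m)]
        refine sm_congr fun n₀ n₁ => ?_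
        rw [sm_comm]
        refine sm_congr fun m₀ m₁ => ?_
        conv_rhs => rw [← sm_tmul_eq (δ (n₁ * m₁)), sm_comul_mul n₁ m₁ (by fun_prop) (by fun_prop)]
        rw [(by fun_prop : Lin k fun s : H ⊗[k] H => (m₀ ⊗ₜ[k] n₀) ⊗ₜ[k] s).map_sm]
        refine sm_congr fun c d => ?_
        rw [(by fun_prop : Lin k fun s : H ⊗[k] H => (m₀ ⊗ₜ[k] n₀) ⊗ₜ[k] s).map_sm]

/-- The counit law holds only up to Δ(1), hence exactly on M ⊗_t N. For a ⊗ b in Δ(1) the actions on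
m and n are coefficients ε(a m₍₁₎) and ε(n₍₁₎b), and the weak counit axiom sums them to ε(n₍₁₎m₍₁₎).
-/
theorem sm_counit_diagCoact (x : M.toAlgMod ⊗[k] N.toAlgMod) :
    (sm (D x) fun w y => ε y • w) = act H M.toAlgMod N.toAlgMod (δ (1 : H)) x := by
  refine lin_ext (k := k) (f := fun x => sm (D x) fun w y => ε y • w)
    (g := fun x => act H M.toAlgMod N.toAlgMod (δ (1 : H)) x) (by fun_prop) (by fun_prop)
    (fun m n => ?_) x
  rw [sm_diagCoact_tmul, act_tmul_eq_sm] <;> try fun_prop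
  symm
  calc _ = sm (δ (1 : H)) fun a b => sm (ρM m) fun m₀ m₁ => sm (ρN n) fun n₀ n₁ =>
          (ε (a * m₁) * ε (n₁ * b)) • (m₀ ⊗ₜ[k] n₀) := by
        refine sm_one_congr (by fun_prop) (by fun_prop) (by fun_prop) (by fun_prop)
          fun a b ha hb => ?_
        have e₁ : a • m = sm (ρM m) fun m₀ m₁ => ε (a * m₁) • m₀ := by
          rw [← sm_coaction_source M.isYetterDrinfeld ha m (F := fun n' x => ε x • n')
            (by fun_prop) (by fun_prop), sm_counit_coaction M.isYetterDrinfeld]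
        have e₂ : b • n = sm (ρN n) fun n₀ n₁ => ε (n₁ * b) • n₀ := by
          -- Here b = S(T(b)) = ε_t(T(b)), as T(b) is a source element, and ε(y ·) does not see ε_t.
          have e₃ : ∀ y : H, ε (y * b) = ε (y * T b) := by
            intro y
            rw [← counit_mul_epsT y (T b), ← hb.antipodeInv.antipode_eq, antipode_antipodeInv]
          simp_rw [e₃]
          rw [← sm_coaction_target N.isYetterDrinfeld hb n (F := fun n' x => ε x • n')
            (by fun_prop) (by fun_prop), sm_counit_coaction N.isYetterDrinfeld]
        rw [e₁, e₂, (by fun_prop : Lin k fun s => s ⊗ₜ[k] (sm (ρN n) fun n₀ n₁ =>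
          ε (n₁ * b) • n₀)).map_sm]
        refine sm_congr fun m₀ m₁ => ?_
        rw [(by fun_prop : Lin k fun s => (ε (a * m₁) • m₀) ⊗ₜ[k] s).map_sm]
        exact sm_congr fun n₀ n₁ => by rw [smul_tmul_smul]
    _ = _ := by
        rw [sm_comm]
        refine sm_congr fun m₀ m₁ => ?_
        rw [sm_comm]
        refine sm_congr fun n₀ n₁ => ?_
        rw [← mul_one n₁, ← sm_counit_mul_mul' n₁ 1 m₁]
        simp only [mul_one]
        exact ((lin_smul_left (k := k) lin_id (m₀ ⊗ₜ[k] n₀)).map_sm _ _).symm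

end Diag

end YDMod

namespace YDMod

open Sweedler WeakBialgebra WeakHopfAlgebra AlgMod Drinfeld

/-! ### The Yetter-Drinfeld module M ⊗_t N and the associator. -/

section TensorYD

variable {k : Type u} {H : Type v} [CommRing k] [Ring H] [Algebra k H] [Coalgebra k H]
  [WeakHopfAlgebra k H] [BijectiveAntipode k H] {P : Type*} [AddCommGroup P] [Module k P]

local notation "δ" => Coalgebra.comul (R := k)
local notation "ε" => Coalgebra.counit (R := k)
local notation "T" => antipodeInv k H

section

variable (M N : YDMod.{u, v, w} k H)

local notation "D" => diagCoact (YDMod.coact M) (YDMod.coact N)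
local notation "τ" => tensorCoact (YDMod.coact M) (YDMod.coact N)

theorem tensorCoact_eq_sm (x : tensor M.toAlgMod N.toAlgMod) :
    τ x = sm (D (incl _ _ x)) fun w y => proj _ _ w ⊗ₜ[k] y := by
  change (proj M.toAlgMod N.toAlgMod).rTensor H (D (incl _ _ x)) = _
  conv_lhs => rw [← sm_tmul_eq (D (incl _ _ x))]
  exact map_sm _ _ _

theorem tensorCoact_proj (x : M.toAlgMod ⊗[k] N.toAlgMod) :
    τ (proj _ _ x) = sm (D x) fun w y => proj _ _ w ⊗ₜ[k] y := by
  rw [tensorCoact_eq_sm, incl_proj, diagCoact_act_one]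

theorem tensorCoact_tm (m : M.toAlgMod) (n : N.toAlgMod) :
    τ (tm m n) = sm (M.coact m) fun m₀ m₁ => sm (N.coact n) fun n₀ n₁ =>
      tm m₀ n₀ ⊗ₜ[k] (n₁ * m₁) := by
  rw [tm, tensorCoact_proj, sm_diagCoact_tmul] <;> try fun_prop
  rfl

theorem rTensor_incl_tensorCoact (x : tensor M.toAlgMod N.toAlgMod) :
    (incl M.toAlgMod N.toAlgMod).rTensor H (τ x) = D (incl _ _ x) := by
  rw [tensorCoact_eq_sm, Sweedler.map_sm]
  simp only [LinearMap.rTensor_tmul, incl_proj]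
  rw [sm_diagCoact_act_one M N _ (F := fun w y => w ⊗ₜ[k] y), sm_tmul_eq] <;> fun_prop

/-- Every axiom descends from the diagonal coaction along the surjection `proj`. Only equivariance
has to be verified in place of the two Yetter-Drinfeld conditions. -/
theorem isYetterDrinfeld_tensor : IsYetterDrinfeld (tensor M.toAlgMod N.toAlgMod) τ := by
  refine isYetterDrinfeld_of_equivariant (fun x => ?_) (fun x => ?_) (fun l x => ?_)
  · obtain ⟨x, rfl⟩ := proj_surjective _ _ x
    rw [tensorCoact_proj]
    simp only [Sweedler.map_sm, LinearMap.rTensor_tmul, LinearMap.lTensor_tmul, tensorCoact_proj]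
    calc _ = sm (D x) fun w y => sm (D w) fun w' y' =>
          proj M.toAlgMod N.toAlgMod w' ⊗ₜ[k] (y' ⊗ₜ[k] y) := by
          refine sm_congr fun w y => ?_
          rw [(by fun_prop : Lin k fun s : tensor M.toAlgMod N.toAlgMod ⊗[k] H =>
            TensorProduct.assoc k _ H H (s ⊗ₜ[k] y)).map_sm]
          rfl
      _ = _ := by
          rw [sm_coaction_coassoc (diagCoact_coassoc M N x) (F := fun w y' y =>
            proj M.toAlgMod N.toAlgMod w ⊗ₜ[k] (y' ⊗ₜ[k] y))] <;> try fun_prop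
          refine sm_congr fun w y => ?_
          rw [← (by fun_prop : Lin k fun s : H ⊗[k] H =>
            proj M.toAlgMod N.toAlgMod w ⊗ₜ[k] s).map_sm, sm_tmul_eq]
  · rw [tensorCoact_eq_sm]
    simp only [Sweedler.map_sm, LinearMap.lTensor_tmul, TensorProduct.rid_tmul]
    simp only [← map_smul]
    rw [← Sweedler.map_sm, sm_counit_diagCoact, ← incl_proj, proj_incl, proj_incl]
  · obtain ⟨x, rfl⟩ := proj_surjective _ _ x
    rw [← proj_act, tensorCoact_proj, diagCoact_act, tensorCoact_proj]
    simp (disch := fun_prop) only [sm_sm, sm_tmul, proj_act]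

/-- The tensor product of Yetter-Drinfeld modules. -/
noncomputable abbrev tensorObj : YDMod.{u, v, w} k H := ⟨_, _, isYetterDrinfeld_tensor M N⟩

end

/-- On the generators both sides have the coefficient p₍₁₎n₍₁₎m₍₁₎, bracketed differently. -/
theorem isColinear_assocIso (M N Q : YDMod.{u, v, w} k H) :
    IsColinear (tensorCoact (tensorCoact M.coact N.coact) Q.coact)
      (tensorCoact M.coact (tensorCoact N.coact Q.coact))
      (assocIso M.toAlgMod N.toAlgMod Q.toAlgMod).hom := by
  have h := tensor_ext₃ (M := M.toAlgMod) (N := N.toAlgMod) (P := Q.toAlgMod)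
    (f := (tensorCoact M.coact (tensorCoact N.coact Q.coact) ∘ₗ
      AlgMod.Hom.lin (assocIso M.toAlgMod N.toAlgMod Q.toAlgMod).hom).toAddMonoidHom)
    (g := ((AlgMod.Hom.lin (assocIso M.toAlgMod N.toAlgMod Q.toAlgMod).hom).rTensor H ∘ₗ
      tensorCoact (tensorCoact M.coact N.coact) Q.coact).toAddMonoidHom) (fun m n p => ?_)
  · exact DFunLike.congr_fun h
  · change tensorCoact M.coact (tensorObj N Q).coact ((assocIso _ _ _).hom.hom (tm (tm m n) p)) =
      (AlgMod.Hom.lin (assocIso M.toAlgMod N.toAlgMod Q.toAlgMod).hom).rTensor H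
        (tensorCoact (tensorObj M N).coact Q.coact (tm (tm m n) p))
    rw [assocIso_tm]
    refine (tensorCoact_tm M (tensorObj N Q) m (tm n p)).trans ?_
    refine Eq.trans ?_ (congrArg _ (tensorCoact_tm (tensorObj M N) Q (tm m n) p).symm)
    refine (sm_congr fun m₀ m₁ => congrArg (fun t => sm t fun n₀ n₁ =>
      (tm m₀ n₀ : tensor M.toAlgMod (tensorObj N Q).toAlgMod) ⊗ₜ[k] (n₁ * m₁))
      (tensorCoact_tm N Q n p)).trans ?_
    refine Eq.trans ?_ (congrArg (fun t => (AlgMod.Hom.lin (assocIso M.toAlgMod N.toAlgMod Q.toAlgMod).hom).rTensor H (sm t fun m₀ m₁ => sm (Q.coact p) fun n₀ n₁ =>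
      (tm m₀ n₀ : tensor (tensorObj M N).toAlgMod Q.toAlgMod) ⊗ₜ[k] (n₁ * m₁)))
      (tensorCoact_tm M N m n)).symm
    simp (disch := fun_prop) only [sm_sm, sm_tmul, Sweedler.map_sm, LinearMap.rTensor_tmul,
      AlgMod.Hom.lin_apply]
    refine sm_congr fun m₀ m₁ => sm_congr fun n₀ n₁ => sm_congr fun p₀ p₁ => ?_
    rw [mul_assoc]
    congr 1
    exact (assocIso_tm _ _ _ _ _ _).symm

end TensorYD

/-! ### The unit object H_t and the unit constraints. -/

section Unit

variable {k : Type u} {H : Type v} [CommRing k] [Ring H] [Algebra k H] [Coalgebra k H]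
  [WeakHopfAlgebra k H] [BijectiveAntipode k H] {P : Type*} [AddCommGroup P] [Module k P]

local notation "δ" => Coalgebra.comul (R := k)
local notation "ε" => Coalgebra.counit (R := k)
local notation "T" => antipodeInv k H

theorem isTarget_unitIncl (z : AlgMod.unit k H) : IsTarget k (unitIncl z) := by
  rw [← epsT_unitIncl]; exact isTarget_epsT _

theorem unitProj_unitIncl (z : AlgMod.unit k H) : unitProj (unitIncl z) = z :=
  unitIncl_injective (epsT_unitIncl z)

theorem smul_unitProj (a b : H) : a • unitProj (k := k) b = unitProj (a * b) :=
  unitIncl_injective (by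
    rw [unitIncl_smul, unitIncl_unitProj, unitIncl_unitProj, epsT_mul_epsT])

/-- As Δ(z) = 1₍₁₎z ⊗ 1₍₂₎, its second leg already lies in the target space. Hence z₍₂₎ ⊗ T(z₍₁₎)
lies in H_t ⊗ H. -/
theorem _root_.WeakBialgebra.IsTarget.sm_epsT {z : H} (hz : IsTarget k z) {F : H → H → P}
    (h₁ : ∀ b, Lin k fun a => F a b) (h₂ : ∀ a, Lin k fun b => F a b) :
    (sm (δ z) fun a b => F a (epsT k H b)) = sm (δ z) F := by
  rw [hz.sm, hz.sm, sm_one_right (F := fun a b => F (a * z) b)] <;> fun_prop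

theorem unitCoactAux_eq_sm (z : AlgMod.unit k H) :
    unitCoactAux k H z = sm (δ (unitIncl z)) fun a b => b ⊗ₜ[k] T a := by
  change TensorProduct.comm k H H ((antipodeInv k H).rTensor H (δ (unitIncl z))) = _
  conv_lhs => rw [← sm_tmul_eq (δ (unitIncl z))]
  rw [Sweedler.map_sm, Sweedler.map_sm]
  rfl

theorem unitCoact_eq_sm (z : AlgMod.unit k H) :
    unitCoact k H z = sm (δ (unitIncl z)) fun a b => unitProj b ⊗ₜ[k] T a := by
  change unitProj.rTensor H (unitCoactAux k H z) = _
  rw [unitCoactAux_eq_sm, Sweedler.map_sm]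
  rfl

theorem rTensor_unitIncl_unitCoact (z : AlgMod.unit k H) :
    unitIncl.rTensor H (unitCoact k H z) = unitCoactAux k H z := by
  rw [unitCoact_eq_sm, unitCoactAux_eq_sm, Sweedler.map_sm,
    ← (isTarget_unitIncl z).sm_epsT (F := fun a b => b ⊗ₜ[k] T a)] <;> try fun_prop
  rfl

/-- Coassociativity and counit come from those of H, as T reverses the coproduct and preserves ε.
For equivariance the legs of l and z combine to Δ²(lz). Applying ε_t to the middle leg produces Δ(1)
and a factor q T(a) with sum T(ε_t(lz)), which is the coaction of l ⇀ z. -/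
theorem isYetterDrinfeld_unit : IsYetterDrinfeld (AlgMod.unit k H) (unitCoact k H) := by
  refine isYetterDrinfeld_of_equivariant (fun z => ?_) (fun z => ?_) (fun l z => ?_)
  · rw [unitCoact_eq_sm]
    simp only [Sweedler.map_sm, LinearMap.rTensor_tmul, LinearMap.lTensor_tmul, unitCoact_eq_sm,
      unitIncl_unitProj]
    calc _ = sm (δ (unitIncl z)) fun a b => sm (δ (epsT k H b)) fun c d =>
          unitProj (k := k) d ⊗ₜ[k] (T c ⊗ₜ[k] T a) := by
          refine sm_congr fun a b => ?_
          rw [(by fun_prop : Lin k fun s : AlgMod.unit k H ⊗[k] H =>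
            TensorProduct.assoc k _ H H (s ⊗ₜ[k] T a)).map_sm]
          rfl
      _ = sm (δ (unitIncl z)) fun a b => sm (δ b) fun c d =>
          unitProj (k := k) d ⊗ₜ[k] (T c ⊗ₜ[k] T a) := by
          rw [(isTarget_unitIncl z).sm_epsT (F := fun a b => sm (δ b) fun c d =>
            unitProj (k := k) d ⊗ₜ[k] (T c ⊗ₜ[k] T a))] <;> fun_prop
      _ = _ := by
          rw [← sm_coassoc (unitIncl z) (F := fun a c d =>
            unitProj (k := k) d ⊗ₜ[k] (T c ⊗ₜ[k] T a))] <;> try fun_prop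
          refine sm_congr fun a b => ?_
          conv_rhs => rw [← sm_tmul_eq (δ (T a)), sm_comul_antipodeInv a (by fun_prop) (by fun_prop)]
          rw [(by fun_prop : Lin k fun s : H ⊗[k] H => unitProj (k := k) b ⊗ₜ[k] s).map_sm]
  · rw [unitCoact_eq_sm]
    simp only [Sweedler.map_sm, LinearMap.lTensor_tmul, TensorProduct.rid_tmul,
      counit_antipodeInv]
    rw [sm_counit_left (F := fun b => unitProj (k := k) b) _ (by fun_prop), unitProj_unitIncl]
  · have hz := isTarget_unitIncl z
    have hw := isTarget_epsT (k := k) (l * unitIncl z)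
    symm
    calc _ = sm (δ l) fun a b => sm (δ b) fun c d => sm (δ (unitIncl z)) fun e f =>
          unitProj (k := k) (c * f) ⊗ₜ[k] (d * T (a * e)) := by
          rw [unitCoact_eq_sm]
          simp (disch := fun_prop) only [sm_sm, sm_tmul, smul_unitProj, antipodeInv_mul]
      _ = sm (δ (l * unitIncl z)) fun r d => sm (δ r) fun a c =>
          unitProj (k := k) c ⊗ₜ[k] (d * T a) := by
          rw [← sm_coassoc l (F := fun a c d => sm (δ (unitIncl z)) fun e f =>
            unitProj (k := k) (c * f) ⊗ₜ[k] (d * T (a * e))), hz.sm_mul] <;> try fun_prop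
          refine sm_congr fun r d => ?_
          rw [sm_comul_mul] <;> fun_prop
      _ = sm (δ (l * unitIncl z)) fun a q => sm (δ q) fun c d =>
          unitProj (k := k) (epsT k H c) ⊗ₜ[k] (d * T a) := by
          rw [sm_coassoc (l * unitIncl z) (F := fun a c d => unitProj (k := k) c ⊗ₜ[k] (d * T a))]
            <;> try fun_prop
          refine sm_congr fun a q => sm_congr fun c d => ?_
          congr 1
          exact unitIncl_injective (epsT_epsT c).symm
      _ = sm (δ (1 : H)) fun c d => sm (δ (l * unitIncl z)) fun a q =>
          unitProj (k := k) d ⊗ₜ[k] (epsTBar k H c * (q * T a)) := by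
          rw [sm_comm]
          refine sm_congr fun a q => ?_
          rw [sm_epsT_left q (F := fun c d => unitProj (k := k) c ⊗ₜ[k] (d * T a))] <;> try fun_prop
          simp only [mul_assoc]
      _ = sm (δ (1 : H)) fun c d =>
          unitProj (k := k) d ⊗ₜ[k] T (epsT k H (l * unitIncl z) * c) := by
          refine sm_one_congr (by fun_prop) (by fun_prop) (by fun_prop) (by fun_prop)
            fun c d hc hd => ?_
          rw [sm_mul_antipodeInv (l * unitIncl z) (F := fun y =>
            unitProj (k := k) d ⊗ₜ[k] (epsTBar k H c * y)) (by fun_prop), hc.epsTBar_eq,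
            antipodeInv_mul]
      _ = _ := by
          rw [unitCoact_eq_sm, unitIncl_smul, hw.sm'] <;> fun_prop

variable (k H) in
/-- The unit Yetter-Drinfeld module `H_t`. -/
noncomputable abbrev unitObj : YDMod.{u, v, v} k H := ⟨_, _, isYetterDrinfeld_unit⟩

theorem isColinear_of_tm {M N Q : YDMod.{u, v, w} k H}
    (f : tensor M.toAlgMod N.toAlgMod ⟶ Q.toAlgMod)
    (h : ∀ m n, Q.coact (f.hom (tm m n)) = sm (M.coact m) fun m₀ m₁ => sm (N.coact n) fun n₀ n₁ =>
      f.hom (tm m₀ n₀) ⊗ₜ[k] (n₁ * m₁)) :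
    IsColinear (tensorCoact M.coact N.coact) Q.coact f := by
  have e := tensor_ext (f := (Q.coact ∘ₗ AlgMod.Hom.lin f).toAddMonoidHom)
    (g := ((AlgMod.Hom.lin f).rTensor H ∘ₗ tensorCoact M.coact N.coact).toAddMonoidHom) (fun m n => by
      change Q.coact (f.hom (tm m n)) = (AlgMod.Hom.lin f).rTensor H (tensorCoact M.coact N.coact (tm m n))
      rw [h, tensorCoact_tm]
      simp only [Sweedler.map_sm]
      rfl)
  exact DFunLike.congr_fun e

/-- The target leg of Δ(z) moves from m₍₀₎ to m₍₁₎ and cancels there by 1₍₂₎T(1₍₁₎) = 1. The result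
m₍₀₎ ⊗ m₍₁₎T(z) is ρ(z m). -/
theorem isColinear_leftUnitor (M : YDMod.{u, v, v} k H) :
    IsColinear (tensorCoact (unitCoact k H) M.coact) M.coact
      (MonoidalCategory.leftUnitor M.toAlgMod).hom := by
  refine isColinear_of_tm (M := unitObj k H) (N := M) (Q := M)
    (MonoidalCategory.leftUnitor M.toAlgMod).hom fun z m => ?_
  have hz := isTarget_unitIncl z
  have e : ∀ (z : AlgMod.unit k H) (m : M.toAlgMod),
      (MonoidalCategory.leftUnitor M.toAlgMod).hom.hom (tm z m) = unitIncl z • m :=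
    leftUnitorLin_tm M.toAlgMod
  refine (congrArg M.coact (e z m)).trans ?_
  refine Eq.trans ?_ (congrArg (fun t => sm t fun z₀ z₁ => sm (M.coact m) fun m₀ m₁ =>
    (MonoidalCategory.leftUnitor M.toAlgMod).hom.hom (tm z₀ m₀) ⊗ₜ[k] (m₁ * z₁))
    (unitCoact_eq_sm z)).symm
  simp (disch := fun_prop) only [e, sm_sm, sm_tmul, unitIncl_unitProj]
  rw [hz.sm_epsT (F := fun a b => sm (M.coact m) fun m₀ m₁ => (b • m₀) ⊗ₜ[k] (m₁ * T a)), hz.sm'] 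
    <;> try fun_prop
  symm
  calc _ = sm (δ (1 : H)) fun a b => sm (M.coact m) fun m₀ m₁ =>
        m₀ ⊗ₜ[k] (m₁ * (b * T a * T (unitIncl z))) := by
        refine sm_one_congr (by fun_prop) (by fun_prop) (by fun_prop) (by fun_prop)
          fun a b ha hb => ?_
        rw [sm_target_smul_coaction M.isYetterDrinfeld hb m (F := fun m₀ m₁ =>
          m₀ ⊗ₜ[k] (m₁ * T (unitIncl z * a)))] <;> try fun_prop
        simp only [antipodeInv_mul, mul_assoc]
    _ = _ := by
        rw [sm_mul_antipodeInv (1 : H) (F := fun y => sm (M.coact m) fun m₀ m₁ =>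
          m₀ ⊗ₜ[k] (m₁ * (y * T (unitIncl z)))) (by fun_prop), epsT_one, antipodeInv_one,
          ← sm_tmul_eq (M.coact (unitIncl z • m)),
          sm_coaction_target M.isYetterDrinfeld hz] <;> try fun_prop
        simp only [one_mul]

/-- On the target space ε̄_s = T. The flipped Δ(1) is absorbed by ρ(m), and T(z)m₍₁₎ is the
coefficient of ρ(T(z)m) because T(z) is a source element. -/
theorem isColinear_rightUnitor (M : YDMod.{u, v, v} k H) :
    IsColinear (tensorCoact M.coact (unitCoact k H)) M.coact
      (MonoidalCategory.rightUnitor M.toAlgMod).hom := by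
  refine isColinear_of_tm (M := M) (N := unitObj k H) (Q := M)
    (MonoidalCategory.rightUnitor M.toAlgMod).hom fun m z => ?_
  have hz := isTarget_unitIncl z
  have e : ∀ (m : M.toAlgMod) (z : AlgMod.unit k H),
      (MonoidalCategory.rightUnitor M.toAlgMod).hom.hom (tm m z) = epsSBar k H (unitIncl z) • m :=
    rightUnitorLin_tm M.toAlgMod
  refine (congrArg M.coact (e m z)).trans ?_
  refine Eq.trans ?_ (congrArg (fun t => sm (M.coact m) fun m₀ m₁ => sm t fun z₀ z₁ =>
    (MonoidalCategory.rightUnitor M.toAlgMod).hom.hom (tm m₀ z₀) ⊗ₜ[k] (z₁ * m₁))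
    (unitCoact_eq_sm z)).symm
  simp (disch := fun_prop) only [e, sm_sm, sm_tmul, unitIncl_unitProj, epsSBar_epsT]
  symm
  calc _ = sm (δ (1 : H)) fun a b => sm (M.coact m) fun m₀ m₁ =>
        (T b • m₀) ⊗ₜ[k] (T (unitIncl z) * (T a * m₁)) := by
        rw [sm_comm, hz.sm] <;> try fun_prop
        refine sm_one_congr (by fun_prop) (by fun_prop) (by fun_prop) (by fun_prop)
          fun a b ha hb => ?_
        simp only [antipodeInv_mul, hb.epsSBar_eq, mul_assoc]
    _ = sm (M.coact m) fun m₀ m₁ => m₀ ⊗ₜ[k] (T (unitIncl z) * m₁) := by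
        rw [sm_antipodeInv_one (F := fun a b => sm (M.coact m) fun m₀ m₁ =>
          (a • m₀) ⊗ₜ[k] (T (unitIncl z) * (b * m₁)))] <;> try fun_prop
        conv_rhs => rw [← act_one_coaction M.isYetterDrinfeld m]
        simp (disch := fun_prop) only [sm_sm, sm_tmul]
    _ = _ := by
        rw [hz.epsSBar_eq, ← sm_tmul_eq (M.coact (T (unitIncl z) • m)),
          sm_coaction_source M.isYetterDrinfeld hz.antipodeInv] <;> fun_prop

variable (k H) in
theorem tensorWellDefined : TensorWellDefined k H where
  incl_tensorCoact := rTensor_incl_tensorCoact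
  incl_tensorCoact_proj M N x := by
    rw [rTensor_incl_tensorCoact, incl_proj, diagCoact_act_one]
  tensor := isYetterDrinfeld_tensor
  incl_unitCoact := rTensor_unitIncl_unitCoact
  unit := isYetterDrinfeld_unit
  associator := isColinear_assocIso
  leftUnitor := isColinear_leftUnitor
  rightUnitor := isColinear_rightUnitor

end Unit

end YDMod

/-! ## Dual bases -/

namespace Sweedler

variable {k : Type u} [CommRing k]

theorem exists_dualBasis (H : Type*) [AddCommGroup H] [Module k H] [Module.Finite k H]
    [Module.Projective k H] : ∃ (n : ℕ) (e : Fin n → H) (e' : Fin n → Module.Dual k H),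
      ∀ x, ∑ i, e' i x • e i = x := by
  obtain ⟨n, f, g, -, -, h⟩ := Module.Finite.exists_comp_eq_id_of_projective k H
  refine ⟨n, fun i => f (Pi.single i 1), fun i => LinearMap.proj i ∘ₗ g, fun x => ?_⟩
  conv_rhs => rw [← LinearMap.id_apply (R := k) x, ← h, LinearMap.comp_apply,
    pi_eq_sum_univ' (g x), map_sum]
  refine Finset.sum_congr rfl fun i _ => ?_
  rw [LinearMap.comp_apply, LinearMap.proj_apply, ← map_smul]

variable {H : Type*} [AddCommGroup H] [Module k H] [Module.Finite k H] [Module.Projective k H]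
  {V : Type*} [AddCommGroup V] [Module k V]

/-- Elements of `V ⊗ H` are separated by the functionals on `H`. -/
theorem tensor_ext_dual {s t : V ⊗[k] H}
    (h : ∀ f : Module.Dual k H, (sm s fun v x => f x • v) = sm t fun v x => f x • v) : s = t := by
  obtain ⟨n, e, e', he⟩ := exists_dualBasis (k := k) H
  have key : ∀ s : V ⊗[k] H, s = ∑ i, (sm s fun v x => e' i x • v) ⊗ₜ[k] e i := by
    intro s
    conv_lhs => rw [← sm_tmul_eq s]
    simp_rw [fun i => ((by fun_prop : Lin k fun v : V => v ⊗ₜ[k] e i).map_sm s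
      (fun v x => e' i x • v))]
    conv_lhs => enter [2, v, x]; rw [← he x, tmul_sum]
    simp only [sm]
    rw [Finset.sum_comm]
    simp only [smul_tmul]
  rw [key s, key t]
  simp only [h]

theorem tensor_ext_dual₂ {s t : V ⊗[k] (H ⊗[k] H)}
    (h : ∀ f g : Module.Dual k H, (sm s fun v y => sm y fun a b => (f a * g b) • v) =
      sm t fun v y => sm y fun a b => (f a * g b) • v) : s = t := by
  have key : ∀ (f g : Module.Dual k H) (s : (V ⊗[k] H) ⊗[k] H),
      (sm (sm s fun u x => g x • u) fun v x => f x • v) =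
        sm (TensorProduct.assoc k V H H s) fun v y => sm y fun a b => (f a * g b) • v := by
    intro f g s
    have l : Lin k fun u : V ⊗[k] H => sm u fun v x => f x • v := by fun_prop
    rw [sm_assoc s (F := fun v a b => (f a * g b) • v), l.map_sm] <;> try fun_prop
    refine sm_congr fun u x => ?_
    rw [l.smul, smul_sm]
    exact sm_congr fun v y => by rw [smul_smul, mul_comm]
  refine (TensorProduct.assoc k V H H).symm.injective (tensor_ext_dual fun g =>
    tensor_ext_dual fun f => ?_)
  rw [key, key, LinearEquiv.apply_symm_apply, LinearEquiv.apply_symm_apply, h]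

/-- Elements of `H* ⊗ V` are separated by the elements of `H`. -/
theorem dual_tensor_ext {s t : Module.Dual k H ⊗[k] V}
    (h : ∀ x : H, (sm s fun f v => f x • v) = sm t fun f v => f x • v) : s = t := by
  obtain ⟨n, e, e', he⟩ := exists_dualBasis (k := k) H
  have he' : ∀ f : Module.Dual k H, f = ∑ i, f (e i) • e' i := by
    intro f
    ext x
    conv_lhs => rw [← he x, map_sum]
    simp [mul_comm]
  have key : ∀ s : Module.Dual k H ⊗[k] V, s = ∑ i, e' i ⊗ₜ[k] (sm s fun f v => f (e i) • v) := by
    intro s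
    conv_lhs => rw [← sm_tmul_eq s]
    simp_rw [fun i => ((by fun_prop : Lin k fun v : V => e' i ⊗ₜ[k] v).map_sm s
      (fun f v => f (e i) • v))]
    conv_lhs => enter [2, f, v]; rw [he' f, sum_tmul]
    simp only [sm]
    rw [Finset.sum_comm]
    simp only [smul_tmul]
  rw [key s, key t]
  simp only [h]

end Sweedler

/-! ## The algebra structure of the Drinfeld double -/

namespace Drinfeld

open Sweedler WeakBialgebra WeakHopfAlgebra AlgMod YDMod

section DoubleAlgebra

variable {k H : Type u} [CommRing k] [Ring H] [Algebra k H] [Coalgebra k H]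
  [WeakHopfAlgebra k H] [BijectiveAntipode k H]

local notation "δ" => Coalgebra.comul (R := k)
local notation "ε" => Coalgebra.counit (R := k)
local notation "T" => antipodeInv k H
local notation "DH" => Double (smashWellDefined k H)
local notation "mk" => doubleMk (smashWellDefined k H)

theorem doubleMk_preunit_smashMul (x : Smash k H) : mk (smashMul k H (preunit k H ⊗ₜ x)) = mk x := by
  rw [← doubleMk_mul, doubleMk_preunit, one_mul]

/-- The product is left H-linear in its first factor, and by `smashMul_dualMulRight` right H*-linear
in its second. With the commutation of e this yields all product formulas in the double. -/
theorem mulLeft_smashMul (h : H) (f : Module.Dual k H) (x : Smash k H) :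
    smashMul k H ((h ⊗ₜ f) ⊗ₜ x) =
      (LinearMap.mulLeft k h).rTensor _ (smashMul k H ((1 ⊗ₜ f) ⊗ₜ x)) := by
  refine lin_ext (k := k) (f := fun x => smashMul k H ((h ⊗ₜ f) ⊗ₜ x))
    (g := fun x => (LinearMap.mulLeft k h).rTensor _ (smashMul k H ((1 ⊗ₜ f) ⊗ₜ x)))
    (by fun_prop) (by fun_prop) (fun l g => ?_) x
  simp only [smashMul_tmul, Sweedler.map_sm, LinearMap.rTensor_tmul, LinearMap.mulLeft_apply,
    one_mul]

/-- Convolution by `g` on the right. -/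
noncomputable def dualMulRight (g : Module.Dual k H) : Module.Dual k H →ₗ[k] Module.Dual k H :=
  dualMul k H ∘ₗ (TensorProduct.mk k _ _).flip g

theorem dualMulRight_apply (f g : Module.Dual k H) : dualMulRight g f = dualMul k H (f ⊗ₜ g) := rfl

theorem smashMul_dualMulRight (x : Smash k H) (l : H) (f g : Module.Dual k H) :
    smashMul k H (x ⊗ₜ (l ⊗ₜ dualMul k H (f ⊗ₜ g))) =
      (dualMulRight g).lTensor H (smashMul k H (x ⊗ₜ (l ⊗ₜ f))) := by
  refine lin_ext (k := k) (f := fun x => smashMul k H (x ⊗ₜ (l ⊗ₜ dualMul k H (f ⊗ₜ g))))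
    (g := fun x => (dualMulRight g).lTensor H (smashMul k H (x ⊗ₜ (l ⊗ₜ f))))
    (by fun_prop) (by fun_prop) (fun h f' => ?_) x
  simp only [smashMul_tmul, Sweedler.map_sm, LinearMap.lTensor_tmul, dualMulRight_apply,
    dualMul_assoc]

theorem smashMul_tmul_preunit_left (h : H) (x : Smash k H) :
    smashMul k H ((h ⊗ₜ Coalgebra.counit) ⊗ₜ x) =
      (LinearMap.mulLeft k h).rTensor _ (smashMul k H (preunit k H ⊗ₜ x)) :=
  mulLeft_smashMul h _ x

/-- (h ⋈ ε)(1 ⋈ f) is h applied to e(1 ⋈ f) = (1 ⋈ f)e, that is (h ⋈ f)e. Since e becomes 1 in the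
quotient, the double is generated by H and H*. -/
theorem doubleMk_tmul (h : H) (f : Module.Dual k H) :
    mk (h ⊗ₜ Coalgebra.counit) * mk (1 ⊗ₜ f) = mk (h ⊗ₜ f) := by
  rw [doubleMk_mul, smashMul_tmul_preunit_left, preunit_comm, ← mulLeft_smashMul, ← preunit_comm,
    doubleMk_preunit_smashMul]

theorem doubleMk_mul_counit (h l : H) :
    mk (h ⊗ₜ Coalgebra.counit) * mk (l ⊗ₜ Coalgebra.counit) = mk ((h * l) ⊗ₜ Coalgebra.counit) := by
  rw [doubleMk_mul, smashMul_tmul_preunit_left, preunit_comm, mulLeft_smashMul,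
    ← LinearMap.rTensor_comp_apply, ← LinearMap.mulLeft_mul, ← mulLeft_smashMul,
    ← preunit_comm, doubleMk_preunit_smashMul]

theorem doubleMk_mul_dual (f g : Module.Dual k H) :
    mk (1 ⊗ₜ f) * mk (1 ⊗ₜ g) = mk (1 ⊗ₜ dualMul k H (f ⊗ₜ g)) := by
  have e : (1 : H) ⊗ₜ[k] g = 1 ⊗ₜ dualMul k H (Coalgebra.counit ⊗ₜ g) := by rw [counit_dualMul]
  rw [doubleMk_mul, e, smashMul_dualMulRight]
  change mk (LinearMap.lTensor H (dualMulRight g) (smashMul k H ((1 ⊗ₜ f) ⊗ₜ preunit k H))) = _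
  rw [← preunit_comm, ← smashMul_dualMulRight, doubleMk_preunit_smashMul]

/-- The commutation rule between H* and H; on a module it becomes the equivariance of the coaction.
-/
theorem doubleMk_dual_mul (f : Module.Dual k H) (l : H) :
    mk (1 ⊗ₜ f) * mk (l ⊗ₜ Coalgebra.counit) =
      sm (δ l) fun a b => sm (δ b) fun c d => mk (c ⊗ₜ hit f (T a) d) := by
  rw [doubleMk_mul, smashMul_tmul]
  simp only [Sweedler.map_sm, one_mul, dualMul_counit]

variable (k H) in
/-- The algebra map `h ↦ [h ⋈ ε]` from `H` to its double. -/
noncomputable def doubleIncl : H →ₐ[k] DH :=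
  AlgHom.ofLinearMap (mk ∘ₗ (TensorProduct.mk k H (Module.Dual k H)).flip Coalgebra.counit) rfl
    fun h l => (doubleMk_mul_counit h l).symm

theorem doubleIncl_apply (h : H) : doubleIncl k H h = mk (h ⊗ₜ Coalgebra.counit) := rfl

variable (k H) in
/-- The map `f ↦ [1 ⋈ f]` from the dual of `H` to the double. -/
noncomputable def doubleDual : Module.Dual k H →ₗ[k] DH :=
  mk ∘ₗ TensorProduct.mk k H (Module.Dual k H) 1

theorem doubleDual_apply (f : Module.Dual k H) : doubleDual k H f = mk (1 ⊗ₜ f) := rfl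

end DoubleAlgebra

/-! ## The inverse functor -/

section Inverse

variable {k H : Type u} [CommRing k] [Ring H] [Algebra k H] [Coalgebra k H]
  [WeakHopfAlgebra k H] [BijectiveAntipode k H] [Module.Finite k H] [Module.Projective k H]

local notation "δ" => Coalgebra.comul (R := k)
local notation "ε" => Coalgebra.counit (R := k)
local notation "T" => antipodeInv k H
local notation "DH" => Double (smashWellDefined k H)
local notation "mk" => doubleMk (smashWellDefined k H)

/-- A module over the double as an `H`-module. -/
@[reducible] noncomputable def restrictModule (M : AlgMod.{u, u, w} k DH) : Module H M :=
  Module.compHom M (doubleIncl k H).toRingHom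

/-- Restriction of scalars along `H → D(H)`. -/
noncomputable abbrev restrict (M : AlgMod.{u, u, w} k DH) : AlgMod.{u, u, w} k H :=
  letI := restrictModule M
  { carrier := M
    isScalarTower := ⟨fun c h m => by
      change doubleIncl k H (c • h) • m = c • (doubleIncl k H h • m)
      rw [map_smul, smul_assoc]⟩ }

theorem exists_coaction (M : AlgMod.{u, u, w} k DH) :
    ∃ ρ : M →ₗ[k] M ⊗[k] H, ∀ (m : M) (f : Module.Dual k H),
      (sm (ρ m) fun w x => f x • w) = doubleDual k H f • m := by
  obtain ⟨n, e, e', he⟩ := exists_dualBasis (k := k) H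
  -- The formula ρ(m) = ∑ [1 ⋈ eⁱ]m ⊗ eᵢ is forced, because f = ∑ f(eᵢ)eⁱ for every functional f.
  refine ⟨∑ i, (TensorProduct.mk k M H).flip (e i) ∘ₗ
    Algebra.lsmul k k M (doubleDual k H (e' i)), fun m f => ?_⟩
  have hf : f = ∑ i, f (e i) • e' i := by
    ext x
    conv_lhs => rw [← he x, map_sum]
    simp [mul_comm]
  have l : Lin k fun s : M ⊗[k] H => sm s fun w x => f x • w := by fun_prop
  rw [LinearMap.sum_apply]
  refine (map_sum l.toLin _ _).trans ?_
  conv_rhs => rw [hf, map_sum, Finset.sum_smul]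
  refine Finset.sum_congr rfl fun i _ => ?_
  rw [map_smul, smul_assoc]
  exact sm_tmul _ _ (F := fun w x => f x • w) (by fun_prop) (by fun_prop)

/-- The coaction of `H` on a module over the double. -/
noncomputable def doubleCoact (M : AlgMod.{u, u, w} k DH) : restrict M →ₗ[k] restrict M ⊗[k] H :=
  (exists_coaction M).choose

theorem sm_doubleCoact (M : AlgMod.{u, u, w} k DH) (m : restrict M) (f : Module.Dual k H) :
    (sm (doubleCoact M m) fun w x => f x • w) = (doubleDual k H f • (show M from m) : M) :=
  (exists_coaction M).choose_spec m f

/-- Tested on functionals, coassociativity is `doubleMk_mul_dual`, the counit law is [1 ⋈ ε] = 1,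
and equivariance is `doubleMk_dual_mul`. -/
theorem isYetterDrinfeld_doubleCoact (M : AlgMod.{u, u, w} k DH) :
    IsYetterDrinfeld (restrict M) (doubleCoact M) := by
  refine isYetterDrinfeld_of_equivariant (fun m => ?_) (fun m => ?_) (fun l m => ?_)
  · refine tensor_ext_dual₂ fun f g => ?_
    rw [sm_assoc _ (F := fun v a b => (f a * g b) • v), sm_rTensor, sm_lTensor] <;> try fun_prop
    calc _ = sm (doubleCoact M m) fun w x => g x •
          (doubleDual k H f • (show M from w) : M) := by
          refine sm_congr fun w x => ?_
          rw [← sm_doubleCoact, smul_sm]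
          exact sm_congr fun w' y => by rw [smul_smul, mul_comm]
      _ = (doubleDual k H f • (show M from doubleDual k H g • (show M from m)) : M) := by
          rw [← sm_doubleCoact M m g,
            ((by fun_prop : Lin k fun s : M => doubleDual k H f • s)).map_sm]
          exact sm_congr fun w x => (((by fun_prop : Lin k fun s : M =>
            doubleDual k H f • s)).smul _ _).symm
      _ = _ := by
          rw [← mul_smul, doubleDual_apply, doubleDual_apply, doubleMk_mul_dual, ← doubleDual_apply,
            ← sm_doubleCoact M m]
          refine sm_congr fun w x => ?_
          rw [dualMul_apply, (by fun_prop : Lin k fun r : k => r • w).map_sm]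
  · conv_lhs => rw [← sm_tmul_eq (doubleCoact M m)]
    simp only [Sweedler.map_sm, LinearMap.lTensor_tmul, TensorProduct.rid_tmul]
    exact (sm_doubleCoact M m Coalgebra.counit).trans (one_smul DH (show M from m))
  · refine tensor_ext_dual fun f => ?_
    simp (disch := fun_prop) only [sm_sm, sm_tmul]
    rw [sm_doubleCoact]
    change doubleDual k H f • (doubleIncl k H l • (show M from m)) = _
    rw [← mul_smul, doubleDual_apply, doubleIncl_apply, doubleMk_dual_mul,
      (by fun_prop : Lin k fun d : DH => d • (show M from m)).map_sm]
    refine sm_congr fun a b => ?_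
    rw [(by fun_prop : Lin k fun d : DH => d • (show M from m)).map_sm]
    refine sm_congr fun c d => ?_
    rw [← doubleMk_tmul, mul_smul, ← doubleDual_apply, ← sm_doubleCoact M m, ← doubleIncl_apply,
      (by fun_prop : Lin k fun s : M => doubleIncl k H c • s).map_sm]
    exact sm_congr fun w x => (by fun_prop : Lin k fun s : M => doubleIncl k H c • s).smul _ _

/-- A module over the double as a Yetter-Drinfeld module. -/
noncomputable abbrev inverseObj (M : AlgMod.{u, u, w} k DH) : YDMod.{u, u, w} k H :=
  ⟨restrict M, doubleCoact M, isYetterDrinfeld_doubleCoact M⟩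

theorem smashAction_inverseObj (M : AlgMod.{u, u, w} k DH) (x : Smash k H)
    (m : (inverseObj M).toAlgMod) :
    smashAction (inverseObj M) x m = (mk x • (show M from m) : M) := by
  refine lin_ext (k := k) (f := fun x => smashAction (inverseObj M) x m)
    (g := fun x => (mk x • (show M from m) : M)) (by fun_prop) (by fun_prop) (fun h f => ?_) x
  rw [smashAction_eq_sm]
  refine (congrArg (fun t : (restrict M).carrier => h • t) (sm_doubleCoact M m f)).trans ?_
  rw [← doubleMk_tmul, mul_smul]
  rfl

theorem smashAction_tmul_counit (M : YDMod.{u, u, w} k H) (h : H) (m : M.toAlgMod) :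
    smashAction M (h ⊗ₜ Coalgebra.counit) m = h • m := by
  rw [smashAction_eq_sm, sm_counit_coaction M.isYetterDrinfeld]

theorem smashAction_one_tmul (M : YDMod.{u, u, w} k H) (f : Module.Dual k H) (m : M.toAlgMod) :
    smashAction M (1 ⊗ₜ f) m = sm (M.coact m) fun w x => f x • w := by
  rw [smashAction_eq_sm, one_smul]

/-- The functor from modules over the double to Yetter-Drinfeld modules. -/
noncomputable def inverseFunctor : AlgMod.{u, u, w} k DH ⥤ YDMod.{u, u, w} k H where
  obj M := inverseObj M
  map {M N} f :=
    { lin := ⟨{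
        toFun := fun m => f.hom m
        map_add' := fun m n => map_add f.hom m n
        map_smul' := fun h m => map_smul f.hom (doubleIncl k H h) m }⟩
      colinear := fun m => by
        refine tensor_ext_dual fun g => ?_
        rw [sm_rTensor] <;> try fun_prop
        refine (sm_doubleCoact N (f.hom m) g).trans ?_
        refine (map_smul f.hom (doubleDual k H g) m).symm.trans ?_
        refine (congrArg f.hom (sm_doubleCoact M m g).symm).trans ?_
        refine ((lin_coe (AlgMod.Hom.lin f)).map_sm _ _).trans ?_
        exact sm_congr fun w x => map_smul (AlgMod.Hom.lin f) (g x) w }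

theorem _root_.AlgMod.eqToHom_hom {A : Type u} [Ring A] [Algebra k A] {M N : AlgMod.{u, u, w} k A}
    (h : M = N) (x : M) : (eqToHom h).hom x = cast (congrArg AlgMod.carrier h) x := by
  subst h; rfl

/-- A strict inverse needs equality of objects. The round trips keep the carrier and its k-module
structure, so agreement of the actions suffices; `YDMod.mk_eq` adds the coaction. -/
theorem _root_.AlgMod.mk_eq {A : Type u} [Ring A] [Algebra k A] (M : AlgMod.{u, u, w} k A)
    (inst : Module A M) (i : @IsScalarTower k A M _ inst.toSMul _)
    (h : ∀ (a : A) (m : M), inst.smul a m = M.module.smul a m) :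
    ({ carrier := M, module := inst, isScalarTower := i } : AlgMod.{u, u, w} k A) = M := by
  obtain rfl : inst = M.module := Module.ext' _ _ h
  rfl

theorem _root_.YDMod.mk_eq (M : YDMod.{u, u, w} k H) (inst : Module H M.toAlgMod)
    (i : @IsScalarTower k H M.toAlgMod _ inst.toSMul _)
    (ρ : M.toAlgMod →ₗ[k] M.toAlgMod ⊗[k] H)
    (hρ : IsYetterDrinfeld
      ({ carrier := M.toAlgMod, module := inst, isScalarTower := i } : AlgMod.{u, u, w} k H) ρ)
    (h : ∀ (a : H) (m : M.toAlgMod), inst.smul a m = M.toAlgMod.module.smul a m) (h' : ρ = M.coact) :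
    (⟨{ carrier := M.toAlgMod, module := inst, isScalarTower := i }, ρ, hρ⟩ :
      YDMod.{u, u, w} k H) = M := by
  obtain rfl : inst = M.toAlgMod.module := Module.ext' _ _ h
  subst h'
  rfl

theorem _root_.YDMod.eqToHom_hom {M N : YDMod.{u, u, w} k H} (h : M = N) (x : M.toAlgMod) :
    (eqToHom h).lin.hom x = cast (congrArg (fun M : YDMod.{u, u, w} k H => M.toAlgMod.carrier) h) x := by
  subst h; rfl

theorem doubleObj_inverseObj (M : AlgMod.{u, u, w} k DH) :
    doubleObj (smashWellDefined k H) (actionWellDefined k H) (inverseObj M) = M :=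
  AlgMod.mk_eq M _ _ fun a m => by
    obtain ⟨x, rfl⟩ := doubleMk₀_surjective _ a
    exact smashAction_inverseObj M x m

/-- The H-action is recovered from [h ⋈ ε]. The coaction is recovered from the operators [1 ⋈ f],
since functionals separate M ⊗ H. -/
theorem inverseObj_doubleObj (M : YDMod.{u, u, w} k H) :
    inverseObj (doubleObj (smashWellDefined k H) (actionWellDefined k H) M) = M := by
  refine YDMod.mk_eq M _ _ _ _ (fun a m => smashAction_tmul_counit M a m) (LinearMap.ext fun m =>
    tensor_ext_dual fun f => ?_)
  refine (sm_doubleCoact (doubleObj (smashWellDefined k H) (actionWellDefined k H) M) m f).trans ?_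
  exact smashAction_one_tmul M f m

theorem isIsomorphismOfCategories_doubleFunctor :
    IsIsomorphismOfCategories
      (doubleFunctor (smashWellDefined k H) (actionWellDefined.{u, u, w} k H)) := by
  refine ⟨inverseFunctor, CategoryTheory.Functor.ext (fun M => inverseObj_doubleObj M)
    fun M N f => ?_, CategoryTheory.Functor.ext (fun M => doubleObj_inverseObj M) fun M N f => ?_⟩
  · refine YDMod.hom_ext (AlgMod.hom_ext fun x => ?_)
    -- Both transports are casts between definitionally equal carriers, so they vanish and the maps
    -- agree.
    change f.lin.hom x = (eqToHom (inverseObj_doubleObj N).symm).lin.hom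
      (f.lin.hom ((eqToHom (inverseObj_doubleObj M)).lin.hom x))
    exact ((YDMod.eqToHom_hom (inverseObj_doubleObj N).symm _).trans
      (congrArg f.lin.hom (YDMod.eqToHom_hom (inverseObj_doubleObj M) x))).symm
  · refine AlgMod.hom_ext fun x => ?_
    change f.hom x = (eqToHom (doubleObj_inverseObj N).symm).hom
      (f.hom ((eqToHom (doubleObj_inverseObj M)).hom x))
    exact ((AlgMod.eqToHom_hom (doubleObj_inverseObj N).symm _).trans
      (congrArg f.hom (AlgMod.eqToHom_hom (doubleObj_inverseObj M) x))).symm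

end Inverse

end Drinfeld

/-! ## The weak bialgebra structure of the Drinfeld double -/

namespace Drinfeld

open Sweedler WeakBialgebra WeakHopfAlgebra AlgMod YDMod

/-! ### Coassociativity of the comultiplication of H*. -/

section DualComul

variable {k : Type u} {H : Type v} [CommRing k] [Ring H] [Algebra k H] [Coalgebra k H]
  [Module.Finite k H] [Module.Projective k H]
  {U : Type*} [AddCommGroup U] [Module k U] {P : Type*} [AddCommGroup P] [Module k P]

theorem sm_dualComul (f : Module.Dual k H) (x y : H) :
    (sm (dualComul k H f) fun g h => g x * h y) = f (x * y) := by
  rw [← dualDistrib_dualComul k H f x y]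
  have l : Lin k fun t => TensorProduct.dualDistrib k H H t (x ⊗ₜ y) := by fun_prop
  conv_rhs => rw [← sm_tmul_eq (dualComul k H f)]
  rw [l.map_sm]
  rfl

/-- Threefold tensors of functionals are separated by evaluation at x, y, z, and both sides evaluate
to f(xyz). -/
theorem sm_dualComul_coassoc (f : Module.Dual k H)
    {F : Module.Dual k H → Module.Dual k H → Module.Dual k H → P}
    (h₁ : ∀ b c, Lin k fun a => F a b c) (h₂ : ∀ a c, Lin k fun b => F a b c)
    (h₃ : ∀ a b, Lin k fun c => F a b c) :
    (sm (dualComul k H f) fun g h => sm (dualComul k H g) fun g₁ g₂ => F g₁ g₂ h) =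
      sm (dualComul k H f) fun g h => sm (dualComul k H h) fun h₁ h₂ => F g h₁ h₂ := by
  let X : Module.Dual k H ⊗[k] (Module.Dual k H ⊗[k] Module.Dual k H) :=
    sm (dualComul k H f) fun g h => sm (dualComul k H g) fun g₁ g₂ => g₁ ⊗ₜ (g₂ ⊗ₜ h)
  let Y : Module.Dual k H ⊗[k] (Module.Dual k H ⊗[k] Module.Dual k H) :=
    sm (dualComul k H f) fun g h => sm (dualComul k H h) fun h₁ h₂ => g ⊗ₜ (h₁ ⊗ₜ h₂)
  have hX : X = Y := by
    refine dual_tensor_ext (V := Module.Dual k H ⊗[k] Module.Dual k H) fun x =>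
      dual_tensor_ext (V := Module.Dual k H) fun y => ?_
    simp (disch := fun_prop) only [X, Y, sm_sm, sm_tmul]
    have l : ∀ (c : k) (t : Module.Dual k H ⊗[k] Module.Dual k H),
        (sm (c • t) fun f v => f y • v) = c • sm t fun f v => f y • v := fun c t =>
      (by fun_prop : Lin k fun t : Module.Dual k H ⊗[k] Module.Dual k H =>
        sm t fun f v => f y • v).smul c t
    have l' : ∀ g h : Module.Dual k H, (sm (g ⊗ₜ[k] h) fun f v => f y • v) = g y • h := fun g h =>
      sm_tmul _ _ (by fun_prop) (by fun_prop)
    simp only [l, l']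
    ext z
    have l'' : Lin k fun f : Module.Dual k H => f z := by fun_prop
    simp only [l''.map_sm, LinearMap.smul_apply, smul_eq_mul]
    calc _ = f (x * y * z) := by
          rw [← sm_dualComul]
          refine sm_congr fun g h => ?_
          rw [← sm_dualComul, sm_mul_const]
          exact sm_congr fun _ _ => by ring
      _ = _ := by
          rw [mul_assoc, ← sm_dualComul]
          refine sm_congr fun g h => ?_
          rw [← sm_dualComul, const_mul_sm]
  have := congrArg (fun t => sm t fun a s => sm s fun b c => F a b c) hX
  simpa (disch := fun_prop) only [X, Y, sm_sm, sm_tmul] using this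

end DualComul

variable {k H : Type u} [CommRing k] [Ring H] [Algebra k H] [Coalgebra k H]
  [WeakHopfAlgebra k H] [BijectiveAntipode k H] [Module.Finite k H] [Module.Projective k H]
  {P : Type*} [AddCommGroup P] [Module k P]

local notation "δ" => Coalgebra.comul (R := k)
local notation "ε" => Coalgebra.counit (R := k)
local notation "S" => antipode (k := k) (A := H)
local notation "T" => antipodeInv k H
local notation "DH" => Double (smashWellDefined k H)
local notation "mk" => doubleMk (smashWellDefined k H)
local notation "dA" => doubleAction (smashWellDefined k H) (actionWellDefined k H)

section Lin

variable {U : Type*} [AddCommGroup U] [Module k U]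

@[fun_prop] theorem lin_doubleMk {f : U → Smash k H} (hf : Lin k f) : Lin k fun x => mk (f x) :=
  (lin_coe _).comp hf

@[fun_prop] theorem lin_doubleAction_left (M : YDMod.{u, u, u} k H) {f : U → DH} (hf : Lin k f)
    (m : M.toAlgMod) : Lin k fun x => dA M (f x) m := (lin_eval (lin_coe (dA M)) m).comp hf

@[fun_prop] theorem lin_doubleAction_right (M : YDMod.{u, u, u} k H) {f : U → M.toAlgMod}
    (hf : Lin k f) (d : DH) : Lin k fun x => dA M d (f x) := (lin_coe (dA M d)).comp hf

end Lin

theorem doubleMk_surjective : Function.Surjective mk := doubleMk₀_surjective _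

theorem doubleAction_mk (M : YDMod.{u, u, u} k H) (x : Smash k H) (m : M.toAlgMod) :
    dA M (mk x) m = smashAction M x m := rfl

theorem doubleAction_mul (M : YDMod.{u, u, u} k H) (x y : DH) (m : M.toAlgMod) :
    dA M (x * y) m = dA M x (dA M y m) := by
  obtain ⟨x, rfl⟩ := doubleMk_surjective x
  obtain ⟨y, rfl⟩ := doubleMk_surjective y
  exact (actionWellDefined k H).mul_act M x y m

theorem doubleAction_one (M : YDMod.{u, u, u} k H) (m : M.toAlgMod) : dA M 1 m = m :=
  (actionWellDefined k H).preunit_act M m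

theorem doubleAction_doubleIncl (M : YDMod.{u, u, u} k H) (h : H) (m : M.toAlgMod) :
    dA M (doubleIncl k H h) m = h • m := smashAction_tmul_counit M h m

theorem doubleAction_map {M N : YDMod.{u, u, u} k H} (f : M ⟶ N) (x : DH)
    (m : M.toAlgMod) : f.lin.hom (dA M x m) = dA N x (f.lin.hom m) := by
  obtain ⟨x, rfl⟩ := doubleMk_surjective x
  exact smashAction_map f x m

/-! ### Reconstruction of the comultiplication and counit from the modules. -/

variable (k H) in
/-- The double as a module over itself. -/
noncomputable abbrev regular : AlgMod.{u, u, u} k DH where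
  carrier := DH

variable (k H) in
theorem doubleAction_regular (x : DH) :
    dA (inverseObj (regular k H)) x (1 : DH) = x := by
  obtain ⟨x, rfl⟩ := doubleMk_surjective x
  exact (smashAction_inverseObj (regular k H) x (1 : DH)).trans (mul_one _)

/-- Elements of the double are separated by their action on Yetter-Drinfeld modules. -/
theorem double_ext {x y : DH}
    (h : ∀ (M : YDMod.{u, u, u} k H) (m : M.toAlgMod), dA M x m = dA M y m) : x = y := by
  rw [← doubleAction_regular k H x, ← doubleAction_regular k H y, h]

/-- Take the regular module twice and evaluate at 1 ⊗ 1. The second leg acts on M and the first on N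
because F reverses the tensor product. -/
theorem double_tensor_ext {X Y : DH ⊗[k] DH}
    (h : ∀ (M N : YDMod.{u, u, u} k H) (m : M.toAlgMod) (n : N.toAlgMod),
      (sm X fun p q => dA M q m ⊗ₜ[k] dA N p n) = sm Y fun p q => dA M q m ⊗ₜ[k] dA N p n) :
    X = Y := by
  have h := h (inverseObj (regular k H)) (inverseObj (regular k H)) (1 : DH) (1 : DH)
  have e : ∀ X : DH ⊗[k] DH, (sm X fun p q => dA (inverseObj (regular k H)) q (1 : DH) ⊗ₜ[k]
      dA (inverseObj (regular k H)) p (1 : DH)) = sm X fun p q => q ⊗ₜ[k] p := fun X =>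
    sm_congr fun p q => congrArg₂ (fun a b : DH => a ⊗ₜ[k] b) (doubleAction_regular k H q)
      (doubleAction_regular k H p)
  apply (TensorProduct.comm k DH DH).injective
  have key : ∀ X : DH ⊗[k] DH, TensorProduct.comm k DH DH X = sm X fun p q => q ⊗ₜ[k] p := by
    intro X
    conv_lhs => rw [← sm_tmul_eq X]
    exact map_sm _ _ _
  rw [key, key]
  exact (e X).symm.trans (h.trans (e Y))

variable (k H) in
/-- The comultiplication on `H ⋈ H*` with values in `D(H) ⊗ D(H)`. -/
noncomputable def doubleComulAux : Smash k H →ₗ[k] DH ⊗[k] DH :=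
  TensorProduct.map mk mk ∘ₗ smashComul k H

@[fun_prop] theorem lin_doubleComulAux {U : Type*} [AddCommGroup U] [Module k U]
    {f : U → Smash k H} (hf : Lin k f) : Lin k fun x => doubleComulAux k H (f x) :=
  (lin_coe _).comp hf

theorem smashComul_tmul (h : H) (f : Module.Dual k H) :
    smashComul k H (h ⊗ₜ f) = sm (δ h) fun a b => sm (dualComul k H f) fun g g' =>
      (b ⊗ₜ g) ⊗ₜ[k] (a ⊗ₜ g') := by
  change TensorProduct.tensorTensorTensorComm k H H (Module.Dual k H) (Module.Dual k H)
    (TensorProduct.comm k H H (δ h) ⊗ₜ dualComul k H f) = _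
  have e : ∀ s, Lin k fun t : H ⊗[k] H =>
      TensorProduct.tensorTensorTensorComm k H H (Module.Dual k H) (Module.Dual k H)
        (TensorProduct.comm k H H t ⊗ₜ s) := fun s =>
    (lin_equiv _).comp (lin_tmul_left ((lin_equiv _).comp lin_id) s)
  have e' : ∀ t, Lin k fun s : Module.Dual k H ⊗[k] Module.Dual k H =>
      TensorProduct.tensorTensorTensorComm k H H (Module.Dual k H) (Module.Dual k H)
        (TensorProduct.comm k H H t ⊗ₜ s) := fun s =>
    (lin_equiv _).comp (lin_tmul_right lin_id _)
  conv_lhs => rw [← sm_tmul_eq (δ h), ← sm_tmul_eq (dualComul k H f)]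
  rw [(e _).map_sm]
  refine sm_congr fun a b => ?_
  rw [(e' _).map_sm]
  rfl

theorem doubleComulAux_tmul (h : H) (f : Module.Dual k H) :
    doubleComulAux k H (h ⊗ₜ f) = sm (δ h) fun a b => sm (dualComul k H f) fun g g' =>
      mk (b ⊗ₜ g) ⊗ₜ[k] mk (a ⊗ₜ g') := by
  change TensorProduct.map mk mk (smashComul k H (h ⊗ₜ f)) = _
  rw [smashComul_tmul]
  simp only [Sweedler.map_sm, TensorProduct.map_tmul]

/-- The comultiplication describes the action on a tensor product, up to the switch map. -/
theorem incl_smashAction_tensorObj (M N : YDMod.{u, u, u} k H) (x : Smash k H) (m : M.toAlgMod)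
    (n : N.toAlgMod) :
    incl M.toAlgMod N.toAlgMod (smashAction (tensorObj M N) x (tm m n)) =
      sm (doubleComulAux k H x) fun p q => dA M q m ⊗ₜ[k] dA N p n := by
  refine lin_ext (k := k)
    (f := fun x => incl M.toAlgMod N.toAlgMod (smashAction (tensorObj M N) x (tm m n)))
    (g := fun x => sm ((doubleComulAux k H) x) fun p q => dA M q m ⊗ₜ[k] dA N p n)
    (by fun_prop) (by fun_prop) (fun h f => ?_) x
  rw [doubleComulAux_tmul, smashAction_eq_sm]
  simp (disch := fun_prop) only [sm_sm, sm_tmul]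
  have e : ∀ x : tensor M.toAlgMod N.toAlgMod,
      incl M.toAlgMod N.toAlgMod (h • x) = act H M.toAlgMod N.toAlgMod (δ h) (incl _ _ x) :=
    incl_smul _ _ h
  refine (e _).trans ?_
  refine (congrArg (fun t => act H M.toAlgMod N.toAlgMod (δ h) (incl _ _
    (sm t fun w y => f y • w))) (tensorCoact_tm M N m n)).trans ?_
  simp (disch := fun_prop) only [sm_sm, sm_tmul, Sweedler.map_sm, map_smul, incl_tm]
  have e' : ∀ x, act H M.toAlgMod N.toAlgMod (δ h) (act H M.toAlgMod N.toAlgMod (δ (1 : H)) x) =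
      act H M.toAlgMod N.toAlgMod (δ h) x := fun x => by
    rw [← Module.End.mul_apply, ← map_mul, comul_mul_one]
  simp only [e']
  simp only [act_tmul_eq_sm, doubleAction_mk, smashAction_eq_sm]
  symm
  calc _ = sm (δ h) fun a b => sm (dualComul k H f) fun g g' => sm (M.coact m) fun m₀ m₁ =>
        sm (N.coact n) fun n₀ n₁ => (g n₁ * g' m₁) • ((a • m₀) ⊗ₜ[k] (b • n₀)) := by
        refine sm_congr fun a b => sm_congr fun g g' => ?_
        rw [(by fun_prop : Lin k fun s : M.toAlgMod => (a • s) ⊗ₜ[k] (b • sm (N.coact n)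
          fun n₀ n₁ => g n₁ • n₀)).map_sm]
        refine sm_congr fun m₀ m₁ => ?_
        rw [(by fun_prop : Lin k fun s : N.toAlgMod => (a • g' m₁ • m₀) ⊗ₜ[k] (b • s)).map_sm]
        refine sm_congr fun n₀ n₁ => ?_
        rw [mul_comm, ← smul_tmul_smul, smul_comm a, smul_comm b]
    _ = sm (δ h) fun a b => sm (M.coact m) fun m₀ m₁ =>
        sm (N.coact n) fun n₀ n₁ => f (n₁ * m₁) • ((a • m₀) ⊗ₜ[k] (b • n₀)) := by
        refine sm_congr fun a b => ?_
        rw [sm_comm]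
        refine sm_congr fun m₀ m₁ => ?_
        rw [sm_comm]
        refine sm_congr fun n₀ n₁ => ?_
        rw [← sm_dualComul, (by fun_prop : Lin k fun r : k =>
          r • ((a • m₀) ⊗ₜ[k] (b • n₀))).map_sm]
    _ = _ := by
        rw [sm_comm]
        refine sm_congr fun m₀ m₁ => ?_
        rw [sm_comm]
        exact sm_congr fun n₀ n₁ => (smul_sm _ _ _).symm

/-- On M ⊗_t N, as on every Yetter-Drinfeld module, p(x) = ex acts like x. By separation the
comultiplication cannot distinguish them either, so it descends to D(H). -/
theorem doubleComulAux_smashProj (x : Smash k H) :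
    doubleComulAux k H (smashProj k H x) = doubleComulAux k H x := by
  refine double_tensor_ext fun M N m n => ?_
  rw [← incl_smashAction_tensorObj, ← incl_smashAction_tensorObj]
  congr 1
  refine ((actionWellDefined k H).mul_act (tensorObj M N) _ _ _).trans ?_
  exact (actionWellDefined k H).preunit_act _ _

variable (k H) in
/-- The comultiplication of the double. -/
noncomputable def doubleComul : DH →ₗ[k] DH ⊗[k] DH :=
  (LinearMap.ker (smashProj k H)).liftQ (doubleComulAux k H) fun x hx => by
    rw [LinearMap.mem_ker] at hx ⊢
    rw [← doubleComulAux_smashProj, hx, map_zero]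

@[fun_prop] theorem lin_doubleComul {U : Type*} [AddCommGroup U] [Module k U]
    {f : U → DH} (hf : Lin k f) : Lin k fun x => doubleComul k H (f x) :=
  (lin_coe _).comp hf

theorem smashCounit_tmul (h : H) (f : Module.Dual k H) :
    smashCounit k H (h ⊗ₜ f) = f (epsTBar k H h) := rfl

/-- Here ρ(1) = 1₍₂₎ ⊗ T(1₍₁₎), so the left side is ε(h1₍₂₎)f(T(1₍₁₎)). Flipping Δ(1) gives
ε(hS(1₍₁₎))f(1₍₂₎), and S(1₍₁₎) = ε_t(1₍₁₎) may be replaced by 1₍₁₎ under ε(h ·). As the left side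
depends only on the action, the counit descends to D(H). -/
theorem counit_smashAction_unitObj (x : Smash k H) :
    ε (unitIncl (smashAction (unitObj k H) x (unitOne (k := k) (A := H)))) = smashCounit k H x := by
  refine lin_ext (k := k)
    (f := fun x => ε (unitIncl (smashAction (unitObj k H) x (unitOne (k := k) (A := H)))))
    (g := fun x => smashCounit k H x) (by fun_prop) (by fun_prop) (fun h f => ?_) x
  rw [smashAction_eq_sm, smashCounit_tmul, epsTBar_eq_sm, Sweedler.map_sm]
  refine (congrArg (fun t : AlgMod.unit k H ⊗[k] H => ε (unitIncl (h • sm t fun w x => f x • w)))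
    (unitCoact_eq_sm _)).trans ?_
  simp (disch := fun_prop) only [sm_sm, sm_tmul, unitIncl_unitOne]
  rw [(by fun_prop : Lin k fun s : AlgMod.unit k H => ε (unitIncl (h • s))).map_sm]
  calc _ = sm (δ (1 : H)) fun a b => ε (h * b) • f (T a) := by
        refine sm_congr fun a b => ?_
        rw [smul_comm, map_smul, map_smul, smul_unitProj, unitIncl_unitProj, counit_epsT, smul_eq_mul,
          smul_eq_mul, mul_comm]
    _ = sm (δ (1 : H)) fun a b => ε (h * S a) • f b := by
        rw [sm_antipode_one_left (F := fun a b => ε (h * a) • f b)] <;> fun_prop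
    _ = _ := by
        refine sm_one_congr (by fun_prop) (by fun_prop) (by fun_prop) (by fun_prop)
          fun a b ha hb => ?_
        rw [ha.antipode_eq, counit_mul_epsT, map_smul]

theorem smashCounit_smashProj (x : Smash k H) : smashCounit k H (smashProj k H x) = smashCounit k H x := by
  rw [← counit_smashAction_unitObj, ← counit_smashAction_unitObj]
  congr 2
  refine ((actionWellDefined k H).mul_act (unitObj k H) _ _ _).trans ?_
  exact (actionWellDefined k H).preunit_act _ _

variable (k H) in
/-- The counit of the double. -/
noncomputable def doubleCounit : DH →ₗ[k] k :=
  (LinearMap.ker (smashProj k H)).liftQ (smashCounit k H) fun x hx => by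
    rw [LinearMap.mem_ker] at hx ⊢
    rw [← smashCounit_smashProj, hx, map_zero]

@[fun_prop] theorem lin_doubleCounit {U : Type*} [AddCommGroup U] [Module k U]
    {f : U → DH} (hf : Lin k f) : Lin k fun x => doubleCounit k H (f x) :=
  (lin_coe _).comp hf

theorem doubleComul_mk (h : H) (f : Module.Dual k H) :
    doubleComul k H (mk (h ⊗ₜ f)) = sm (δ h) fun a b => sm (dualComul k H f) fun g g' =>
      mk (b ⊗ₜ g) ⊗ₜ[k] mk (a ⊗ₜ g') := doubleComulAux_tmul h f

theorem doubleCounit_mk (x : Smash k H) : doubleCounit k H (mk x) = smashCounit k H x := rfl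

theorem doubleComul_coassoc (h : H) (f : Module.Dual k H) :
    TensorProduct.assoc k DH DH DH ((doubleComul k H).rTensor DH (doubleComul k H (mk (h ⊗ₜ f)))) =
      (doubleComul k H).lTensor DH (doubleComul k H (mk (h ⊗ₜ f))) := by
  rw [doubleComul_mk]
  simp only [Sweedler.map_sm, LinearMap.rTensor_tmul, LinearMap.lTensor_tmul, doubleComul_mk]
  calc _ = sm (δ h) fun a b => sm (δ b) fun c d => sm (dualComul k H f) fun f₁ f₂ =>
        sm (dualComul k H f₁) fun g₁ g₂ =>
          mk (d ⊗ₜ g₁) ⊗ₜ[k] (mk (c ⊗ₜ g₂) ⊗ₜ[k] mk (a ⊗ₜ f₂)) := by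
        refine sm_congr fun a b => ?_
        rw [sm_comm]
        refine sm_congr fun f₁ f₂ => ?_
        have l : Lin k fun t : DH ⊗[k] DH =>
          TensorProduct.assoc k DH DH DH (t ⊗ₜ[k] mk (a ⊗ₜ f₂)) := by fun_prop
        rw [l.map_sm]
        refine sm_congr fun c d => ?_
        rw [l.map_sm]
        rfl
    _ = sm (δ h) fun a b => sm (δ b) fun c d => sm (dualComul k H f) fun f₁ f₂ =>
        sm (dualComul k H f₂) fun g₁ g₂ =>
          mk (d ⊗ₜ f₁) ⊗ₜ[k] (mk (c ⊗ₜ g₁) ⊗ₜ[k] mk (a ⊗ₜ g₂)) := by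
        refine sm_congr fun a b => sm_congr fun c d => ?_
        rw [sm_dualComul_coassoc f (F := fun g₁ g₂ f₂ =>
          mk (d ⊗ₜ g₁) ⊗ₜ[k] (mk (c ⊗ₜ g₂) ⊗ₜ[k] mk (a ⊗ₜ f₂)))] <;> fun_prop
    _ = sm (δ h) fun a b => sm (δ a) fun c d => sm (dualComul k H f) fun f₁ f₂ =>
        sm (dualComul k H f₂) fun g₁ g₂ =>
          mk (b ⊗ₜ f₁) ⊗ₜ[k] (mk (d ⊗ₜ g₁) ⊗ₜ[k] mk (c ⊗ₜ g₂)) := by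
        rw [sm_coassoc h (F := fun a c d => sm (dualComul k H f) fun f₁ f₂ =>
          sm (dualComul k H f₂) fun g₁ g₂ =>
          mk (d ⊗ₜ f₁) ⊗ₜ[k] (mk (c ⊗ₜ g₁) ⊗ₜ[k] mk (a ⊗ₜ g₂)))] <;> fun_prop
    _ = _ := by
        refine sm_congr fun a b => ?_
        rw [sm_comm]
        refine sm_congr fun f₁ f₂ => ?_
        have l : Lin k fun t : DH ⊗[k] DH => mk (b ⊗ₜ f₁) ⊗ₜ[k] t := by fun_prop
        rw [l.map_sm]
        refine sm_congr fun c d => ?_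
        rw [l.map_sm]

/-- Insert Δ(1) into ρ(m). The factor ε̄_t(h₍₂₎) becomes a counit ε(h₍₂₎1₍₂₎), and regrouping Δ²(1)
leaves the counit law for Δ(h1₍₁₎). -/
theorem sm_epsTBar_coaction {M : YDMod.{u, u, u} k H} (h : H) (m : M.toAlgMod)
    {F : M.toAlgMod → H → P} (h₁ : ∀ b, Lin k fun a => F a b) (h₂ : ∀ a, Lin k fun b => F a b) :
    (sm (δ h) fun a b => sm (M.coact m) fun m₀ m₁ => F (a • m₀) (epsTBar k H b * m₁)) =
      sm (M.coact m) fun m₀ m₁ => F (h • m₀) m₁ := by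
  calc _ = sm (δ h) fun a b => sm (δ (1 : H)) fun c d => sm (M.coact m) fun m₀ m₁ =>
        F (a • c • m₀) (epsTBar k H b * d * m₁) := by
        refine sm_congr fun a b => ?_
        conv_lhs => rw [← act_one_coaction M.isYetterDrinfeld m]
        simp (disch := fun_prop) only [sm_sm, sm_tmul, mul_assoc]
    _ = sm (δ h) fun a b => sm (δ (1 : H)) fun c d => sm (δ d) fun p q => ε (b * p) •
        sm (M.coact m) fun m₀ m₁ => F (a • c • m₀) (q * m₁) := by
        refine sm_congr fun a b => sm_congr fun c d => ?_
        rw [sm_contract₃ d b (F := fun q => sm (M.coact m) fun m₀ m₁ =>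
          F (a • c • m₀) (q * m₁)) (by fun_prop)]
    _ = sm (δ (1 : H)) fun r q => sm (δ (h * r)) fun a b => ε b •
        sm (M.coact m) fun m₀ m₁ => F (a • m₀) (q * m₁) := by
        refine Eq.trans (sm_congr fun a b => (sm_coassoc (1 : H) (F := fun c p q => ε (b * p) •
          sm (M.coact m) fun m₀ m₁ => F (a • c • m₀) (q * m₁)) (by fun_prop) (by fun_prop)
            (by fun_prop)).symm) ?_
        rw [sm_comm]
        refine sm_congr fun r q => ?_
        rw [sm_comul_mul] <;> try fun_prop
        simp only [mul_smul]
    _ = _ := by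
        conv_rhs => rw [← act_one_coaction M.isYetterDrinfeld m]
        simp (disch := fun_prop) only [sm_sm, sm_tmul]
        refine sm_congr fun r q => ?_
        rw [sm_counit_right (h * r) (F := fun a => sm (M.coact m) fun m₀ m₁ =>
          F (a • m₀) (q * m₁)) (by fun_prop)]
        simp only [mul_smul]

/-- On a Yetter-Drinfeld module the left side acts by ⟨f, ε̄_t(h₍₂₎)m₍₁₎⟩h₍₁₎m₍₀₎, and
`sm_epsTBar_coaction` removes the counital map. -/
theorem doubleCounit_comul (x : DH) :
    (sm (doubleComul k H x) fun p q => doubleCounit k H p • q) = x := by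
  obtain ⟨x, rfl⟩ := doubleMk_surjective x
  refine double_ext fun M m => ?_
  refine lin_ext (k := k) (f := fun x => dA M (sm (doubleComul k H (mk x)) fun p q =>
    doubleCounit k H p • q) m) (g := fun x => dA M (mk x) m) (by fun_prop) (by fun_prop)
    (fun h f => ?_) x
  rw [doubleComul_mk]
  simp (disch := fun_prop) only [sm_sm, sm_tmul, doubleCounit_mk, smashCounit_tmul]
  have l : Lin k fun x : DH => dA M x m := by fun_prop
  simp only [l.map_sm, l.smul, doubleAction_mk, smashAction_eq_sm]
  calc _ = sm (δ h) fun a b => sm (M.coact m) fun m₀ m₁ => f (epsTBar k H b * m₁) • (a • m₀) := by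
        refine sm_congr fun a b => ?_
        refine Eq.trans (sm_congr fun g g' => ?_) ((sm_comm _ _ fun g g' m₀ m₁ =>
          (g (epsTBar k H b) * g' m₁) • (a • m₀)).trans (sm_congr fun m₀ m₁ => ?_))
        · rw [smul_sm, smul_sm]
          exact sm_congr fun m₀ m₁ => by rw [smul_comm a, smul_smul]
        · rw [← sm_dualComul, (by fun_prop : Lin k fun r : k => r • (a • m₀)).map_sm]
    _ = _ := by
        rw [sm_epsTBar_coaction h m (F := fun m₀ m₁ => f m₁ • m₀), smul_sm] <;> try fun_prop
        exact sm_congr fun m₀ m₁ => smul_comm _ _ _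

/-- The left side acts by ⟨f, m₍₁₎ε̄_t(h₍₁₎)⟩h₍₂₎m₍₀₎. The target element moves to m₍₀₎, and
h₍₂₎ε̄_t(h₍₁₎) = hS(1₍₁₎)1₍₂₎ = h. -/
theorem comul_doubleCounit (x : DH) :
    (sm (doubleComul k H x) fun p q => doubleCounit k H q • p) = x := by
  obtain ⟨x, rfl⟩ := doubleMk_surjective x
  refine double_ext fun M m => ?_
  refine lin_ext (k := k) (f := fun x => dA M (sm (doubleComul k H (mk x)) fun p q =>
    doubleCounit k H q • p) m) (g := fun x => dA M (mk x) m) (by fun_prop) (by fun_prop)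
    (fun h f => ?_) x
  rw [doubleComul_mk]
  simp (disch := fun_prop) only [sm_sm, sm_tmul, doubleCounit_mk, smashCounit_tmul]
  have l : Lin k fun x : DH => dA M x m := by fun_prop
  simp only [l.map_sm, l.smul, doubleAction_mk, smashAction_eq_sm]
  calc _ = sm (δ h) fun a b => sm (M.coact m) fun m₀ m₁ => f (m₁ * epsTBar k H a) • (b • m₀) := by
        refine sm_congr fun a b => ?_
        refine Eq.trans (sm_congr fun g g' => ?_) ((sm_comm _ _ fun g g' m₀ m₁ =>
          (g m₁ * g' (epsTBar k H a)) • (b • m₀)).trans (sm_congr fun m₀ m₁ => ?_))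
        · rw [smul_sm, smul_sm]
          exact sm_congr fun m₀ m₁ => by rw [smul_comm b, smul_smul, mul_comm]
        · rw [← sm_dualComul, (by fun_prop : Lin k fun r : k => r • (b • m₀)).map_sm]
    _ = sm (δ h) fun a b => sm (M.coact m) fun m₀ m₁ => f m₁ • ((b * epsTBar k H a) • m₀) := by
        refine sm_congr fun a b => ?_
        rw [← sm_target_smul_coaction M.isYetterDrinfeld (isTarget_epsTBar a) m
          (F := fun m₀ m₁ => f m₁ • (b • m₀))] <;> try fun_prop
        simp only [mul_smul]
    _ = sm (δ (1 : H)) fun c d => sm (M.coact m) fun m₀ m₁ => f m₁ • ((h * (S c * d)) • m₀) := by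
        rw [sm_epsTBar_left h (F := fun a b => sm (M.coact m) fun m₀ m₁ =>
          f m₁ • ((b * a) • m₀))] <;> try fun_prop
        simp only [mul_assoc]
    _ = _ := by
        rw [sm_antipode_mul (1 : H) (F := fun y => sm (M.coact m) fun m₀ m₁ =>
          f m₁ • ((h * y) • m₀)) (by fun_prop), epsS_one, mul_one, smul_sm]
        exact sm_congr fun m₀ m₁ => smul_comm _ _ _

noncomputable instance doubleCoalgebra : Coalgebra k DH where
  comul := doubleComul k H
  counit := doubleCounit k H
  coassoc := LinearMap.ext fun x => by
    obtain ⟨x, rfl⟩ := doubleMk_surjective x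
    exact lin_ext (k := k) (f := fun x => TensorProduct.assoc k DH DH DH
      ((doubleComul k H).rTensor DH (doubleComul k H (mk x))))
      (g := fun x => (doubleComul k H).lTensor DH (doubleComul k H (mk x))) (by fun_prop)
      (by fun_prop) doubleComul_coassoc x
  rTensor_counit_comp_comul := LinearMap.ext fun x => (TensorProduct.lid k DH).injective (by
    refine Eq.trans ?_ ((doubleCounit_comul x).trans (one_smul k x).symm)
    change TensorProduct.lid k DH ((doubleCounit k H).rTensor DH (doubleComul k H x)) = _
    conv_lhs => rw [← sm_tmul_eq (doubleComul k H x)]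
    rw [Sweedler.map_sm, Sweedler.map_sm]
    rfl)
  lTensor_counit_comp_comul := LinearMap.ext fun x => (TensorProduct.rid k DH).injective (by
    refine Eq.trans ?_ ((comul_doubleCounit x).trans (one_smul k x).symm)
    change TensorProduct.rid k DH ((doubleCounit k H).lTensor DH (doubleComul k H x)) = _
    conv_lhs => rw [← sm_tmul_eq (doubleComul k H x)]
    rw [Sweedler.map_sm, Sweedler.map_sm]
    rfl)

variable (k H) in
theorem isDoubleCoalgebra : IsDoubleCoalgebra (smashWellDefined k H) where
  comul_mk _ := rfl
  counit_mk _ := rfl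

end Drinfeld

namespace Sweedler

theorem sm_mul_sm {k : Type u} [CommRing k] {A B V W V' W' : Type*} [Ring A] [Algebra k A] [Ring B]
    [Algebra k B] [AddCommGroup V] [Module k V] [AddCommGroup W] [Module k W] [AddCommGroup V']
    [Module k V'] [AddCommGroup W'] [Module k W'] (t : V ⊗[k] W) (s : V' ⊗[k] W')
    (F : V → W → A ⊗[k] B) (G : V' → W' → A ⊗[k] B) :
    sm t F * sm s G = sm t fun a b => sm s fun c d => F a b * G c d := by
  simp only [sm]
  exact Finset.sum_mul_sum _ _ _ _

end Sweedler

namespace Drinfeld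

open Sweedler WeakBialgebra WeakHopfAlgebra AlgMod YDMod

/-! ### The weak bialgebra axioms for the double. -/

section DoubleWeakBialgebra

variable {k H : Type u} [CommRing k] [Ring H] [Algebra k H] [Coalgebra k H]
  [WeakHopfAlgebra k H] [BijectiveAntipode k H] [Module.Finite k H] [Module.Projective k H]
  {P : Type*} [AddCommGroup P] [Module k P]

local notation "δ" => Coalgebra.comul (R := k)
local notation "ε" => Coalgebra.counit (R := k)
local notation "T" => antipodeInv k H
local notation "DH" => Double (smashWellDefined k H)
local notation "dA" => doubleAction (smashWellDefined k H) (actionWellDefined k H)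
local notation "FO" => doubleObj (smashWellDefined k H) (actionWellDefined k H)
local notation "ι" => doubleIncl k H

@[fun_prop] theorem lin_doubleIncl {U : Type*} [AddCommGroup U] [Module k U]
    {f : U → H} (hf : Lin k f) : Lin k fun x => ι (f x) :=
  (lin_coe (doubleIncl k H).toLinearMap).comp hf

theorem incl_doubleAction_tm (M N : YDMod.{u, u, u} k H) (d : DH) (m : M.toAlgMod)
    (n : N.toAlgMod) : incl M.toAlgMod N.toAlgMod (dA (tensorObj M N) d (tm m n)) =
      sm (δ d) fun p q => dA M q m ⊗ₜ[k] dA N p n := by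
  obtain ⟨x, rfl⟩ := doubleMk_surjective d
  exact incl_smashAction_tensorObj M N x m n

theorem incl_doubleAction_proj (M N : YDMod.{u, u, u} k H) (d : DH)
    (v : M.toAlgMod ⊗[k] N.toAlgMod) :
    incl M.toAlgMod N.toAlgMod (dA (tensorObj M N) d (proj _ _ v)) =
      sm (δ d) fun p q => sm v fun m n => dA M q m ⊗ₜ[k] dA N p n := by
  refine lin_ext (k := k)
    (f := fun v => incl M.toAlgMod N.toAlgMod (dA (tensorObj M N) d (proj _ _ v)))
    (g := fun v => sm (δ d) fun p q => sm v fun m n => dA M q m ⊗ₜ[k] dA N p n)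
    (by fun_prop) (by fun_prop) (fun m n => ?_) v
  simp (disch := fun_prop) only [sm_tmul]
  exact incl_doubleAction_tm M N d m n

/-- D(H) acts on M ⊗_t N, and Δ describes this action. By separation it is multiplicative. -/
theorem double_comul_mul (x y : DH) : δ (x * y) = δ x * δ y := by
  refine double_tensor_ext fun M N m n => ?_
  rw [← incl_doubleAction_tm, doubleAction_mul, sm_mul] <;> try fun_prop
  simp only [doubleAction_mul]
  refine (congrArg (fun t => incl M.toAlgMod N.toAlgMod (dA (tensorObj M N) x t))
    (proj_incl M.toAlgMod N.toAlgMod (dA (tensorObj M N) y (tm m n))).symm).trans ?_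
  refine (incl_doubleAction_proj M N x _).trans (sm_congr fun p q => ?_)
  rw [incl_doubleAction_tm]
  simp (disch := fun_prop) only [sm_sm, sm_tmul]

/-- The inclusion of H reverses the coproduct. At h = 1 it transfers the unit axioms from H to the
double. -/
theorem comul_doubleIncl (h : H) : δ (ι h) = sm (δ h) fun a b => ι b ⊗ₜ[k] ι a := by
  refine double_tensor_ext fun M N m n => ?_
  rw [← incl_doubleAction_tm, doubleAction_doubleIncl]
  simp (disch := fun_prop) only [sm_sm, sm_tmul, doubleAction_doubleIncl]
  refine (incl_smul M.toAlgMod N.toAlgMod h (tm m n)).trans ?_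
  rw [incl_tm, ← Module.End.mul_apply, ← map_mul, comul_mul_one, act_tmul_eq_sm]

theorem comul_double_one : δ (1 : DH) = sm (δ (1 : H)) fun a b => ι b ⊗ₜ[k] ι a := by
  rw [← comul_doubleIncl, map_one (doubleIncl k H)]

theorem lTensor_comul_comul_double_one :
    (Coalgebra.comul (R := k) (A := DH)).lTensor DH (δ (1 : DH)) =
      sm (δ (1 : H)) fun a b => sm (δ b) fun c d => ι d ⊗ₜ[k] (ι c ⊗ₜ[k] ι a) := by
  rw [comul_double_one]
  simp only [Sweedler.map_sm, LinearMap.lTensor_tmul, comul_doubleIncl]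
  rw [← sm_coassoc (1 : H) (F := fun a c d => ι d ⊗ₜ[k] (ι c ⊗ₜ[k] ι a))] <;> try fun_prop
  refine sm_congr fun a b => ?_
  rw [(by fun_prop : Lin k fun s : DH ⊗[k] DH => ι b ⊗ₜ[k] s).map_sm]

theorem assoc_comul_double_one :
    TensorProduct.assoc k DH DH DH (δ (1 : DH) ⊗ₜ[k] 1) =
      sm (δ (1 : H)) fun a b => ι b ⊗ₜ[k] (ι a ⊗ₜ[k] 1) := by
  rw [comul_double_one, (by fun_prop : Lin k fun s : DH ⊗[k] DH =>
    TensorProduct.assoc k DH DH DH (s ⊗ₜ[k] 1)).map_sm]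
  rfl

theorem one_tmul_comul_double_one :
    (1 : DH) ⊗ₜ[k] δ (1 : DH) = sm (δ (1 : H)) fun a b => 1 ⊗ₜ[k] (ι b ⊗ₜ[k] ι a) := by
  rw [comul_double_one, (by fun_prop : Lin k fun s : DH ⊗[k] DH => (1 : DH) ⊗ₜ[k] s).map_sm]

/-- Because of the flip this factorization of Δ²(1) comes from the opposite one in H, and conversely
for the other axiom. -/
theorem double_comul_comul_one :
    (Coalgebra.comul (R := k) (A := DH)).lTensor DH (δ (1 : DH)) =
      TensorProduct.assoc k DH DH DH (δ (1 : DH) ⊗ₜ[k] 1) * ((1 : DH) ⊗ₜ[k] δ (1 : DH)) := by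
  rw [lTensor_comul_comul_double_one, assoc_comul_double_one, one_tmul_comul_double_one]
  refine Eq.trans ?_ (sm_mul_sm _ _ _ _).symm
  simp only [Algebra.TensorProduct.tmul_mul_tmul, one_mul, mul_one]
  rw [sm_comul_one' (fun a c d => ι d ⊗ₜ[k] (ι c ⊗ₜ[k] ι a)), sm_comm] <;> try fun_prop
  simp only [map_mul]

theorem double_comul_comul_one' :
    (Coalgebra.comul (R := k) (A := DH)).lTensor DH (δ (1 : DH)) =
      ((1 : DH) ⊗ₜ[k] δ (1 : DH)) * TensorProduct.assoc k DH DH DH (δ (1 : DH) ⊗ₜ[k] 1) := by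
  rw [lTensor_comul_comul_double_one, assoc_comul_double_one, one_tmul_comul_double_one]
  refine Eq.trans ?_ (sm_mul_sm _ _ _ _).symm
  simp only [Algebra.TensorProduct.tmul_mul_tmul, one_mul, mul_one]
  rw [sm_comul_one (fun a c d => ι d ⊗ₜ[k] (ι c ⊗ₜ[k] ι a))] <;> try fun_prop
  simp only [map_mul]

local notation "dU" => doubleAction (smashWellDefined k H) (actionWellDefined k H) (unitObj k H)

local notation "𝟭U" => unitOne (k := k) (A := H)

theorem counit_double (d : DH) : ε d = ε (unitIncl (dU d 𝟭U)) := by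
  obtain ⟨x, rfl⟩ := doubleMk_surjective d
  exact (counit_smashAction_unitObj x).symm

/-- On H_t ⊗_t H_t the unit constraints are the counit on one factor, as ε(1₍₂₎w)1₍₁₎ = ε̄_s(w). In
this form they meet the counit of the double. -/
theorem rightUnitorLin_eq_sm (X : tensor (AlgMod.unit k H) (AlgMod.unit k H)) :
    rightUnitorLin (AlgMod.unit k H) X =
      sm (incl _ _ X) fun z w => ε (unitIncl w) • z := by
  refine DFunLike.congr_fun (tensor_ext (M := AlgMod.unit k H) (N := AlgMod.unit k H)
    (f := (rightUnitorLin (AlgMod.unit k H)).toAddMonoidHom)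
    (g := ((by fun_prop : Lin k fun X : tensor (AlgMod.unit k H) (AlgMod.unit k H) =>
      sm (incl _ _ X) fun z w => ε (unitIncl w) • z).toLin).toAddMonoidHom) fun z w => ?_) X
  refine (rightUnitorLin_tm _ z w).trans ?_
  change _ = sm (incl _ _ (tm z w)) fun z w => ε (unitIncl w) • z
  rw [incl_tm, act_tmul_eq_sm]
  simp (disch := fun_prop) only [sm_sm, sm_tmul, unitIncl_smul, counit_epsT]
  rw [sm_contract₂ (1 : H) (unitIncl w) (F := fun a => a • z) (by fun_prop), one_mul]

theorem leftUnitorLin_eq_sm (X : tensor (AlgMod.unit k H) (AlgMod.unit k H)) :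
    leftUnitorLin (AlgMod.unit k H) X =
      sm (incl _ _ X) fun z w => ε (unitIncl z) • w := by
  refine DFunLike.congr_fun (tensor_ext (M := AlgMod.unit k H) (N := AlgMod.unit k H)
    (f := (leftUnitorLin (AlgMod.unit k H)).toAddMonoidHom)
    (g := ((by fun_prop : Lin k fun X : tensor (AlgMod.unit k H) (AlgMod.unit k H) =>
      sm (incl _ _ X) fun z w => ε (unitIncl z) • w).toLin).toAddMonoidHom) fun z w => ?_) X
  refine (leftUnitorLin_tm _ z w).trans ?_
  change _ = sm (incl _ _ (tm z w)) fun z w => ε (unitIncl z) • w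
  rw [incl_tm, act_tmul_eq_sm]
  simp (disch := fun_prop) only [sm_sm, sm_tmul, unitIncl_smul, counit_epsT]
  rw [sm_contract₁ (1 : H) (unitIncl z) (F := fun a => a • w) (by fun_prop), one_mul,
    epsT_unitIncl]

theorem unitIncl_smul_unitOne (u : AlgMod.unit k H) : unitIncl u • 𝟭U = u :=
  unitIncl_injective (by rw [unitIncl_smul, unitIncl_unitOne, mul_one, epsT_unitIncl])

/-- ε̄_s(u) = T(u) is a source element, so ε_t takes it to S(T(u)) = u. -/
theorem epsSBar_smul_unitOne (u : AlgMod.unit k H) : epsSBar k H (unitIncl u) • 𝟭U = u := by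
  have hz := isTarget_unitIncl u
  refine unitIncl_injective ?_
  rw [unitIncl_smul, unitIncl_unitOne, mul_one, hz.epsSBar_eq, ← hz.antipodeInv.antipode_eq,
    antipode_antipodeInv]

/-- The right unit constraint of H_t is a morphism of Yetter-Drinfeld modules, hence commutes with
d; apply it to d(1 ⊗ u). The other side uses the left constraint and u ⊗ 1. -/
theorem sm_counit_double_left (d : DH) (u : AlgMod.unit k H) :
    (sm (δ d) fun p q => ε (unitIncl (dU p u)) • dU q 𝟭U) = dU d u := by
  let f : tensorObj (unitObj k H) (unitObj k H) ⟶ unitObj k H :=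
    ⟨_, isColinear_rightUnitor (unitObj k H)⟩
  have e : ∀ X : tensor (AlgMod.unit k H) (AlgMod.unit k H),
      f.lin.hom X = sm (incl _ _ X) fun z w => ε (unitIncl w) • z := rightUnitorLin_eq_sm
  have h := doubleAction_map f d (tm 𝟭U u)
  rw [e, e] at h
  refine Eq.trans ?_ (h.trans ?_)
  · refine Eq.trans ?_ (congrArg (fun t => sm t fun (z w : AlgMod.unit k H) => ε (unitIncl w) • z)
      (incl_doubleAction_tm (unitObj k H) (unitObj k H) d 𝟭U u)).symm
    simp (disch := fun_prop) only [sm_sm, sm_tmul]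
  · congr 1
    rw [← rightUnitorLin_eq_sm, rightUnitorLin_tm, epsSBar_smul_unitOne]

theorem sm_counit_double_right (d : DH) (u : AlgMod.unit k H) :
    (sm (δ d) fun p q => ε (unitIncl (dU q u)) • dU p 𝟭U) = dU d u := by
  let f : tensorObj (unitObj k H) (unitObj k H) ⟶ unitObj k H :=
    ⟨_, isColinear_leftUnitor (unitObj k H)⟩
  have e : ∀ X : tensor (AlgMod.unit k H) (AlgMod.unit k H),
      f.lin.hom X = sm (incl _ _ X) fun z w => ε (unitIncl z) • w := leftUnitorLin_eq_sm
  have h := doubleAction_map f d (tm u 𝟭U)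
  rw [e, e] at h
  refine Eq.trans ?_ (h.trans ?_)
  · refine Eq.trans ?_ (congrArg (fun t => sm t fun (z w : AlgMod.unit k H) => ε (unitIncl z) • w)
      (incl_doubleAction_tm (unitObj k H) (unitObj k H) d u 𝟭U)).symm
    simp (disch := fun_prop) only [sm_sm, sm_tmul]
  · congr 1
    rw [← leftUnitorLin_eq_sm, leftUnitorLin_tm, unitIncl_smul_unitOne]

noncomputable instance doubleWeakBialgebra : WeakBialgebra k DH where
  comul_mul := double_comul_mul
  comul_comul_one := double_comul_comul_one
  comul_comul_one' := double_comul_comul_one'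
  counit_mul_mul a b c := by
    have l : Lin k fun u : AlgMod.unit k H => ε (unitIncl (dU a u)) := by fun_prop
    -- ε(abc) is ε of a·(b·u) with u = c·1 in H_t, and the action of b on u is expanded over Δ(b).
    rw [counit_double, doubleAction_mul, doubleAction_mul, ← sm_counit_double_right b, l.map_sm]
    conv_rhs => rw [← sm_tmul_eq (δ b), Sweedler.map_sm, Sweedler.map_sm]
    refine sm_congr fun p q => ?_
    rw [l.smul]
    simp only [TensorProduct.map_tmul, LinearMap.comp_apply, LinearMap.mulLeft_apply,
      LinearMap.mulRight_apply, LinearMap.mul'_apply, smul_eq_mul, counit_double (a * p),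
      counit_double (q * c)]
    rw [doubleAction_mul, doubleAction_mul, mul_comm]
  counit_mul_mul' a b c := by
    have l : Lin k fun u : AlgMod.unit k H => ε (unitIncl (dU a u)) := by fun_prop
    rw [counit_double, doubleAction_mul, doubleAction_mul, ← sm_counit_double_left b, l.map_sm]
    conv_rhs => rw [← sm_tmul_eq (δ b), Sweedler.map_sm, Sweedler.map_sm]
    refine sm_congr fun p q => ?_
    rw [l.smul]
    simp only [TensorProduct.map_tmul, LinearMap.comp_apply, LinearMap.mulLeft_apply,
      LinearMap.mulRight_apply, LinearMap.mul'_apply, smul_eq_mul, counit_double (a * q),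
      counit_double (p * c)]
    rw [doubleAction_mul, doubleAction_mul]

/-- `ε_t(d) = [ε̄_s(d 1) ⋈ ε]` in the double. -/
theorem epsT_double (d : DH) : epsT k DH d = ι (epsSBar k H (unitIncl (dU d 𝟭U))) := by
  rw [epsT_eq_sm, comul_double_one, epsSBar_eq_sm]
  simp (disch := fun_prop) only [sm_sm, sm_tmul]
  rw [(by fun_prop : Lin k fun s : H => ι s).map_sm]
  refine sm_congr fun a b => ?_
  rw [map_smul, counit_double, doubleAction_mul, doubleAction_doubleIncl, unitIncl_smul,
    counit_epsT]

/-- `ε̄_s(d) = [d 1 ⋈ ε]` in the double. -/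
theorem epsSBar_double (d : DH) : epsSBar k DH d = ι (unitIncl (dU d 𝟭U)) := by
  rw [epsSBar_eq_sm, comul_double_one, ← epsT_unitIncl, epsT_eq_sm]
  simp (disch := fun_prop) only [sm_sm, sm_tmul]
  rw [(by fun_prop : Lin k fun s : H => ι s).map_sm]
  refine sm_congr fun a b => ?_
  rw [map_smul, counit_double, doubleAction_mul, doubleAction_doubleIncl, unitIncl_smul,
    counit_epsT]

end DoubleWeakBialgebra

end Drinfeld

/-! ## The monoidal structure of the functor -/

namespace AlgMod

variable {k : Type u} {A : Type v} [CommRing k] [Ring A] [Algebra k A] [Coalgebra k A]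
  [WeakBialgebra k A]

theorem assocIso_inv_tm (M N P : AlgMod.{u, v, w} k A) (m : M) (n : N) (p : P) :
    (assocIso M N P).inv.hom (tm m (tm n p)) = tm (tm m n) p := by
  rw [← assocIso_tm]
  exact congrArg (fun f : tensor (tensor M N) P ⟶ _ => f.hom (tm (tm m n) p))
    (assocIso M N P).hom_inv_id

/-- The generators for the other bracketing, obtained by transport along the associator. -/
theorem tensor_hom_ext_right {M N P Q : AlgMod.{u, v, w} k A} {f g : tensor M (tensor N P) ⟶ Q}
    (h : ∀ m n p, f.hom (tm m (tm n p)) = g.hom (tm m (tm n p))) : f = g := by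
  rw [← cancel_epi (assocIso M N P).hom]
  refine tensor_hom_ext₃ fun m n p => ?_
  rw [comp_hom, comp_hom, LinearMap.comp_apply, LinearMap.comp_apply, assocIso_tm, h]

end AlgMod

namespace Drinfeld

open Sweedler WeakBialgebra WeakHopfAlgebra AlgMod YDMod

section Monoidal

variable {k H : Type u} [CommRing k] [Ring H] [Algebra k H] [Coalgebra k H]
  [WeakHopfAlgebra k H] [BijectiveAntipode k H] [Module.Finite k H] [Module.Projective k H]

local notation "δ" => Coalgebra.comul (R := k)
local notation "ε" => Coalgebra.counit (R := k)
local notation "DH" => Double (smashWellDefined k H)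
local notation "dA" => doubleAction (smashWellDefined k H) (actionWellDefined k H)
local notation "FO" => doubleObj (smashWellDefined k H) (actionWellDefined k H)
local notation "ι" => doubleIncl k H
local notation "𝟭U" => unitOne (k := k) (A := H)

/-- The switch map `F(N) ⊗ F(M) → M ⊗ N`. -/
noncomputable def switch (M N : YDMod.{u, u, u} k H) :
    FO N ⊗[k] FO M ≃ₗ[k] M.toAlgMod ⊗[k] N.toAlgMod :=
  TensorProduct.comm k N.toAlgMod M.toAlgMod

/-- `D(H)` acts on `M ⊗_t N` through the comultiplication of `D(H)` on `F(N) ⊗ F(M)`. -/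
theorem incl_doubleAction_proj_switch (M N : YDMod.{u, u, u} k H) (d : DH) (v : FO N ⊗[k] FO M) :
    incl M.toAlgMod N.toAlgMod (dA (tensorObj M N) d (proj _ _ (switch M N v))) =
      switch M N (act DH (FO N) (FO M) (δ d) v) := by
  refine lin_ext (k := k)
    (f := fun v => incl M.toAlgMod N.toAlgMod (dA (tensorObj M N) d (proj _ _ (switch M N v))))
    (g := fun v => switch M N (act DH (FO N) (FO M) (δ d) v))
    (by fun_prop) (by fun_prop) (fun n m => ?_) v
  refine (incl_doubleAction_tm M N d m n).trans ?_
  rw [act_tmul_eq_sm, Sweedler.map_sm]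
  rfl

/-- The switch map `F(N) ⊗_t F(M) → F(M ⊗_t N)` as a `k`-linear map. -/
noncomputable def switchLin (M N : YDMod.{u, u, u} k H) :
    tensor (FO N) (FO M) →ₗ[k] tensor M.toAlgMod N.toAlgMod :=
  proj M.toAlgMod N.toAlgMod ∘ₗ (switch M N).toLinearMap ∘ₗ incl (FO N) (FO M)

theorem incl_doubleAction_switchLin (M N : YDMod.{u, u, u} k H) (d : DH)
    (x : tensor (FO N) (FO M)) :
    incl M.toAlgMod N.toAlgMod (dA (tensorObj M N) d (switchLin M N x)) =
      switch M N (incl (FO N) (FO M) (d • x)) := by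
  refine (incl_doubleAction_proj_switch M N d _).trans ?_
  rw [incl_smul]

/-- At d = 1 the intertwining relation says that Δ(1) of the double acts as the flip of Δ(1) of H.
So the two submodules correspond under the switch, and the projection in `switchLin` changes
nothing. -/
theorem incl_switchLin (M N : YDMod.{u, u, u} k H) (x : tensor (FO N) (FO M)) :
    incl M.toAlgMod N.toAlgMod (switchLin M N x) = switch M N (incl (FO N) (FO M) x) := by
  have e := incl_doubleAction_switchLin M N 1 x
  rwa [doubleAction_one, one_smul] at e

theorem switchLin_smul (M N : YDMod.{u, u, u} k H) (d : DH) (x : tensor (FO N) (FO M)) :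
    switchLin M N (d • x) = dA (tensorObj M N) d (switchLin M N x) :=
  incl_injective _ _ ((incl_switchLin M N _).trans (incl_doubleAction_switchLin M N d x).symm)

theorem switchLin_tm (M N : YDMod.{u, u, u} k H) (n : N.toAlgMod) (m : M.toAlgMod) :
    switchLin M N (tm (M := FO N) (N := FO M) n m) = tm m n := by
  refine incl_injective _ _ ((incl_switchLin M N _).trans ?_)
  have e := incl_doubleAction_proj_switch M N 1 ((show FO N from n) ⊗ₜ[k] (show FO M from m))
  rw [doubleAction_one] at e
  exact e.symm

theorem switchLin_bijective (M N : YDMod.{u, u, u} k H) :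
    Function.Bijective (switchLin M N) := by
  refine ⟨fun x y h => ?_, fun y => ?_⟩
  · refine incl_injective _ _ ((switch M N).injective ?_)
    rw [← incl_switchLin, ← incl_switchLin, h]
  · refine ⟨proj _ _ ((switch M N).symm (incl _ _ y)), incl_injective _ _ ?_⟩
    rw [incl_switchLin, incl_proj, ← incl_doubleAction_proj_switch, LinearEquiv.apply_symm_apply,
      proj_incl, doubleAction_one]

/-- The switch map `F(N) ⊗_t F(M) → F(M ⊗_t N)` as a `D(H)`-linear map. -/
noncomputable def switchDoubleLin (M N : YDMod.{u, u, u} k H) :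
    tensor (FO N) (FO M) →ₗ[DH] FO (tensorObj M N) where
  toFun := switchLin M N
  map_add' := map_add (switchLin M N)
  map_smul' := switchLin_smul M N

/-- The switch isomorphism `F(N) ⊗_t F(M) ≅ F(M ⊗_t N)`. -/
noncomputable def switchIso (M N : YDMod.{u, u, u} k H) :
    tensor (FO N) (FO M) ≅ FO (tensorObj M N) :=
  isoOfEquiv (LinearEquiv.ofBijective (switchDoubleLin M N) (switchLin_bijective M N))

theorem switchIso_hom_tm (M N : YDMod.{u, u, u} k H) (n : FO N) (m : FO M) :
    (switchIso M N).hom.hom (tm n m) = tm (M := M.toAlgMod) (N := N.toAlgMod) m n :=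
  switchLin_tm M N n m

/-- The isomorphism `d ↦ d 1` from the unit object of `D(H)`-modules to `F(H_t)`. -/
noncomputable def unitSwitchLin : AlgMod.unit k DH →ₗ[DH] FO (unitObj k H) where
  toFun z := dA (unitObj k H) (unitIncl z) 𝟭U
  map_add' x y := by
    rw [map_add, map_add]
    rfl
  map_smul' d z := by
    change dA (unitObj k H) (unitIncl (d • z)) 𝟭U =
      dA (unitObj k H) d (dA (unitObj k H) (unitIncl z) 𝟭U)
    -- By `epsT_double`, ε_t(dz) acts on 1 as ε̄_s(u) with u = (dz)·1, which gives u again.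
    rw [unitIncl_smul, epsT_double, doubleAction_doubleIncl, ← doubleAction_mul]
    exact epsSBar_smul_unitOne _

theorem unitSwitchLin_bijective : Function.Bijective (unitSwitchLin (k := k) (H := H)) := by
  refine Function.bijective_iff_has_inverse.mpr
    -- The inverse is read off from `epsT_double`: an element of D(H)_t is determined by its value
    -- on 1.
    ⟨fun z : AlgMod.unit k H => unitProj (ι (epsSBar k H (unitIncl z))), fun z => ?_, fun z => ?_⟩
  · refine unitIncl_injective ?_
    have e := epsT_double (unitIncl z)
    rw [epsT_unitIncl] at e
    rw [unitIncl_unitProj]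
    refine Eq.trans (congrArg (epsT k DH) e.symm) (epsT_unitIncl z)
  · change dA (unitObj k H) (epsT k DH (ι (epsSBar k H (unitIncl (k := k) z)))) 𝟭U = z
    rw [epsT_double, doubleAction_doubleIncl, doubleAction_doubleIncl]
    refine (epsSBar_smul_unitOne (k := k) (H := H) _).trans ?_
    exact epsSBar_smul_unitOne (k := k) (H := H) z

/-- The isomorphism between the unit object of `D(H)`-modules and `F(H_t)`. -/
noncomputable def unitSwitchIso : AlgMod.unit k DH ≅ FO (unitObj k H) :=
  isoOfEquiv (LinearEquiv.ofBijective unitSwitchLin unitSwitchLin_bijective)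

/-- The functor `F`. -/
noncomputable abbrev doubleFun : YDMod.{u, u, u} k H ⥤ AlgMod.{u, u, u} k DH :=
  doubleFunctor (smashWellDefined k H) (actionWellDefined.{u, u, u} k H)

theorem switchIso_natural_left {M M' : YDMod.{u, u, u} k H} (f : M ⟶ M')
    (N : YDMod.{u, u, u} k H) :
    letI := YDMod.monoidalCategory (YDMod.tensorWellDefined k H)
    tensorMap (𝟙 (FO N)) (doubleFun.map f) ≫ (switchIso M' N).hom =
      (switchIso M N).hom ≫ doubleFun.map (MonoidalCategory.whiskerRight f N) := by
  refine tensor_hom_ext fun n m => ?_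
  refine (congrArg (switchIso M' N).hom.hom (tensorMap_tm _ _ n m)).trans ?_
  refine (switchIso_hom_tm M' N n _).trans ?_
  refine Eq.trans ?_ (congrArg (tensorMap f.lin (𝟙 N.toAlgMod)).hom
    (switchIso_hom_tm M N n m)).symm
  exact (tensorMap_tm f.lin (𝟙 N.toAlgMod) m n).symm

theorem switchIso_natural_right (M : YDMod.{u, u, u} k H) {N N' : YDMod.{u, u, u} k H}
    (f : N ⟶ N') :
    letI := YDMod.monoidalCategory (YDMod.tensorWellDefined k H)
    tensorMap (doubleFun.map f) (𝟙 (FO M)) ≫ (switchIso M N').hom =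
      (switchIso M N).hom ≫ doubleFun.map (MonoidalCategory.whiskerLeft M f) := by
  refine tensor_hom_ext fun n m => ?_
  refine (congrArg (switchIso M N').hom.hom (tensorMap_tm _ _ n m)).trans ?_
  refine (switchIso_hom_tm M N' _ m).trans ?_
  refine Eq.trans ?_ (congrArg (tensorMap (𝟙 M.toAlgMod) f.lin).hom
    (switchIso_hom_tm M N n m)).symm
  exact (tensorMap_tm (𝟙 M.toAlgMod) f.lin m n).symm

/-- On a generator both composites reverse the three factors. The inverse associator appears because
the tensor product is reversed. -/
theorem switchIso_associativity (M N P : YDMod.{u, u, u} k H) :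
    letI := YDMod.monoidalCategory (YDMod.tensorWellDefined k H)
    tensorMap (𝟙 (FO P)) (switchIso M N).hom ≫ (switchIso (tensorObj M N) P).hom ≫
        doubleFun.map (MonoidalCategory.associator M N P).hom =
      (assocIso (FO P) (FO N) (FO M)).inv ≫ tensorMap (switchIso N P).hom (𝟙 (FO M)) ≫
        (switchIso M (tensorObj N P)).hom := by
  refine tensor_hom_ext_right fun p n m => ?_
  let β := (assocIso M.toAlgMod N.toAlgMod P.toAlgMod).hom.hom
  have e₁ : (tensorMap (𝟙 (FO P)) (switchIso M N).hom).hom (tm p (tm n m)) =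
      tm p (show FO (tensorObj M N) from tm (M := M.toAlgMod) (N := N.toAlgMod) m n) :=
    (tensorMap_tm _ _ _ _).trans (congrArg (fun t => tm p t) (switchIso_hom_tm M N n m))
  have e₂ : (tensorMap (switchIso N P).hom (𝟙 (FO M))).hom (tm (tm p n) m) =
      tm (show FO (tensorObj N P) from tm (M := N.toAlgMod) (N := P.toAlgMod) n p) m :=
    (tensorMap_tm _ _ _ _).trans (congrArg (fun t => tm t m) (switchIso_hom_tm N P p n))
  have e₃ := assocIso_inv_tm (FO P) (FO N) (FO M) p n m
  refine (congrArg (fun t => β ((switchIso (tensorObj M N) P).hom.hom t)) e₁).trans ?_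
  refine (congrArg β (switchIso_hom_tm (tensorObj M N) P p _)).trans ?_
  refine (assocIso_tm M.toAlgMod N.toAlgMod P.toAlgMod m n p).trans ?_
  symm
  refine (congrArg (fun t => (switchIso M (tensorObj N P)).hom.hom
    ((tensorMap (switchIso N P).hom (𝟙 (FO M))).hom t)) e₃).trans ?_
  refine (congrArg (switchIso M (tensorObj N P)).hom.hom e₂).trans ?_
  exact switchIso_hom_tm M (tensorObj N P) _ m

/-- The right constraint of D(H)-modules acts by ε̄_s(z) = [z·1 ⋈ ε], which is the left constraint
of H-modules for z·1 ∈ H_t. The other unit law uses `epsT_double` in the same way. -/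
theorem switchIso_left_unitality (M : YDMod.{u, u, u} k H) :
    letI := YDMod.monoidalCategory (YDMod.tensorWellDefined k H)
    (MonoidalCategory.rightUnitor (FO M)).hom =
      tensorMap (𝟙 (FO M)) unitSwitchIso.hom ≫ (switchIso (unitObj k H) M).hom ≫
        doubleFun.map (MonoidalCategory.leftUnitor M).hom := by
  refine tensor_hom_ext fun m z => ?_
  refine (rightUnitorLin_tm (FO M) m z).trans ?_
  symm
  let β := leftUnitorLin M.toAlgMod
  refine (congrArg (fun t => β ((switchIso (unitObj k H) M).hom.hom t))
    (tensorMap_tm _ _ m z)).trans ?_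
  refine (congrArg β (switchIso_hom_tm (unitObj k H) M m _)).trans ?_
  refine (leftUnitorLin_tm M.toAlgMod _ m).trans ?_
  rw [epsSBar_double]
  exact (doubleAction_doubleIncl M _ m).symm

theorem switchIso_right_unitality (M : YDMod.{u, u, u} k H) :
    letI := YDMod.monoidalCategory (YDMod.tensorWellDefined k H)
    (MonoidalCategory.leftUnitor (FO M)).hom =
      tensorMap unitSwitchIso.hom (𝟙 (FO M)) ≫ (switchIso M (unitObj k H)).hom ≫
        doubleFun.map (MonoidalCategory.rightUnitor M).hom := by
  refine tensor_hom_ext fun z m => ?_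
  refine (leftUnitorLin_tm (FO M) z m).trans ?_
  symm
  let β := rightUnitorLin M.toAlgMod
  refine (congrArg (fun t => β ((switchIso M (unitObj k H)).hom.hom t))
    (tensorMap_tm _ _ z m)).trans ?_
  refine (congrArg β (switchIso_hom_tm M (unitObj k H) _ m)).trans ?_
  refine (rightUnitorLin_tm M.toAlgMod m _).trans ?_
  rw [← epsT_unitIncl z, epsT_double]
  exact (doubleAction_doubleIncl M _ m).symm

variable (k H) in
/-- The strong monoidal structure of `F` given by the switch maps. -/
noncomputable def doubleCoreMonoidal :
    letI := YDMod.monoidalCategory (YDMod.tensorWellDefined k H)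
    (doubleFunctor (smashWellDefined k H) (actionWellDefined.{u, u, u} k H) ⋙
      mopFunctor (AlgMod.{u, u, u} k DH)).CoreMonoidal :=
  letI := YDMod.monoidalCategory (YDMod.tensorWellDefined k H)
  { εIso := unitSwitchIso.mop
    μIso := fun M N => (switchIso M N).mop
    μIso_hom_natural_left := fun f N => Quiver.Hom.unmop_inj (switchIso_natural_left f N)
    μIso_hom_natural_right := fun M f => Quiver.Hom.unmop_inj (switchIso_natural_right M f)
    associativity := fun M N P => Quiver.Hom.unmop_inj (switchIso_associativity M N P)
    left_unitality := fun M => Quiver.Hom.unmop_inj (switchIso_left_unitality M)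
    right_unitality := fun M => Quiver.Hom.unmop_inj (switchIso_right_unitality M) }

end Monoidal

end Drinfeld

theorem proposition4p5 {k H : Type u} [CommRing k] [Ring H] [Algebra k H] [Coalgebra k H]
    [WeakHopfAlgebra k H] [WeakHopfAlgebra.BijectiveAntipode k H]
    [Module.Finite k H] [Module.Projective k H] :
    ∃ (hD : Drinfeld.SmashWellDefined k H) (_ : Coalgebra k (Drinfeld.Double hD))
      (_ : WeakBialgebra k (Drinfeld.Double hD)) (_ : Drinfeld.IsDoubleCoalgebra hD)
      (hY : YDMod.TensorWellDefined k H) (hF : Drinfeld.ActionWellDefined.{u, u, u} k H),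
      IsIsomorphismOfCategories (Drinfeld.doubleFunctor hD hF) ∧
      letI := YDMod.monoidalCategory hY
      ∃ _ : (Drinfeld.doubleFunctor hD hF ⋙
          mopFunctor (AlgMod.{u, u, u} k (Drinfeld.Double hD))).Monoidal,
        ∀ M N : YDMod.{u, u, u} k H,
          Drinfeld.IsSwitch hD hY hF M N
            (Functor.LaxMonoidal.μ (Drinfeld.doubleFunctor hD hF ⋙
              mopFunctor (AlgMod.{u, u, u} k (Drinfeld.Double hD))) M N).unmop := by
  exact ⟨Drinfeld.smashWellDefined k H, Drinfeld.doubleCoalgebra, Drinfeld.doubleWeakBialgebra,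
    Drinfeld.isDoubleCoalgebra k H, YDMod.tensorWellDefined k H, Drinfeld.actionWellDefined k H,
    Drinfeld.isIsomorphismOfCategories_doubleFunctor,
    letI := YDMod.monoidalCategory (YDMod.tensorWellDefined k H)
    (Drinfeld.doubleCoreMonoidal k H).toMonoidal, fun M N => Drinfeld.incl_switchLin M N⟩
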